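/- Let $\chi:\mathbb R\to\mathbb R$ be smooth with $\chi=0$ on $(-\infty,0]$, $\chi=1$ on $[1,\infty)$ and $\chi'\ge 0$. Let $V=\{f\in C(\mathbb R)\cap L^\infty(\mathbb R): f_\xi\in L^2(\mathbb R)\}$ with norm $\|f\|_{L^\infty}+\|f_\xi\|_{L^2}$, and let $H_{0,\infty}(\mathbb R)$ be the space of all $U=\bar u+c\chi$ with $\bar u\in H^1(\mathbb R)$, $c\in\mathbb R$, with norm $\|\bar u\|_{H^1}+|c|$. Put $E=V\times H_{0,\infty}(\mathbb R)\times L^2(\mathbb R)$, with the sum of the norms. For $X=(\zeta,U,h)\in E$ write $y(\xi)=\xi+\zeta(\xi)$, $\bar U=U-c\,\chi\circ y$, and $$P(\xi)=\tfrac14\int_{\mathbb R}e^{-|y(\xi)-y(\eta)|}\big((2\bar U^2+4c\bar U\chi\circ y)y_\xi+h\big)(\eta)\,d\eta+c^2g(y(\xi)),$$ $$Q(\xi)=-\tfrac14\int_{\mathbb R}\operatorname{sign}(\xi-\eta)e^{-|y(\xi)-y(\eta)|}\big((2\bar U^2+4c\bar U\chi\circ y)y_\xi+h\big)(\eta)\,d\eta+c^2g'(y(\xi)),$$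 where $g(x)=\chi^2(x)+\frac12\int_{\mathbb R}e^{-|x-z|}(2\chi'^2+2\chi\chi'')(z)\,dz$. Consider the system $$y_t=U,\qquad U_t=-Q,\qquad h_t=2(U^2-P)U_\xi. \tag{1}$$ Let $\mathcal G$ be the set of $(\zeta,U,h)\in E$ with $\zeta,U\in W^{1,\infty}(\mathbb R)$, $h\in L^\infty(\mathbb R)$ and, almost everywhere, $y_\xi\ge0$, $h\ge0$, $y_\xi+h>0$, $y_\xi h=U_\xi^2$. Let $G$ be the group (under composition) of homeomorphisms $f$ of $\mathbb R$ such that $f-\mathrm{id}$ and $f^{-1}-\mathrm{id}$ belong to $W^{1,\infty}(\mathbb R)$ and $f_\xi-1\in L^2(\mathbb R)$. Let $\mathcal F$ be the set of $X=(y,U,h)\in\mathcal G$ with $y+H\in G$, where $H(\xi)=\int_{-\infty}^\xi h\,d\tau$. The group $G$ acts on $\mathcal F$ from the right by $X\circ f=(y\circ f,\,U\circ f,\,(h\circ f)f_\xi)$. Let $\mathcal F/G$ be the quotient, $[X]$ the class of $X$, $\Gamma(X)=X\circ(y+H)^{-1}$, and equip $\mathcal F/G$ with the metric $d_{\mathcal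 F/G}([X],[X'])=\|\Gamma(X)-\Gamma(X')\|_E$. Let $S_t:\mathcal F\to\mathcal F$, $t\ge0$, be the flow of (1): for each $X_0\in\mathcal F$, the curve $t\mapsto S_t(X_0)$ lies in $\mathcal F$ and is the unique solution of (1) in $C^1([0,\infty),E)$ with values in $\mathcal G$ and initial value $X_0$. (The existence of this flow is part of the claim.) Then $S_t$ is $G$-equivariant, that is, $$S_t(X\circ f)=S_t(X)\circ f\qquad\text{for all } t\ge0,\ X\in\mathcal F,\ f\in G.$$ Hence the mapping $\tilde S_t:\mathcal F/G\to\mathcal F/G$, $\tilde S_t([X])=[S_t(X)]$, is well defined. The maps $\tilde S_t$ form a continuous semigroup on $(\mathcal F/G,d_{\mathcal F/G})$: $\tilde S_0=\mathrm{id}$, $\tilde S_{s+t}=\tilde S_s\circ\tilde S_t$ for all $s,t\ge0$, and $(t,a)\mapsto\tilde S_t(a)$ is continuous from $[0,\infty)\times\mathcal F/G$ to $\mathcal F/G$. -/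

import Mathlib

open MeasureTheory Set Filter Topology
open scoped ENNReal NNReal ContDiff

namespace CamassaHolm

noncomputable section

/-! ### Sobolev-type spaces on the line -/

/-- `f` is locally absolutely continuous on `ℝ`.  These are exactly the continuous functions with a
locally integrable weak derivative, and the weak derivative is then `deriv f` (a.e.). -/
def LocAC (f : ℝ → ℝ) : Prop := ∀ a b : ℝ, AbsolutelyContinuousOnInterval f a b

/-- `f ∈ L^p(ℝ)` and `f_ξ ∈ L^q(ℝ)` (`f` is the continuous representative).
`MemSob p p` is `W^{1,p}(ℝ)`; `MemSob ∞ 2` is membership in `V`. -/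
structure MemSob (p q : ℝ≥0∞) (f : ℝ → ℝ) : Prop where
  locAC : LocAC f
  memLp : MemLp f p volume
  memLp_deriv : MemLp (deriv f) q volume

lemma LocAC.continuous {f : ℝ → ℝ} (hf : LocAC f) : Continuous f := by
  rw [continuous_iff_continuousAt]
  intro x
  refine (hf (x - 1) (x + 1)).continuousOn.continuousAt ?_
  rw [uIcc_of_le (by linarith)]
  exact Icc_mem_nhds (by linarith) (by linarith)

lemma LocAC.ae_differentiableAt {f : ℝ → ℝ} (hf : LocAC f) :
    ∀ᵐ x : ℝ, DifferentiableAt ℝ f x := by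
  have h : ∀ᵐ x : ℝ, ∀ n : ℕ, x ∈ uIcc (-(n : ℝ)) n → DifferentiableAt ℝ f x :=
    ae_all_iff.2 fun n => (hf (-n) n).ae_differentiableAt
  filter_upwards [h] with x hx
  obtain ⟨n, hn⟩ := exists_nat_ge |x|
  refine hx n ?_
  rw [uIcc_of_le (by linarith [abs_nonneg x])]
  exact abs_le.1 hn

lemma LocAC.add {f g : ℝ → ℝ} (hf : LocAC f) (hg : LocAC g) : LocAC (f + g) :=
  fun a b => (hf a b).add (hg a b)

lemma LocAC.const_mul {f : ℝ → ℝ} (c : ℝ) (hf : LocAC f) : LocAC (fun x => c * f x) :=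
  fun a b => (hf a b).const_mul c

lemma LocAC.of_lipschitz {f : ℝ → ℝ} {K : ℝ≥0} (hf : LipschitzWith K f) : LocAC f :=
  fun _ _ => hf.lipschitzOnWith.absolutelyContinuousOnInterval

lemma LocAC.deriv_add {f g : ℝ → ℝ} (hf : LocAC f) (hg : LocAC g) :
    deriv (f + g) =ᵐ[volume] deriv f + deriv g := by
  filter_upwards [hf.ae_differentiableAt, hg.ae_differentiableAt] with x h1 h2
  exact _root_.deriv_add h1 h2

lemma LocAC.comp {f g : ℝ → ℝ} {K : ℝ≥0} (hf : LocAC f) (hg : LipschitzWith K g)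
    (hm : Monotone g) : LocAC (f ∘ g) := by
  intro a b
  rw [absolutelyContinuousOnInterval_iff]
  intro ε hε
  obtain ⟨δ, hδ, H⟩ := (absolutelyContinuousOnInterval_iff f _ _).1 (hf (g a) (g b)) ε hε
  refine ⟨δ / (K + 1), by positivity, fun E hE hs => ?_⟩
  refine H (E.1, fun i => (g (E.2 i).1, g (E.2 i).2)) ⟨fun i hi => ?_, ?_⟩ ?_
  · have := hE.1 i hi
    exact ⟨hm.image_uIcc_subset (mem_image_of_mem g this.1),
      hm.image_uIcc_subset (mem_image_of_mem g this.2)⟩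
  · intro i hi j hj hij
    have h := hE.2 hi hj hij
    simp only [Function.onFun, uIoc, ← hm.map_min, ← hm.map_max] at h ⊢
    rw [Ioc_disjoint_Ioc] at h ⊢
    rw [← hm.map_min, ← hm.map_max]
    exact hm h
  · calc ∑ i ∈ Finset.range E.1, dist (g (E.2 i).1) (g (E.2 i).2)
        ≤ ∑ i ∈ Finset.range E.1, K * dist (E.2 i).1 (E.2 i).2 :=
          Finset.sum_le_sum fun i _ => hg.dist_le_mul _ _
      _ = K * ∑ i ∈ Finset.range E.1, dist (E.2 i).1 (E.2 i).2 := by rw [Finset.mul_sum]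
      _ ≤ K * (δ / (K + 1)) := by gcongr
      _ < δ := by
          rw [mul_div_assoc', div_lt_iff₀ (by positivity)]
          nlinarith [K.2]

lemma MemSob.add {p q : ℝ≥0∞} {f g : ℝ → ℝ} (hf : MemSob p q f) (hg : MemSob p q g) :
    MemSob p q (f + g) :=
  ⟨hf.locAC.add hg.locAC, hf.memLp.add hg.memLp,
    (hf.memLp_deriv.add hg.memLp_deriv).ae_eq (hf.locAC.deriv_add hg.locAC).symm⟩

lemma MemSob.const_mul {p q : ℝ≥0∞} {f : ℝ → ℝ} (c : ℝ) (hf : MemSob p q f) :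
    MemSob p q (fun x => c * f x) := by
  refine ⟨hf.locAC.const_mul c, hf.memLp.const_mul c, ?_⟩
  have : deriv (fun x => c * f x) = fun x => c * deriv f x := by
    ext x; exact deriv_const_mul_field c
  rw [this]
  exact hf.memLp_deriv.const_mul c

lemma MemSob.zero (p q : ℝ≥0∞) : MemSob p q (0 : ℝ → ℝ) := by
  refine ⟨LocAC.of_lipschitz (K := 0) (LipschitzWith.const (0 : ℝ)), MemLp.zero, ?_⟩
  have : deriv (0 : ℝ → ℝ) = 0 := by ext x; exact deriv_const x 0
  rw [this]; exact MemLp.zero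

/-- A bounded Lipschitz function is in `W^{1,∞}`. -/
lemma MemSob.of_lipschitz {f : ℝ → ℝ} {K : ℝ≥0} {C : ℝ} (hf : LipschitzWith K f)
    (hC : ∀ x, |f x| ≤ C) : MemSob ∞ ∞ f :=
  ⟨LocAC.of_lipschitz hf, memLp_top_of_bound hf.continuous.aestronglyMeasurable C (ae_of_all _ hC),
    memLp_top_of_bound (measurable_deriv f).aestronglyMeasurable K
      (ae_of_all _ fun _ => norm_deriv_le_of_lipschitz hf)⟩

lemma ae_bound_of_memLp_top {f : ℝ → ℝ} (hf : MemLp f ∞ volume) :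
    ∃ C : ℝ, ∀ᵐ x : ℝ, |f x| ≤ C := by
  refine ⟨(eLpNorm f ∞ volume).toReal, ?_⟩
  have h : ∀ᵐ x : ℝ, ‖f x‖ₑ ≤ eLpNorm f ∞ volume := by
    rw [eLpNorm_exponent_top]; exact ae_le_eLpNormEssSup
  filter_upwards [h] with x hx
  rw [← Real.norm_eq_abs, ← toReal_enorm]
  exact ENNReal.toReal_mono hf.2.ne hx

lemma bound_of_memLp_top {f : ℝ → ℝ} (hc : Continuous f) (hf : MemLp f ∞ volume) :
    ∃ C : ℝ, ∀ x, |f x| ≤ C := by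
  obtain ⟨C, hC⟩ := ae_bound_of_memLp_top hf
  refine ⟨C, ?_⟩
  have hd : Dense {x | |f x| ≤ C} := Measure.dense_of_ae hC
  have hcl : IsClosed {x | |f x| ≤ C} := isClosed_le hc.abs continuous_const
  intro x
  have : x ∈ closure {x | |f x| ≤ C} := hd x
  rwa [hcl.closure_eq] at this

lemma MemSob.lipschitz {p : ℝ≥0∞} {f : ℝ → ℝ} (hf : MemSob p ∞ f) :
    ∃ K : ℝ≥0, LipschitzWith K f := by
  obtain ⟨C, hC⟩ := ae_bound_of_memLp_top hf.memLp_deriv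
  refine ⟨C.toNNReal, LipschitzWith.of_dist_le_mul fun a b => ?_⟩
  rw [dist_comm, dist_comm a b, Real.dist_eq, Real.dist_eq,
    ← (hf.locAC a b).integral_deriv_eq_sub]
  have := intervalIntegral.norm_integral_le_of_norm_le_const_ae (a := a) (b := b)
    (f := deriv f) (C := C.toNNReal) (by
      filter_upwards [hC] with x hx _
      exact hx.trans (Real.le_coe_toNNReal C))
  exact this

/-! ### The group of relabelings -/

/-- `f - id` and `f⁻¹ - id` belong to `W^{1,∞}(ℝ)` and `f_ξ - 1` belongs to `L²(ℝ)`. -/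
structure IsRelabeling (f : ℝ ≃ₜ ℝ) : Prop where
  memSob : MemSob ∞ ∞ (fun x => f x - x)
  memSob_symm : MemSob ∞ ∞ (fun x => f.symm x - x)
  memLp_deriv : MemLp (fun x => deriv f x - 1) 2 volume

lemma lipschitz_of_sub_id {f : ℝ → ℝ} (hf : MemSob ∞ ∞ (fun x => f x - x)) :
    ∃ K : ℝ≥0, LipschitzWith K f := by
  obtain ⟨K, hK⟩ := hf.lipschitz
  refine ⟨K + 1, ?_⟩
  have := hK.add LipschitzWith.id
  simpa using this

lemma IsRelabeling.strictMono {f : ℝ ≃ₜ ℝ} (hf : IsRelabeling f) : StrictMono f := by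
  rcases f.continuous.strictMono_of_inj f.injective with h | h
  · exact h
  exfalso
  obtain ⟨C, hC⟩ := bound_of_memLp_top hf.memSob.locAC.continuous hf.memSob.memLp
  have h1 := abs_le.1 (hC (|C| + 1))
  have h2 := abs_le.1 (hC (-(|C| + 1)))
  have h3 : f (|C| + 1) < f (-(|C| + 1)) := h (by linarith [abs_nonneg C])
  linarith [le_abs_self C, neg_abs_le C]

lemma volume_image_le {g : ℝ → ℝ} {K : ℝ≥0} (hg : LipschitzWith K g) (s : Set ℝ) :
    volume (g '' s) ≤ K * volume s := by
  have := hg.hausdorffMeasure_image_le (d := 1) zero_le_one s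
  simpa [hausdorffMeasure_real] using this

lemma map_volume_le {f : ℝ ≃ₜ ℝ} {K : ℝ≥0} (hf : LipschitzWith K f.symm) :
    volume.map f ≤ (K : ℝ≥0∞) • (volume : Measure ℝ) := by
  refine Measure.le_iff.2 fun s hs => ?_
  rw [Measure.map_apply f.measurable hs, ← f.image_symm]
  simpa using volume_image_le hf s

lemma quasi_of_lipschitz {f : ℝ ≃ₜ ℝ} {K : ℝ≥0} (hf : LipschitzWith K f.symm) :
    Measure.QuasiMeasurePreserving f volume volume :=
  ⟨f.measurable, Measure.absolutelyContinuous_of_le_smul (map_volume_le hf)⟩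

lemma memLp_comp {f : ℝ ≃ₜ ℝ} {K : ℝ≥0} (hf : LipschitzWith K f.symm) {p : ℝ≥0∞} {u : ℝ → ℝ}
    (hu : MemLp u p volume) : MemLp (fun x => u (f x)) p volume :=
  (hu.of_measure_le_smul ENNReal.coe_ne_top (map_volume_le hf)).comp_of_map
    f.measurable.aemeasurable

lemma memLp_mul_deriv {f : ℝ → ℝ} {K : ℝ≥0} (hf : LipschitzWith K f) {p : ℝ≥0∞} {u : ℝ → ℝ}
    (hu : MemLp u p volume) : MemLp (fun x => u x * deriv f x) p volume := by
  refine hu.of_le_mul (c := K)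
    (hu.1.mul (measurable_deriv f).aestronglyMeasurable) (ae_of_all _ fun x => ?_)
  rw [norm_mul, mul_comm]
  exact mul_le_mul_of_nonneg_right (norm_deriv_le_of_lipschitz hf) (norm_nonneg _)

/-- Almost-everywhere chain rule for a bi-Lipschitz change of variables. -/
lemma ae_deriv_comp {f : ℝ ≃ₜ ℝ} {K K' : ℝ≥0} (hf : LipschitzWith K f)
    (hf' : LipschitzWith K' f.symm) {u : ℝ → ℝ} (hu : ∀ᵐ x : ℝ, DifferentiableAt ℝ u x) :
    deriv (fun x => u (f x)) =ᵐ[volume] fun x => deriv u (f x) * deriv f x := by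
  filter_upwards [(quasi_of_lipschitz hf').ae hu, hf.ae_differentiableAt_real] with x h1 h2
  exact deriv_comp x h1 h2

lemma MemSob.comp {p q : ℝ≥0∞} {f : ℝ ≃ₜ ℝ} {K K' : ℝ≥0} (hf : LipschitzWith K f)
    (hf' : LipschitzWith K' f.symm) (hm : Monotone f) {u : ℝ → ℝ} (hu : MemSob p q u) :
    MemSob p q (fun x => u (f x)) :=
  ⟨hu.locAC.comp hf hm, memLp_comp hf' hu.memLp,
    (memLp_mul_deriv hf (memLp_comp hf' hu.memLp_deriv)).ae_eq
      (ae_deriv_comp hf hf' hu.locAC.ae_differentiableAt).symm⟩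

lemma IsRelabeling.one : IsRelabeling 1 := by
  have h : MemSob ∞ ∞ (fun x : ℝ => (1 : ℝ ≃ₜ ℝ) x - x) := by
    have : (fun x : ℝ => (1 : ℝ ≃ₜ ℝ) x - x) = 0 := by ext x; exact sub_self x
    rw [this]; exact MemSob.zero _ _
  refine ⟨h, h, ?_⟩
  have : (fun x : ℝ => deriv (1 : ℝ ≃ₜ ℝ) x - 1) = 0 := by
    ext x
    have h1 : ((1 : ℝ ≃ₜ ℝ) : ℝ → ℝ) = id := rfl
    rw [h1, deriv_id]; exact sub_self 1
  rw [this]; exact MemLp.zero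

lemma IsRelabeling.inv {f : ℝ ≃ₜ ℝ} (hf : IsRelabeling f) : IsRelabeling f⁻¹ := by
  refine ⟨hf.memSob_symm, hf.memSob, ?_⟩
  obtain ⟨K, hK⟩ := lipschitz_of_sub_id hf.memSob
  obtain ⟨K', hK'⟩ := lipschitz_of_sub_id hf.memSob_symm
  have h1 : MemLp (fun x => deriv f (f.symm x) - 1) 2 volume :=
    memLp_comp (f := f.symm) hK hf.memLp_deriv
  have h2 := memLp_mul_deriv hK' h1
  refine h2.neg.ae_eq ?_
  have hd : ∀ᵐ x : ℝ, DifferentiableAt ℝ f x := hK.ae_differentiableAt_real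
  filter_upwards [ae_deriv_comp (f := f.symm) hK' hK hd] with x hx
  have h3 : (fun x => f (f.symm x)) = id := by ext x; exact f.apply_symm_apply x
  rw [h3, deriv_id] at hx
  have h4 : (⇑(f⁻¹) : ℝ → ℝ) = f.symm := rfl
  simp only [Pi.neg_apply, h4]
  linarith

lemma IsRelabeling.mul {f g : ℝ ≃ₜ ℝ} (hf : IsRelabeling f) (hg : IsRelabeling g) :
    IsRelabeling (f * g) := by
  obtain ⟨K, hK⟩ := lipschitz_of_sub_id hf.memSob
  obtain ⟨K', hK'⟩ := lipschitz_of_sub_id hf.memSob_symm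
  obtain ⟨L, hL⟩ := lipschitz_of_sub_id hg.memSob
  obtain ⟨L', hL'⟩ := lipschitz_of_sub_id hg.memSob_symm
  have hfi := hf.inv.strictMono
  have e : (⇑(f * g) : ℝ → ℝ) = fun x => f (g x) := rfl
  have e' : (⇑(f * g).symm : ℝ → ℝ) = fun x => g.symm (f.symm x) := rfl
  refine ⟨?_, ?_, ?_⟩
  · convert (MemSob.comp hL hL' hg.strictMono.monotone hf.memSob).add hg.memSob using 1
    ext x; simp
  · convert (MemSob.comp (f := f.symm) hK' hK hfi.monotone hg.memSob_symm).add
      hf.memSob_symm using 1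
    ext x; simp [e']
  · have h1 := (memLp_mul_deriv hL (memLp_comp hL' hf.memLp_deriv)).add hg.memLp_deriv
    refine h1.ae_eq ?_
    filter_upwards [ae_deriv_comp hL hL' hK.ae_differentiableAt_real] with x hx
    rw [e, hx]
    simp only [Pi.add_apply]; ring

/-- The group `G` of relabeling functions, as a subgroup of the homeomorphisms of `ℝ`
(multiplication is composition). -/
def relabelingGroup : Subgroup (ℝ ≃ₜ ℝ) where
  carrier := {f | IsRelabeling f}
  mul_mem' := IsRelabeling.mul
  one_mem' := IsRelabeling.one
  inv_mem' := IsRelabeling.inv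

/-- The type of elements of `G`. -/
abbrev Relabeling : Type := relabelingGroup

/-! ### The Banach spaces `V`, `H¹` and `E` -/

/-- The vector space of all `f` with `f ∈ L^p` and `f_ξ ∈ L^q`. -/
def sobSubmodule (p q : ℝ≥0∞) : Submodule ℝ (ℝ → ℝ) where
  carrier := {f | MemSob p q f}
  add_mem' := MemSob.add
  zero_mem' := MemSob.zero p q
  smul_mem' c _ hf := hf.const_mul c

/-- The space of all `f ∈ L^p` with `f_ξ ∈ L^q`, normed by the `ℓ^r`-norm of
`(‖f‖_{L^p}, ‖f_ξ‖_{L^q})`. -/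
def Sob (_r p q : ℝ≥0∞) : Type := sobSubmodule p q

variable {r p q : ℝ≥0∞}

instance : AddCommGroup (Sob r p q) := inferInstanceAs (AddCommGroup (sobSubmodule p q))
instance : Module ℝ (Sob r p q) := inferInstanceAs (Module ℝ (sobSubmodule p q))
instance : FunLike (Sob r p q) ℝ ℝ := ⟨fun f => Subtype.val f, Subtype.val_injective⟩

lemma Sob.memSob (f : Sob r p q) : MemSob p q f := f.2

@[ext] lemma Sob.ext {f g : Sob r p q} (h : ∀ x, f x = g x) : f = g := DFunLike.ext _ _ h

/-- The element of `Sob r p q` given by a function. -/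
def Sob.mk {u : ℝ → ℝ} (hu : MemSob p q u) : Sob r p q := (⟨u, hu⟩ : sobSubmodule p q)

@[simp] lemma Sob.mk_apply {u : ℝ → ℝ} (hu : MemSob p q u) (x : ℝ) :
    (Sob.mk hu : Sob r p q) x = u x := rfl

@[simp] lemma Sob.coe_add (f g : Sob r p q) : ⇑(f + g) = ⇑f + ⇑g := rfl
@[simp] lemma Sob.coe_smul (c : ℝ) (f : Sob r p q) : ⇑(c • f) = c • ⇑f := rfl
@[simp] lemma Sob.coe_sub (f g : Sob r p q) : ⇑(f - g) = ⇑f - ⇑g := rfl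
@[simp] lemma Sob.coe_zero : ⇑(0 : Sob r p q) = 0 := rfl

/-- `f ↦ (f, f_ξ)`, which defines the norm. -/
def Sob.toPair (r p q : ℝ≥0∞) : Sob r p q →ₗ[ℝ]
    WithLp r (Lp ℝ p (volume : Measure ℝ) × Lp ℝ q (volume : Measure ℝ)) where
  toFun f := WithLp.toLp r (f.memSob.memLp.toLp f, f.memSob.memLp_deriv.toLp (deriv f))
  map_add' f g := by
    refine congrArg (WithLp.toLp r) (Prod.ext ?_ ?_)
    · exact MemLp.toLp_add f.memSob.memLp g.memSob.memLp
    · exact ((MemLp.toLp_eq_toLp_iff (f + g).memSob.memLp_deriv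
        (f.memSob.memLp_deriv.add g.memSob.memLp_deriv)).2
          (f.memSob.locAC.deriv_add g.memSob.locAC)).trans
            (MemLp.toLp_add f.memSob.memLp_deriv g.memSob.memLp_deriv)
  map_smul' c f := by
    refine congrArg (WithLp.toLp r) (Prod.ext ?_ ?_)
    · exact MemLp.toLp_const_smul c f.memSob.memLp
    · exact ((MemLp.toLp_eq_toLp_iff (c • f).memSob.memLp_deriv
        (f.memSob.memLp_deriv.const_smul c)).2
          (ae_of_all _ fun x => deriv_const_mul_field c)).trans
            (MemLp.toLp_const_smul c f.memSob.memLp_deriv)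

lemma Sob.toPair_injective : Function.Injective (Sob.toPair r p q) := by
  intro f g h
  have h1 : f.memSob.memLp.toLp f = g.memSob.memLp.toLp g := congrArg WithLp.fst h
  have h2 := (MemLp.toLp_eq_toLp_iff _ _).1 h1
  exact DFunLike.coe_injective
    ((f.memSob.locAC.continuous.ae_eq_iff_eq volume g.memSob.locAC.continuous).1 h2)

instance [Fact (1 ≤ r)] [Fact (1 ≤ p)] [Fact (1 ≤ q)] : NormedAddCommGroup (Sob r p q) :=
  NormedAddCommGroup.induced _ _ (Sob.toPair r p q) Sob.toPair_injective

instance [Fact (1 ≤ r)] [Fact (1 ≤ p)] [Fact (1 ≤ q)] : NormedSpace ℝ (Sob r p q) :=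
  NormedSpace.induced ℝ _ _ (Sob.toPair r p q)


/-- `V`: bounded continuous `f` with `f_ξ ∈ L²`, with norm `‖f‖_{L^∞} + ‖f_ξ‖_{L²}`. -/
abbrev V : Type := Sob 1 ∞ 2

/-- `H¹(ℝ)`, with norm `(‖f‖_{L²}² + ‖f_ξ‖_{L²}²)^{1/2}`. -/
abbrev H1 : Type := Sob 2 2 2

lemma V.norm_def (f : V) :
    ‖f‖ = (eLpNorm f ∞ volume).toReal + (eLpNorm (deriv f) 2 volume).toReal := by
  have h : ‖f‖ = ‖Sob.toPair 1 ∞ 2 f‖ := rfl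
  rw [h, WithLp.prod_norm_eq_of_L1]
  exact congrArg₂ _ (Lp.norm_toLp _ f.memSob.memLp) (Lp.norm_toLp _ f.memSob.memLp_deriv)

lemma H1.norm_def (f : H1) :
    ‖f‖ = √((eLpNorm f 2 volume).toReal ^ 2 + (eLpNorm (deriv f) 2 volume).toReal ^ 2) := by
  have h : ‖f‖ = ‖Sob.toPair 2 2 2 f‖ := rfl
  rw [h, WithLp.prod_norm_eq_of_L2]
  exact congrArg₂ (fun a b : ℝ => √(a ^ 2 + b ^ 2)) (Lp.norm_toLp _ f.memSob.memLp)
    (Lp.norm_toLp _ f.memSob.memLp_deriv)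

/-- A partition function: smooth, `0` on `(-∞, 0]`, `1` on `[1, ∞)` and nondecreasing. -/
structure PartitionFunction where
  toFun : ℝ → ℝ
  contDiff : ContDiff ℝ ∞ toFun
  eq_zero : ∀ x ≤ 0, toFun x = 0
  eq_one : ∀ x, 1 ≤ x → toFun x = 1
  deriv_nonneg : ∀ x, 0 ≤ deriv toFun x

instance : CoeFun PartitionFunction (fun _ => ℝ → ℝ) := ⟨PartitionFunction.toFun⟩

/-- The Banach space `E = V × H_{0,∞}(ℝ) × L²(ℝ)`.  An element `(ζ, U, h)` is stored as
`(ζ, ū, c, h)`, where `U = ū + c χ` with `ū ∈ H¹(ℝ)` and `c ∈ ℝ`; the pair `(ū, c)` is determined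
by `U`, and the norm of `H_{0,∞}(ℝ)` is by definition `‖U‖ = ‖ū‖_{H¹} + |c|`. -/
abbrev E : Type := WithLp 1 (V × WithLp 1 (H1 × WithLp 1 (ℝ × Lp ℝ 2 (volume : Measure ℝ))))

namespace E

def mk (ζ : V) (u : H1) (c : ℝ) (h : Lp ℝ 2 (volume : Measure ℝ)) : E :=
  WithLp.toLp 1 (ζ, WithLp.toLp 1 (u, WithLp.toLp 1 (c, h)))

def zeta (X : E) : V := X.fst
def ubar (X : E) : H1 := X.snd.fst
def c (X : E) : ℝ := X.snd.snd.fst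
def h (X : E) : Lp ℝ 2 (volume : Measure ℝ) := X.snd.snd.snd

lemma norm_def (X : E) : ‖X‖ = ‖X.zeta‖ + (‖X.ubar‖ + |X.c|) + ‖X.h‖ := by
  rw [WithLp.prod_norm_eq_of_L1, WithLp.prod_norm_eq_of_L1, WithLp.prod_norm_eq_of_L1,
    ← Real.norm_eq_abs]
  simp only [zeta, ubar, c, h]
  ring

protected lemma ext' {X Y : E} (h1 : X.zeta = Y.zeta) (h2 : X.ubar = Y.ubar) (h3 : X.c = Y.c)
    (h4 : X.h = Y.h) : X = Y := by
  refine (WithLp.ofLp_injective 1) (Prod.ext h1 ?_)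
  refine (WithLp.ofLp_injective 1) (Prod.ext h2 ?_)
  exact (WithLp.ofLp_injective 1) (Prod.ext h3 h4)

/-- `y(ξ) = ξ + ζ(ξ)`. -/
def y (X : E) (ξ : ℝ) : ℝ := ξ + X.zeta ξ

/-- `U = I_χ(ū, 0, c) = ū + c χ`. -/
def U (χ : PartitionFunction) (X : E) (ξ : ℝ) : ℝ := X.ubar ξ + X.c * χ ξ

/-- `Ū = U - c χ ∘ y`. -/
def Ubar (χ : PartitionFunction) (X : E) (ξ : ℝ) : ℝ := X.U χ ξ - X.c * χ (X.y ξ)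

/-- `(2 Ū² + 4 c Ū χ ∘ y) y_ξ + h`. -/
def density (χ : PartitionFunction) (X : E) (η : ℝ) : ℝ :=
  (2 * X.Ubar χ η ^ 2 + 4 * X.c * X.Ubar χ η * χ (X.y η)) * deriv X.y η + X.h η

end E

/-! ### The governing system -/

/-- `g(x) = χ²(x) + ½ ∫ e^{-|x-z|} (2 χ'² + 2 χ χ'')(z) dz`. -/
def gFun (χ : PartitionFunction) (x : ℝ) : ℝ :=
  χ x ^ 2 + 1 / 2 * ∫ z : ℝ, Real.exp (-|x - z|) *
    (2 * deriv χ z ^ 2 + 2 * χ z * deriv (deriv χ) z)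

/-- `P(ξ) = ¼ ∫ e^{-|y(ξ)-y(η)|} ((2 Ū² + 4 c Ū χ ∘ y) y_ξ + h)(η) dη + c² g(y(ξ))`. -/
def P (χ : PartitionFunction) (X : E) (ξ : ℝ) : ℝ :=
  1 / 4 * (∫ η : ℝ, Real.exp (-|X.y ξ - X.y η|) * X.density χ η) + X.c ^ 2 * gFun χ (X.y ξ)

/-- `Q(ξ) = -¼ ∫ sign(ξ-η) e^{-|y(ξ)-y(η)|} ((2 Ū² + 4 c Ū χ ∘ y) y_ξ + h)(η) dη + c² g'(y(ξ))`. -/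
def Q (χ : PartitionFunction) (X : E) (ξ : ℝ) : ℝ :=
  -(1 / 4) * (∫ η : ℝ, Real.sign (ξ - η) * Real.exp (-|X.y ξ - X.y η|) * X.density χ η)
    + X.c ^ 2 * deriv (gFun χ) (X.y ξ)

/-- The element `D` of `E` is the right-hand side of `y_t = U`, `U_t = -Q`, `h_t = 2 (U² - P) U_ξ`
at the point `X` of `E` (note that `y_t = ζ_t`). -/
structure IsVelocity (χ : PartitionFunction) (X D : E) : Prop where
  zeta_eq : ∀ ξ, D.zeta ξ = X.U χ ξ
  U_eq : ∀ ξ, D.U χ ξ = -Q χ X ξ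
  h_eq : ∀ᵐ ξ : ℝ, D.h ξ = 2 * (X.U χ ξ ^ 2 - P χ X ξ) * deriv (X.U χ) ξ

/-- `X ∈ C¹([0,∞), E)` is a global solution of the system. -/
def IsGlobalSolution (χ : PartitionFunction) (X : ℝ≥0 → E) : Prop :=
  ∃ X' : ℝ≥0 → E, Continuous X' ∧ ∀ t : ℝ≥0,
    HasDerivWithinAt (fun s : ℝ => X s.toNNReal) (X' t) (Ici 0) t ∧ IsVelocity χ (X t) (X' t)

/-! ### The sets `𝒢` and `ℱ` -/

/-- Membership in the set `𝒢`: `ζ, U ∈ W^{1,∞}`, `h ∈ L^∞`, and almost everywhere `y_ξ ≥ 0`, `h ≥ 0`,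
`y_ξ + h > 0`, `y_ξ h = U_ξ²`. -/
structure MemG (χ : PartitionFunction) (X : E) : Prop where
  zeta_mem : MemSob ∞ ∞ X.zeta
  U_mem : MemSob ∞ ∞ (X.U χ)
  h_mem : MemLp X.h ∞ volume
  y_deriv_nonneg : ∀ᵐ ξ : ℝ, 0 ≤ deriv X.y ξ
  h_nonneg : ∀ᵐ ξ : ℝ, 0 ≤ X.h ξ
  pos : ∀ᵐ ξ : ℝ, 0 < deriv X.y ξ + X.h ξ
  energy : ∀ᵐ ξ : ℝ, deriv X.y ξ * X.h ξ = deriv (X.U χ) ξ ^ 2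

/-- `H(ξ) = ∫_{-∞}^ξ h`. -/
def E.H (X : E) (ξ : ℝ) : ℝ := ∫ τ in Iic ξ, X.h τ

/-- Membership in the set `ℱ`: `X ∈ 𝒢` and `y + H ∈ G`. -/
def MemF (χ : PartitionFunction) (X : E) : Prop :=
  MemG χ X ∧ ∃ f : Relabeling, ∀ ξ, f.1 ξ = X.y ξ + X.H ξ

/-- The set `ℱ`. -/
def F (χ : PartitionFunction) : Type := {X : E // MemF χ X}

/-! ### The action of `G` -/

lemma Relabeling.lip (f : Relabeling) : ∃ K : ℝ≥0, LipschitzWith K f.1 :=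
  lipschitz_of_sub_id f.2.memSob

lemma Relabeling.lip_symm (f : Relabeling) : ∃ K : ℝ≥0, LipschitzWith K f.1.symm :=
  lipschitz_of_sub_id f.2.memSob_symm

lemma Relabeling.strictMono (f : Relabeling) : StrictMono f.1 := f.2.strictMono

lemma Relabeling.memSob_comp (f : Relabeling) {u : ℝ → ℝ} (hu : MemSob p q u) :
    MemSob p q (fun x => u (f.1 x)) := by
  obtain ⟨K, hK⟩ := f.lip
  obtain ⟨K', hK'⟩ := f.lip_symm
  exact MemSob.comp hK hK' f.strictMono.monotone hu

lemma Relabeling.memLp_h (f : Relabeling) {u : ℝ → ℝ} (hu : MemLp u p volume) :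
    MemLp (fun x => u (f.1 x) * deriv f.1 x) p volume := by
  obtain ⟨K, hK⟩ := f.lip
  obtain ⟨K', hK'⟩ := f.lip_symm
  exact memLp_mul_deriv hK (memLp_comp hK' hu)

lemma Relabeling.memSob_sub_id (f : Relabeling) : MemSob ∞ 2 (fun x => f.1 x - x) := by
  obtain ⟨K, hK⟩ := f.lip
  refine ⟨f.2.memSob.locAC, f.2.memSob.memLp, f.2.memLp_deriv.ae_eq ?_⟩
  filter_upwards [hK.ae_differentiableAt_real] with x hx
  exact ((hx.hasDerivAt.sub (hasDerivAt_id x)).deriv).symm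

lemma memSob_relabel_zeta (f : Relabeling) (X : E) :
    MemSob ∞ 2 (fun x => X.y (f.1 x) - x) := by
  convert (f.memSob_comp X.zeta.memSob).add f.memSob_sub_id using 1
  ext x; simp [E.y]; ring

lemma PartitionFunction.lip (χ : PartitionFunction) : ∃ K : ℝ≥0, LipschitzWith K χ := by
  have hc : Continuous (deriv χ) := χ.contDiff.continuous_deriv (by simp)
  obtain ⟨C, hC⟩ := (isCompact_Icc (a := (0 : ℝ)) (b := 1)).exists_bound_of_continuousOn
    hc.continuousOn
  refine ⟨C.toNNReal, lipschitzWith_of_nnnorm_deriv_le (χ.contDiff.differentiable (by simp))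
    fun x => ?_⟩
  rw [← NNReal.coe_le_coe, coe_nnnorm]
  by_cases hx : x ∈ Icc (0 : ℝ) 1
  · exact (hC x hx).trans (Real.le_coe_toNNReal C)
  · have : deriv χ x = 0 := by
      rw [mem_Icc, not_and_or, not_le, not_le] at hx
      rcases hx with hx | hx
      · have : (χ : ℝ → ℝ) =ᶠ[𝓝 x] fun _ => 0 := by
          filter_upwards [Iio_mem_nhds hx] with z hz using χ.eq_zero z (le_of_lt hz)
        rw [this.deriv_eq, deriv_const]
      · have : (χ : ℝ → ℝ) =ᶠ[𝓝 x] fun _ => 1 := by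
          filter_upwards [Ioi_mem_nhds hx] with z hz using χ.eq_one z (le_of_lt hz)
        rw [this.deriv_eq, deriv_const]
    rw [this]; simp

lemma memSob_chi_comp_sub (χ : PartitionFunction) (f : Relabeling) :
    MemSob 2 2 (fun x => χ (f.1 x) - χ x) := by
  obtain ⟨K, hK⟩ := χ.lip
  obtain ⟨L, hL⟩ := f.lip
  have hlip : LipschitzWith (K * L + K) (fun x => χ (f.1 x) - χ x) :=
    (hK.comp hL).sub hK
  obtain ⟨C, hC⟩ := bound_of_memLp_top f.2.memSob.locAC.continuous f.2.memSob.memLp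
  have hsupp : HasCompactSupport (fun x => χ (f.1 x) - χ x) := by
    refine HasCompactSupport.intro (isCompact_Icc (a := -|C|) (b := 1 + |C|)) fun x hx => ?_
    have h1 := abs_le.1 ((hC x).trans (le_abs_self C))
    rw [mem_Icc, not_and_or, not_le, not_le] at hx
    rcases hx with hx | hx
    · rw [χ.eq_zero _ (by linarith), χ.eq_zero _ (by linarith [abs_nonneg C]), sub_zero]
    · rw [χ.eq_one _ (by linarith), χ.eq_one _ (by linarith [abs_nonneg C]), sub_self]
  obtain ⟨B, hB⟩ := hsupp.exists_bound_of_continuous hlip.continuous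
  refine ⟨LocAC.of_lipschitz hlip, ?_, ?_⟩
  · exact hsupp.memLp_of_bound hlip.continuous.aestronglyMeasurable B (ae_of_all _ hB)
  · exact hsupp.deriv.memLp_of_bound (measurable_deriv _).aestronglyMeasurable (K * L + K : ℝ≥0)
      (ae_of_all _ fun _ => norm_deriv_le_of_lipschitz hlip)

lemma memSob_relabel_ubar (χ : PartitionFunction) (f : Relabeling) (X : E) :
    MemSob 2 2 (fun x => X.U χ (f.1 x) - X.c * χ x) := by
  convert (f.memSob_comp X.ubar.memSob).add ((memSob_chi_comp_sub χ f).const_mul X.c) using 1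
  ext x; simp [E.U]; ring

/-- `X ∘ f = (y ∘ f, U ∘ f, (h ∘ f) f_ξ)`, written in the components `(ζ, ū, c, h)`. -/
def E.relabel (χ : PartitionFunction) (X : E) (f : Relabeling) : E :=
  E.mk (Sob.mk (memSob_relabel_zeta f X)) (Sob.mk (memSob_relabel_ubar χ f X)) X.c
    ((f.memLp_h (Lp.memLp X.h)).toLp _)

section Relabel

variable (χ : PartitionFunction) (X : E) (f : Relabeling)

@[simp] lemma E.relabel_c : (X.relabel χ f).c = X.c := rfl

lemma E.relabel_y (ξ : ℝ) : (X.relabel χ f).y ξ = X.y (f.1 ξ) := by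
  change ξ + (X.y (f.1 ξ) - ξ) = _
  ring

lemma E.relabel_U (ξ : ℝ) : (X.relabel χ f).U χ ξ = X.U χ (f.1 ξ) := by
  change (X.U χ (f.1 ξ) - X.c * χ ξ) + X.c * χ ξ = _
  ring

lemma E.relabel_h : (X.relabel χ f).h =ᵐ[volume] fun ξ => X.h (f.1 ξ) * deriv f.1 ξ :=
  MemLp.coeFn_toLp (f.memLp_h (Lp.memLp X.h))

/-- Two elements of `E` with the same `y`, `U`, `c`, `h` are equal. -/
lemma E.ext_of {X Y : E} (h1 : ∀ ξ, X.y ξ = Y.y ξ) (h2 : ∀ ξ, X.U χ ξ = Y.U χ ξ)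
    (h3 : X.c = Y.c) (h4 : X.h =ᵐ[volume] Y.h) : X = Y := by
  refine E.ext' (Sob.ext fun x => ?_) (Sob.ext fun x => ?_) h3 (Lp.ext h4)
  · simpa [E.y] using h1 x
  · simpa [E.U, h3] using h2 x

lemma E.relabel_one : X.relabel χ 1 = X := by
  refine E.ext_of χ (fun ξ => X.relabel_y χ 1 ξ) (fun ξ => X.relabel_U χ 1 ξ) rfl ?_
  filter_upwards [X.relabel_h χ 1] with ξ hξ
  rw [hξ]
  have e : (((1 : Relabeling) : ℝ ≃ₜ ℝ) : ℝ → ℝ) = id := rfl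
  rw [e, deriv_id]
  simp

lemma E.relabel_mul (g : Relabeling) : X.relabel χ (f * g) = (X.relabel χ f).relabel χ g := by
  obtain ⟨K, hK⟩ := f.lip
  obtain ⟨L, hL⟩ := g.lip
  obtain ⟨L', hL'⟩ := g.lip_symm
  have e : (((f * g : Relabeling) : ℝ ≃ₜ ℝ) : ℝ → ℝ) = fun x => f.1 (g.1 x) := rfl
  refine E.ext_of χ (fun ξ => ?_) (fun ξ => ?_) rfl ?_
  · rw [E.relabel_y, E.relabel_y, E.relabel_y]; rfl
  · rw [E.relabel_U, E.relabel_U, E.relabel_U]; rfl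
  · filter_upwards [X.relabel_h χ (f * g), (X.relabel χ f).relabel_h χ g,
      (quasi_of_lipschitz hL').ae (X.relabel_h χ f),
      ae_deriv_comp hL hL' hK.ae_differentiableAt_real] with ξ h1 h2 h3 h4
    rw [h1, h2, h3, e, h4]
    ring

lemma E.deriv_relabel_y {X : E} (hX : MemG χ X) :
    deriv (X.relabel χ f).y =ᵐ[volume] fun ξ => deriv X.y (f.1 ξ) * deriv f.1 ξ := by
  obtain ⟨K, hK⟩ := f.lip
  obtain ⟨K', hK'⟩ := f.lip_symm
  have e : (X.relabel χ f).y = fun ξ => X.y (f.1 ξ) := funext (X.relabel_y χ f)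
  rw [e]
  refine ae_deriv_comp hK hK' ?_
  filter_upwards [hX.zeta_mem.locAC.ae_differentiableAt] with x hx
  exact differentiableAt_id.add hx

lemma E.deriv_relabel_U {X : E} (hX : MemG χ X) :
    deriv ((X.relabel χ f).U χ) =ᵐ[volume] fun ξ => deriv (X.U χ) (f.1 ξ) * deriv f.1 ξ := by
  obtain ⟨K, hK⟩ := f.lip
  obtain ⟨K', hK'⟩ := f.lip_symm
  have e : (X.relabel χ f).U χ = fun ξ => X.U χ (f.1 ξ) := funext (X.relabel_U χ f)
  rw [e]
  exact ae_deriv_comp hK hK' hX.U_mem.locAC.ae_differentiableAt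

lemma Relabeling.ae_deriv_pos : ∀ᵐ ξ : ℝ, 0 < deriv f.1 ξ := by
  obtain ⟨K, hK⟩ := f.lip
  obtain ⟨K', hK'⟩ := f.lip_symm
  have h := ae_deriv_comp hK hK' hK'.ae_differentiableAt_real
  filter_upwards [h] with x hx
  have e : (fun x => f.1.symm (f.1 x)) = id := by ext x; exact f.1.symm_apply_apply x
  rw [e, deriv_id] at hx
  have h0 : 0 ≤ deriv f.1 x := f.strictMono.monotone.deriv_nonneg
  refine lt_of_le_of_ne h0 fun h1 => ?_
  rw [← h1, mul_zero] at hx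
  exact one_ne_zero hx

lemma MemG.relabel {χ : PartitionFunction} {X : E} (hX : MemG χ X) (f : Relabeling) :
    MemG χ (X.relabel χ f) := by
  obtain ⟨K', hK'⟩ := f.lip_symm
  have hq := quasi_of_lipschitz hK'
  refine ⟨?_, ?_, ?_, ?_, ?_, ?_, ?_⟩
  · have : MemSob ∞ ∞ (fun x => X.y (f.1 x) - x) := by
      convert (f.memSob_comp hX.zeta_mem).add f.2.memSob using 1
      ext x; simp [E.y]; ring
    exact this
  · have e : (X.relabel χ f).U χ = fun ξ => X.U χ (f.1 ξ) := funext (X.relabel_U χ f)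
    rw [e]
    exact f.memSob_comp hX.U_mem
  · exact (f.memLp_h hX.h_mem).ae_eq (X.relabel_h χ f).symm
  · filter_upwards [E.deriv_relabel_y χ f hX, hq.ae hX.y_deriv_nonneg, f.ae_deriv_pos]
      with ξ h1 h2 h3
    rw [h1]; positivity
  · filter_upwards [X.relabel_h χ f, hq.ae hX.h_nonneg, f.ae_deriv_pos] with ξ h1 h2 h3
    rw [h1]; positivity
  · filter_upwards [E.deriv_relabel_y χ f hX, X.relabel_h χ f, hq.ae hX.pos, f.ae_deriv_pos]
      with ξ h1 h2 h3 h4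
    rw [h1, h2, ← add_mul]; positivity
  · filter_upwards [E.deriv_relabel_y χ f hX, X.relabel_h χ f, E.deriv_relabel_U χ f hX,
      hq.ae hX.energy] with ξ h1 h2 h3 h4
    rw [h1, h2, h3, mul_pow, ← h4]; ring

lemma E.relabel_H (ξ : ℝ) : (X.relabel χ f).H ξ = X.H (f.1 ξ) := by
  obtain ⟨K, hK⟩ := f.lip
  let D : Set ℝ := {x | DifferentiableAt ℝ f.1 x}
  have hD : MeasurableSet D := measurableSet_of_differentiableAt ℝ f.1
  have hDc : volume Dᶜ = 0 := hK.ae_differentiableAt_real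
  have hDI : (D ∩ Iic ξ : Set ℝ) =ᵐ[volume] Iic ξ := by
    filter_upwards [hK.ae_differentiableAt_real] with x hx
    exact propext ⟨fun h => h.2, fun h => ⟨hx, h⟩⟩
  have himg : (f.1 '' (D ∩ Iic ξ) : Set ℝ) =ᵐ[volume] Iic (f.1 ξ) := by
    have h0 : volume (f.1 '' Dᶜ) = 0 := by
      refine le_antisymm ((volume_image_le hK _).trans ?_) bot_le
      rw [hDc, mul_zero]
    have h1 : ∀ᵐ z : ℝ, z ∉ f.1 '' Dᶜ := measure_eq_zero_iff_ae_notMem.1 h0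
    filter_upwards [h1] with z hz
    refine propext ⟨?_, fun h => ?_⟩
    · rintro ⟨x, hx, rfl⟩
      exact f.strictMono.monotone hx.2
    · refine ⟨f.1.symm z, ⟨?_, ?_⟩, f.1.apply_symm_apply z⟩
      · by_contra hn
        exact hz ⟨_, hn, f.1.apply_symm_apply z⟩
      · refine f.strictMono.le_iff_le.1 ?_
        rw [f.1.apply_symm_apply]; exact h
  have key := integral_image_eq_integral_abs_deriv_smul (s := D ∩ Iic ξ) (f := f.1)
    (f' := deriv f.1) (hD.inter measurableSet_Iic)
    (fun x hx => (DifferentiableAt.hasDerivAt hx.1).hasDerivWithinAt) f.1.injective.injOn X.h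
  rw [setIntegral_congr_set himg, setIntegral_congr_set hDI] at key
  unfold E.H
  rw [key]
  refine integral_congr_ae (ae_restrict_of_ae ?_)
  filter_upwards [X.relabel_h χ f, f.ae_deriv_pos] with x h1 h2
  rw [h1, abs_of_pos h2, smul_eq_mul, mul_comm]

end Relabel

lemma MemF.relabel {χ : PartitionFunction} {X : E} (hX : MemF χ X) (f : Relabeling) :
    MemF χ (X.relabel χ f) := by
  obtain ⟨hG, g, hg⟩ := hX
  refine ⟨hG.relabel f, g * f, fun ξ => ?_⟩
  rw [E.relabel_y, E.relabel_H, ← hg]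
  rfl

namespace F

variable {χ : PartitionFunction}

/-- The relabeling `X ∘ f` of `X ∈ ℱ` by `f ∈ G`. -/
def relabel (X : F χ) (f : Relabeling) : F χ := ⟨X.1.relabel χ f, X.2.relabel f⟩

lemma relabel_one (X : F χ) : X.relabel 1 = X := Subtype.ext (X.1.relabel_one χ)

lemma relabel_mul (X : F χ) (f g : Relabeling) :
    X.relabel (f * g) = (X.relabel f).relabel g := Subtype.ext (X.1.relabel_mul χ f g)

/-- The element `y + H` of `G` attached to `X ∈ ℱ`. -/
def total (X : F χ) : Relabeling := X.2.2.choose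

lemma total_apply (X : F χ) (ξ : ℝ) : X.total.1 ξ = X.1.y ξ + X.1.H ξ := X.2.2.choose_spec ξ

lemma total_relabel (X : F χ) (f : Relabeling) : (X.relabel f).total = X.total * f := by
  refine Subtype.ext (Homeomorph.ext fun ξ => ?_)
  rw [total_apply]
  change (X.1.relabel χ f).y ξ + (X.1.relabel χ f).H ξ = X.total.1 (f.1 ξ)
  rw [E.relabel_y, E.relabel_H, total_apply]

/-- `Γ(X) = X ∘ (y + H)⁻¹`. -/
def Gam (X : F χ) : F χ := X.relabel X.total⁻¹

lemma Gam_relabel (X : F χ) (f : Relabeling) : (X.relabel f).Gam = X.Gam := by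
  rw [Gam, total_relabel, ← relabel_mul, Gam]
  congr 1
  group

/-- `X ~ X'` iff `X' = X ∘ f` for some `f ∈ G`. -/
instance setoid (χ : PartitionFunction) : Setoid (F χ) where
  r X X' := ∃ f : Relabeling, X' = X.relabel f
  iseqv := by
    refine ⟨fun X => ⟨1, X.relabel_one.symm⟩, ?_, ?_⟩
    · rintro X _ ⟨f, rfl⟩
      exact ⟨f⁻¹, by rw [← relabel_mul, mul_inv_cancel, relabel_one]⟩
    · rintro X _ _ ⟨f, rfl⟩ ⟨g, rfl⟩
      exact ⟨f * g, by rw [relabel_mul]⟩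

end F

/-- The quotient space `ℱ/G`. -/
def FmodG (χ : PartitionFunction) : Type := Quotient (F.setoid χ)

namespace FmodG

variable {χ : PartitionFunction}

/-- The projection `Π(X) = [X]`. -/
def proj (X : F χ) : FmodG χ := Quotient.mk _ X

/-- The map `Γ̃ : ℱ/G → E`, `Γ̃([X]) = Γ(X)`. -/
def GamTilde : FmodG χ → E :=
  Quotient.lift (fun X : F χ => X.Gam.1) (by
    rintro X _ ⟨f, rfl⟩
    exact congrArg Subtype.val (F.Gam_relabel X f).symm)

lemma GamTilde_injective : Function.Injective (GamTilde (χ := χ)) := by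
  intro a b
  refine Quotient.inductionOn₂ a b fun X Y h => Quotient.sound ?_
  have h1 : X.Gam = Y.Gam := Subtype.ext h
  refine ⟨X.total⁻¹ * Y.total, ?_⟩
  rw [F.relabel_mul, show X.relabel X.total⁻¹ = Y.relabel Y.total⁻¹ from h1, ← F.relabel_mul,
    inv_mul_cancel, F.relabel_one]

/-- The metric `d_{ℱ/G}([X], [X']) = ‖Γ(X) - Γ(X')‖_E`. -/
instance : MetricSpace (FmodG χ) := MetricSpace.induced GamTilde GamTilde_injective inferInstance

lemma dist_def (X Y : F χ) : dist (proj X) (proj Y) = ‖X.Gam.1 - Y.Gam.1‖ :=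
  dist_eq_norm X.Gam.1 Y.Gam.1

end FmodG

end

end CamassaHolm

open CamassaHolm

/-! The system is an ordinary differential equation X' = `E.field` X in the Banach space E. When y
is nondecreasing, the kernel e^{-|y(ξ)-y(η)|} factors on either side of ξ as e^{∓ζ(ξ)} e^{-|ξ-η|}
e^{±ζ(η)}. Hence P and Q are given by formulas that make sense on all of E and are assembled from
bounded multilinear maps, superposition operators and the one-sided convolutions `Kp`, `Km` from L²
to H¹. This field is Lipschitz on bounded sets (`E.lipB_field`), and at points of 𝒢 it is the only
possible velocity (`IsVelocity.eq_field`).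

Invariance of the constraints. Along a solution, (y_ξ, U_ξ, h) obeys a linear system with
coefficient A = U² - P, which is the symmetric square of the 2×2 system p' = ½q, q' = Ap. A point
with y_ξ, h ≥ 0 and y_ξ h = U_ξ² is a square (α², αβ, β²), and it stays one when (α, β) moves by the
2×2 system; the sum α² + β² = y_ξ + h changes at relative rate at most ‖A‖ + ½ (`Cone.propagate`).
Since y_ξ, U_ξ, h are only L² classes, the 2×2 system is solved in bounded continuous functions,
carried along as extra unknowns (`augField`), and the two descriptions are matched by uniqueness in
L².

Global existence. The energy ∫ ū² y_ξ + h controls ū uniformly, because 2|ū U_ξ| ≤ ū² y_ξ + h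
(`E.ubar_sq_le`), hence also P (`E.abs_pB_le`) and A. Its time derivative is a total derivative up
to terms carried by χ' (`E.rate_eq`), so it grows at most exponentially. None of these constants
involves the cone constant. So one bounds in turn the energy, A, the cone constant and the norm
(`exists_apriori_bound`), and solutions cannot blow up. The set ℱ is exactly the union of the cones,
since K⁻¹ ≤ y_ξ + h ≤ K says that y + H is bi-Lipschitz (`E.exists_cone_of_memF`, `E.memF_of_cone`);
therefore ℱ is invariant.

Equivariance. Relabeling by f is an affine map of E, and a change of variables turns P and Q of X∘f
into P∘f and Q∘f. So S_t(X)∘f solves the system, and uniqueness gives `flow_relabel`.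

Continuity on the quotient. A class is represented by Γ(X), for which y + H = id, so all
representatives lie in the single cone with constant 1. From a fixed cone the flow is jointly
continuous and stays locally in one cone (`tendsto_flow`). On one cone Γ is continuous
(`F.tendsto_Gam`): its components are quotients by y_ξ + h composed with (y + H)⁻¹, this inverse
depends continuously on X in the sup norm because (y_ξ + h) h = U_ξ² + h² bounds the L¹ distance of
the h's by L² distances, and composition is strongly continuous on L². -/

namespace CamassaHolm

noncomputable section

set_option linter.unusedSectionVars false

/-! ### Maps that are Lipschitz on bounded sets, and their flows -/

section LipB

variable {W W₁ W₂ W₃ : Type*} [NormedAddCommGroup W] [NormedSpace ℝ W]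
  [NormedAddCommGroup W₁] [NormedSpace ℝ W₁] [NormedAddCommGroup W₂] [NormedSpace ℝ W₂]
  [NormedAddCommGroup W₃] [NormedSpace ℝ W₃]

/-- `F` is Lipschitz on every ball. -/
def LipB (F : W → W₁) : Prop :=
  ∀ R : ℝ, ∃ C : ℝ, 0 ≤ C ∧ ∀ x y, ‖x‖ ≤ R → ‖y‖ ≤ R → ‖F x - F y‖ ≤ C * ‖x - y‖

lemma LipB.bounded {F : W → W₁} (hF : LipB F) (R : ℝ) :
    ∃ C : ℝ, 0 ≤ C ∧ ∀ x, ‖x‖ ≤ R → ‖F x‖ ≤ C := by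
  obtain ⟨C, hC, h⟩ := hF (max R 0)
  refine ⟨‖F 0‖ + C * max R 0, by positivity, fun x hx => ?_⟩
  have h1 := h x 0 (hx.trans (le_max_left _ _)) (by simp)
  rw [sub_zero] at h1
  have h2 : ‖F x‖ ≤ ‖F 0‖ + ‖F x - F 0‖ := by
    have := norm_add_le (F 0) (F x - F 0)
    rwa [add_sub_cancel] at this
  have h3 : C * ‖x‖ ≤ C * max R 0 := by gcongr; exact hx.trans (le_max_left _ _)
  linarith

lemma LipB.lipschitzOnWith {F : W → W₁} (hF : LipB F) (R : ℝ) :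
    ∃ K : ℝ≥0, LipschitzOnWith K F (Metric.closedBall 0 R) := by
  obtain ⟨C, hC, h⟩ := hF R
  refine ⟨⟨C, hC⟩, LipschitzOnWith.of_dist_le_mul fun x hx y hy => ?_⟩
  rw [dist_eq_norm, dist_eq_norm]
  exact h x y (by simpa using hx) (by simpa using hy)

lemma LipB.continuous {F : W → W₁} (hF : LipB F) : Continuous F := by
  rw [continuous_iff_continuousAt]
  intro x
  obtain ⟨K, hK⟩ := hF.lipschitzOnWith (‖x‖ + 1)
  refine hK.continuousOn.continuousAt (Metric.closedBall_mem_nhds_of_mem ?_)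
  simp

lemma LipB.const (c : W₁) : LipB (fun _ : W => c) :=
  fun _ => ⟨0, le_rfl, fun _ _ _ _ => by simp⟩

lemma LipB.clm (L : W →L[ℝ] W₁) : LipB (fun x => L x) := fun _ =>
  ⟨‖L‖, norm_nonneg _, fun x y _ _ => by rw [← map_sub]; exact L.le_opNorm _⟩

lemma LipB.add {F G : W → W₁} (hF : LipB F) (hG : LipB G) : LipB (fun x => F x + G x) := by
  intro R
  obtain ⟨C, hC, h⟩ := hF R
  obtain ⟨D, hD, h'⟩ := hG R
  refine ⟨C + D, by positivity, fun x y hx hy => ?_⟩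
  rw [add_sub_add_comm, add_mul]
  exact (norm_add_le _ _).trans (add_le_add (h x y hx hy) (h' x y hx hy))

lemma LipB.comp {G : W₁ → W₂} {F : W → W₁} (hG : LipB G) (hF : LipB F) :
    LipB (fun x => G (F x)) := by
  intro R
  obtain ⟨C, hC, h⟩ := hF R
  obtain ⟨B, hB, hb⟩ := hF.bounded R
  obtain ⟨D, hD, h'⟩ := hG B
  refine ⟨D * C, by positivity, fun x y hx hy => ?_⟩
  rw [mul_assoc]
  exact (h' _ _ (hb x hx) (hb y hy)).trans (mul_le_mul_of_nonneg_left (h x y hx hy) hD)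

lemma LipB.clm_comp (L : W₁ →L[ℝ] W₂) {F : W → W₁} (hF : LipB F) : LipB (fun x => L (F x)) :=
  (LipB.clm L).comp hF

lemma LipB.smul_const (c : ℝ) {F : W → W₁} (hF : LipB F) : LipB (fun x => c • F x) :=
  LipB.clm_comp (c • ContinuousLinearMap.id ℝ W₁) hF

lemma LipB.neg {F : W → W₁} (hF : LipB F) : LipB (fun x => -F x) := by
  simpa using hF.smul_const (-1)

lemma LipB.sub {F G : W → W₁} (hF : LipB F) (hG : LipB G) : LipB (fun x => F x - G x) := by
  simpa [sub_eq_add_neg] using hF.add hG.neg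

lemma LipB.prodMk {F : W → W₁} {G : W → W₂} (hF : LipB F) (hG : LipB G) :
    LipB (fun x => (F x, G x)) := by
  intro R
  obtain ⟨C, hC, h⟩ := hF R
  obtain ⟨D, hD, h'⟩ := hG R
  refine ⟨max C D, by positivity, fun x y hx hy => ?_⟩
  rw [Prod.mk_sub_mk, Prod.norm_mk]
  refine max_le ((h x y hx hy).trans ?_) ((h' x y hx hy).trans ?_)
  · gcongr; exact le_max_left _ _
  · gcongr; exact le_max_right _ _

lemma LipB.bilin (L : W₁ →L[ℝ] W₂ →L[ℝ] W₃) {F : W → W₁} {G : W → W₂} (hF : LipB F)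
    (hG : LipB G) : LipB (fun x => L (F x) (G x)) := by
  intro R
  obtain ⟨C, hC, h⟩ := hF R
  obtain ⟨D, hD, h'⟩ := hG R
  obtain ⟨A, hA, ha⟩ := hF.bounded R
  obtain ⟨B, hB, hb⟩ := hG.bounded R
  refine ⟨‖L‖ * C * B + ‖L‖ * A * D, by positivity, fun x y hx hy => ?_⟩
  have e : L (F x) (G x) - L (F y) (G y) = L (F x - F y) (G x) + L (F y) (G x - G y) := by
    simp
  rw [e, add_mul]
  refine (norm_add_le _ _).trans (add_le_add ?_ ?_)
  · calc _ ≤ ‖L‖ * ‖F x - F y‖ * ‖G x‖ := L.le_opNorm₂ _ _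
      _ ≤ ‖L‖ * (C * ‖x - y‖) * B := by gcongr; exacts [h x y hx hy, hb x hx]
      _ = _ := by ring
  · calc _ ≤ ‖L‖ * ‖F y‖ * ‖G x - G y‖ := L.le_opNorm₂ _ _
      _ ≤ ‖L‖ * A * (D * ‖x - y‖) := by gcongr; exacts [ha y hy, h' x y hx hy]
      _ = _ := by ring

/-- `X` solves `X' = F(X)` on `[0, τ]`. -/
def SolvesOn (F : W → W) (X : ℝ → W) (τ : ℝ) : Prop :=
  ∀ t ∈ Icc 0 τ, HasDerivWithinAt X (F (X t)) (Icc 0 τ) t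

/-- `X` solves `X' = F(X)` on `[0, ∞)`. -/
def SolvesGlobally (F : W → W) (X : ℝ → W) : Prop :=
  ∀ t, 0 ≤ t → HasDerivWithinAt X (F (X t)) (Ici 0) t

/-! ### Uniqueness, gluing and continuation of solutions of X' = F(X). -/

lemma SolvesOn.continuousOn {F : W → W} {X : ℝ → W} {τ : ℝ} (h : SolvesOn F X τ) :
    ContinuousOn X (Icc 0 τ) := fun t ht => (h t ht).continuousWithinAt

lemma SolvesOn.mono {F : W → W} {X : ℝ → W} {τ τ' : ℝ} (h : SolvesOn F X τ) (hτ : τ' ≤ τ) :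
    SolvesOn F X τ' := fun t ht =>
  (h t ⟨ht.1, ht.2.trans hτ⟩).mono (Icc_subset_Icc_right hτ)

lemma SolvesOn.right {F : W → W} {X : ℝ → W} {τ : ℝ} (h : SolvesOn F X τ) :
    ∀ t ∈ Ico 0 τ, HasDerivWithinAt X (F (X t)) (Ici t) t := fun t ht =>
  (h t ⟨ht.1, ht.2.le⟩).mono_of_mem_nhdsWithin (mem_of_superset
    (Icc_mem_nhdsGE ht.2) (Icc_subset_Icc_left ht.1))

lemma SolvesGlobally.solvesOn {F : W → W} {X : ℝ → W} (h : SolvesGlobally F X) (τ : ℝ) :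
    SolvesOn F X τ := fun t ht => (h t ht.1).mono fun _ hs => hs.1

lemma SolvesOn.bounded {F : W → W} {X : ℝ → W} {τ : ℝ} (h : SolvesOn F X τ) :
    ∃ R, ∀ t ∈ Icc 0 τ, ‖X t‖ ≤ R :=
  isCompact_Icc.exists_bound_of_continuousOn h.continuousOn

/-- Grönwall's inequality. The rate K depends on the radius R alone, not on the solutions or on τ;
this uniformity is what later gives continuity of the flow in its initial value. -/
lemma LipB.dist_le {F : W → W} (hF : LipB F) (R : ℝ) : ∃ K : ℝ, ∀ (τ : ℝ) (X Y : ℝ → W),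
    SolvesOn F X τ → SolvesOn F Y τ → (∀ t ∈ Icc 0 τ, ‖X t‖ ≤ R) → (∀ t ∈ Icc 0 τ, ‖Y t‖ ≤ R) →
      ∀ t ∈ Icc 0 τ, dist (X t) (Y t) ≤ dist (X 0) (Y 0) * Real.exp (K * t) := by
  obtain ⟨K, hK⟩ := hF.lipschitzOnWith R
  refine ⟨K, fun τ X Y hX hY hXR hYR t ht => ?_⟩
  have := dist_le_of_trajectories_ODE_of_mem (v := fun _ => F)
    (s := fun _ => Metric.closedBall 0 R) (fun _ _ => hK) hX.continuousOn hX.right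
    (fun t ht => by simpa using hXR t ⟨ht.1, ht.2.le⟩) hY.continuousOn hY.right
    (fun t ht => by simpa using hYR t ⟨ht.1, ht.2.le⟩) le_rfl t ht
  simpa using this

lemma LipB.unique {F : W → W} (hF : LipB F) {τ : ℝ} {X Y : ℝ → W} (hX : SolvesOn F X τ)
    (hY : SolvesOn F Y τ) (h0 : X 0 = Y 0) : ∀ t ∈ Icc 0 τ, X t = Y t := by
  obtain ⟨R, hR⟩ := hX.bounded
  obtain ⟨R', hR'⟩ := hY.bounded
  obtain ⟨K, hK⟩ := hF.dist_le (max R R')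
  intro t ht
  have := hK τ X Y hX hY (fun t ht => (hR t ht).trans (le_max_left _ _))
    (fun t ht => (hR' t ht).trans (le_max_right _ _)) t ht
  rw [h0, dist_self, zero_mul] at this
  exact dist_le_zero.1 this

/-- Both pieces have the same value at s, hence the same velocity there, so the two one-sided
derivatives combine to a derivative on the union of the intervals. -/
lemma SolvesOn.glue {F : W → W} {X Y : ℝ → W} {s r : ℝ} (hs : 0 ≤ s) (hr : s ≤ r)
    (hX : SolvesOn F X s) (hY : ∀ t ∈ Icc s r, HasDerivWithinAt Y (F (Y t)) (Icc s r) t)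
    (h : Y s = X s) : SolvesOn F (fun t => if t ≤ s then X t else Y t) r := by
  set Z : ℝ → W := fun t => if t ≤ s then X t else Y t with hZ
  have hZX : ∀ t, t ≤ s → Z t = X t := fun t ht => by simp [hZ, ht]
  have hZY : ∀ t, s ≤ t → Z t = Y t := fun t ht => by
    rcases ht.eq_or_lt with rfl | ht
    · simp [hZ, h]
    · simp [hZ, not_le.2 ht]
  have h1 : ∀ t ∈ Icc 0 s, HasDerivWithinAt Z (F (Z t)) (Icc 0 s) t := fun t ht => by
    rw [hZX t ht.2]
    exact (hX t ht).congr (fun u hu => hZX u hu.2) (hZX t ht.2)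
  have h2 : ∀ t ∈ Icc s r, HasDerivWithinAt Z (F (Z t)) (Icc s r) t := fun t ht => by
    rw [hZY t ht.1]
    exact (hY t ht).congr (fun u hu => hZY u hu.1) (hZY t ht.1)
  intro t ht
  rcases lt_trichotomy t s with hts | rfl | hts
  · refine (h1 t ⟨ht.1, hts.le⟩).mono_of_mem_nhdsWithin ?_
    filter_upwards [self_mem_nhdsWithin, mem_nhdsWithin_of_mem_nhds (Iio_mem_nhds hts)]
      with u hu hu' using ⟨hu.1, hu'.le⟩
  · have := (h1 t ⟨hs, le_rfl⟩).union (h2 t ⟨le_rfl, hr⟩)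
    rwa [Icc_union_Icc_eq_Icc hs hr] at this
  · refine (h2 t ⟨hts.le, ht.2⟩).mono_of_mem_nhdsWithin ?_
    filter_upwards [self_mem_nhdsWithin, mem_nhdsWithin_of_mem_nhds (Ioi_mem_nhds hts)]
      with u hu hu' using ⟨hu'.le, hu.2⟩

/-- Picard–Lindelöf on the unit ball around x. The point is that ε depends only on R, so that a
solution known to remain in a ball can be prolonged by steps of a fixed length. -/
lemma LipB.exists_local [CompleteSpace W] {F : W → W} (hF : LipB F) (R : ℝ) :
    ∃ ε > 0, ∀ (s : ℝ) (x : W), ‖x‖ ≤ R → ∃ Y : ℝ → W, Y s = x ∧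
      ∀ t ∈ Icc s (s + ε), HasDerivWithinAt Y (F (Y t)) (Icc s (s + ε)) t := by
  obtain ⟨K, hK⟩ := hF.lipschitzOnWith (R + 1)
  obtain ⟨L, hL, hb⟩ := hF.bounded (R + 1)
  -- The speed is at most L on the unit ball around x, so that a time 1 / (L + 1) is too short to
  -- leave it.
  refine ⟨1 / (L + 1), by positivity, fun s x hx => ?_⟩
  have hsub : Metric.closedBall x ((1 : ℝ≥0) : ℝ) ⊆ Metric.closedBall 0 (R + 1) := by
    refine Metric.closedBall_subset_closedBall' ?_
    rw [dist_zero_right]; simp; linarith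
  have hε : (0 : ℝ) < 1 / (L + 1) := by positivity
  have := IsPicardLindelof.of_time_independent (f := F) (tmin := s) (tmax := s + 1 / (L + 1))
    (t₀ := ⟨s, le_rfl, by linarith⟩) (x₀ := x) (a := 1) (r := 0) (L := ⟨L, hL⟩) (K := K)
    (fun z hz => hb z (by simpa using hsub hz)) (hK.mono hsub) (by
      simp only [add_sub_cancel_left, sub_self, NNReal.coe_one, NNReal.coe_zero, sub_zero]
      rw [max_eq_left hε.le, mul_one_div, div_le_one (by positivity)]
      exact (lt_add_one L).le)
  exact this.exists_eq_forall_mem_Icc_hasDerivWithinAt₀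

/-- Continuation in steps of the uniform length ε of `LipB.exists_local`. The a priori bound is
asked only of solutions that start at x₀, and only at their final time, since that is where the next
step is attached. -/
theorem LipB.exists_solvesOn [CompleteSpace W] {F : W → W} (hF : LipB F) {x₀ : W} {T R : ℝ}
    (hT : 0 ≤ T) (hb : ∀ τ ∈ Icc 0 T, ∀ X : ℝ → W, X 0 = x₀ → SolvesOn F X τ → ‖X τ‖ ≤ R) :
    ∃ X : ℝ → W, X 0 = x₀ ∧ SolvesOn F X T := by
  obtain ⟨ε, hε, hloc⟩ := hF.exists_local R
  have key : ∀ n : ℕ, ∃ X : ℝ → W, X 0 = x₀ ∧ SolvesOn F X (min (n * ε) T) := by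
    intro n
    induction n with
    | zero =>
      refine ⟨fun _ => x₀, rfl, fun t ht => ?_⟩
      have h0 : min ((0 : ℕ) * ε) T = 0 := by simp [hT]
      rw [h0] at ht ⊢
      rw [Icc_self]
      exact hasDerivWithinAt_iff_hasFDerivWithinAt.2 HasFDerivWithinAt.singleton
    | succ n ih =>
      obtain ⟨X, hX0, hX⟩ := ih
      have hs : 0 ≤ min (n * ε) T := le_min (by positivity) hT
      obtain ⟨Y, hY0, hY⟩ := hloc (min (n * ε) T) _ (hb _ ⟨hs, min_le_right _ _⟩ X hX0 hX)
      refine ⟨_, ?_, (SolvesOn.glue hs (by linarith) hX hY hY0).mono ?_⟩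
      · simp [hs, hX0]
      · push_cast
        rcases le_total (n * ε) T with h | h
        · rw [min_eq_left h]; exact (min_le_left _ _).trans (by linarith)
        · rw [min_eq_right h]; exact (min_le_right _ _).trans (by linarith)
  obtain ⟨n, hn⟩ := exists_nat_ge (T / ε)
  obtain ⟨X, hX0, hX⟩ := key n
  rw [min_eq_right ((div_le_iff₀ hε).1 hn)] at hX
  exact ⟨X, hX0, hX⟩

theorem LipB.exists_solvesGlobally [CompleteSpace W] {F : W → W} (hF : LipB F) {x₀ : W}
    (hb : ∀ T, 0 ≤ T → ∃ R, ∀ τ ∈ Icc 0 T, ∀ X : ℝ → W, X 0 = x₀ → SolvesOn F X τ → ‖X τ‖ ≤ R) :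
    ∃ X : ℝ → W, X 0 = x₀ ∧ SolvesGlobally F X := by
  have h : ∀ T : ℝ, ∃ X : ℝ → W, X 0 = x₀ ∧ (0 ≤ T → SolvesOn F X T) := by
    intro T
    by_cases hT : 0 ≤ T
    · obtain ⟨R, hR⟩ := hb T hT
      obtain ⟨X, h1, h2⟩ := hF.exists_solvesOn hT hR
      exact ⟨X, h1, fun _ => h2⟩
    · exact ⟨fun _ => x₀, rfl, fun h => absurd h hT⟩
  choose Z hZ0 hZ using h
  -- At time t the solution on [0, t + 1] is used, so that t is not a right end point; by uniqueness
  -- the choices for different times agree.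
  refine ⟨fun t => Z (t + 1) t, hZ0 _, fun t ht => ?_⟩
  have heq : ∀ s ∈ Icc 0 (t + 1), Z (s + 1) s = Z (t + 2) s := by
    intro s hs
    refine hF.unique (τ := s) ((hZ _ (by linarith [hs.1])).mono (by linarith))
      ((hZ _ (by linarith)).mono (by linarith [hs.2])) ?_ s ⟨hs.1, le_rfl⟩
    rw [hZ0, hZ0]
  have h1 := hZ (t + 2) (by linarith) t ⟨ht, by linarith⟩
  have h2 : HasDerivWithinAt (fun s => Z (s + 1) s) (F (Z (t + 1) t)) (Icc 0 (t + 1)) t := by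
    rw [heq t ⟨ht, by linarith⟩]
    exact (h1.mono (Icc_subset_Icc_right (by linarith))).congr heq (heq t ⟨ht, by linarith⟩)
  refine h2.mono_of_mem_nhdsWithin ?_
  filter_upwards [self_mem_nhdsWithin,
    mem_nhdsWithin_of_mem_nhds (Iio_mem_nhds (show t < t + 1 by linarith))]
    with u hu hu' using ⟨hu, le_of_lt hu'⟩

end LipB

/-! ### Calculus of locally absolutely continuous functions -/

section LocAC

variable {f g : ℝ → ℝ}

lemma LocAC.mul (hf : LocAC f) (hg : LocAC g) : LocAC (fun x => f x * g x) :=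
  fun a b => (hf a b).fun_mul (hg a b)

lemma LocAC.neg (hf : LocAC f) : LocAC (fun x => -f x) := fun a b => (hf a b).neg

lemma LocAC.sub (hf : LocAC f) (hg : LocAC g) : LocAC (fun x => f x - g x) :=
  fun a b => (hf a b).sub (hg a b)

lemma LocAC.add' (hf : LocAC f) (hg : LocAC g) : LocAC (fun x => f x + g x) := hf.add hg

lemma LocAC.const (c : ℝ) : LocAC (fun _ => c) := LocAC.of_lipschitz (LipschitzWith.const c)

lemma LocAC.id : LocAC (fun x => x) := LocAC.of_lipschitz LipschitzWith.id

lemma LocAC.pow (hf : LocAC f) (n : ℕ) : LocAC (fun x => f x ^ n) := by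
  induction n with
  | zero => simpa using LocAC.const 1
  | succ n ih => simpa [pow_succ] using ih.mul hf

lemma LocAC.comp_left {φ : ℝ → ℝ} (hφ : ContDiff ℝ 1 φ) (hf : LocAC f) :
    LocAC (fun x => φ (f x)) := by
  intro a b
  obtain ⟨C, hC⟩ := isCompact_uIcc.exists_bound_of_continuousOn
    (hf.continuous.continuousOn (s := uIcc a b))
  have hmem : ∀ x ∈ uIcc a b, f x ∈ Icc (-C) C := fun x hx => abs_le.1 (hC x hx)
  obtain ⟨K, hK⟩ := (hφ.contDiffOn (s := Icc (-C) C)).exists_lipschitzOnWith one_ne_zero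
    (convex_Icc _ _) isCompact_Icc
  rw [absolutelyContinuousOnInterval_iff]
  intro ε hε
  obtain ⟨δ, hδ, H⟩ := (absolutelyContinuousOnInterval_iff f _ _).1 (hf a b) (ε / (K + 1))
    (by positivity)
  refine ⟨δ, hδ, fun E hE hs => ?_⟩
  calc ∑ i ∈ Finset.range E.1, dist (φ (f (E.2 i).1)) (φ (f (E.2 i).2))
      ≤ ∑ i ∈ Finset.range E.1, K * dist (f (E.2 i).1) (f (E.2 i).2) :=
        Finset.sum_le_sum fun i hi => hK.dist_le_mul _ (hmem _ (hE.1 i hi).1) _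
          (hmem _ (hE.1 i hi).2)
    _ = K * ∑ i ∈ Finset.range E.1, dist (f (E.2 i).1) (f (E.2 i).2) := by rw [Finset.mul_sum]
    _ ≤ K * (ε / (K + 1)) := by gcongr; exact (H E hE hs).le
    _ < ε := by
        rw [mul_div_assoc', div_lt_iff₀ (by positivity)]
        nlinarith [K.2]

lemma LocAC.of_contDiff {φ : ℝ → ℝ} (hφ : ContDiff ℝ 1 φ) : LocAC φ := LocAC.comp_left hφ LocAC.id

lemma LocAC.integral_deriv (hf : LocAC f) (a b : ℝ) : ∫ x in a..b, deriv f x = f b - f a :=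
  (hf a b).integral_deriv_eq_sub

lemma LocAC.intervalIntegrable_deriv (hf : LocAC f) (a b : ℝ) :
    IntervalIntegrable (deriv f) volume a b := (hf a b).intervalIntegrable_deriv

lemma LocAC.primitive (hf : LocallyIntegrable f volume) (a c : ℝ) :
    LocAC (fun x => c + ∫ t in a..x, f t) := by
  refine (LocAC.const c).add' fun u v => ?_
  have h1 : IntervalIntegrable f volume (min a (min u v)) (max a (max u v)) :=
    (hf.integrableOn_isCompact isCompact_uIcc).intervalIntegrable
  have h2 := h1.absolutelyContinuousOnInterval_intervalIntegral (c := a) (by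
    rw [uIcc_of_le (by simp)]; simp)
  refine h2.mono ?_
  rw [uIcc_of_le (a := min a _) (by simp)]
  exact Icc_subset_Icc (min_le_right _ _) (le_max_right _ _)

lemma LocAC.deriv_primitive (hf : LocallyIntegrable f volume) (a c : ℝ) :
    deriv (fun x => c + ∫ t in a..x, f t) =ᵐ[volume] f := by
  filter_upwards [LocallyIntegrable.ae_hasDerivAt_integral hf] with x hx
  exact ((hx a).const_add c).deriv

/-- The difference of values of a locally absolutely continuous function whose derivative is
dominated by that of another one. -/
lemma LocAC.integral_eq_of_tendsto (hf : LocAC f) (hi : Integrable (deriv f)) {m l : ℝ}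
    (hm : Tendsto f atBot (𝓝 m)) (hl : Tendsto f atTop (𝓝 l)) : ∫ x, deriv f x = l - m := by
  have h1 := intervalIntegral_tendsto_integral hi (tendsto_neg_atTop_atBot (G := ℝ)) tendsto_id
  have h2 : Tendsto (fun i : ℝ => ∫ x in -i..i, deriv f x) atTop (𝓝 (l - m)) := by
    simp_rw [hf.integral_deriv]
    exact hl.sub (hm.comp tendsto_neg_atTop_atBot)
  exact tendsto_nhds_unique h1 h2

/-- Integrability of the derivative produces a limit, and an integrable function cannot have a
nonzero one. -/
lemma LocAC.tendsto_atTop_zero (hf : LocAC f) (hi : Integrable (deriv f)) (h : Integrable f) :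
    Tendsto f atTop (𝓝 0) := by
  have h1 := (intervalIntegral_tendsto_integral_Ioi 0 hi.integrableOn tendsto_id).const_add (f 0)
  simp_rw [hf.integral_deriv] at h1
  simp only [add_sub_cancel] at h1
  have h2 := IntegrableAtFilter.eq_zero_of_tendsto (h.integrableAtFilter atTop) (fun s hs => by
    obtain ⟨a, ha⟩ := mem_atTop_sets.1 hs
    exact top_le_iff.1 (Real.volume_Ici (a := a) ▸ measure_mono (μ := volume) ha)) h1
  rwa [h2] at h1

lemma LocAC.tendsto_atBot_zero (hf : LocAC f) (hi : Integrable (deriv f)) (h : Integrable f) :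
    Tendsto f atBot (𝓝 0) := by
  have h1 := (intervalIntegral_tendsto_integral_Iic 0 hi.integrableOn tendsto_id).const_sub (f 0)
  simp_rw [hf.integral_deriv] at h1
  simp only [sub_sub_cancel] at h1
  have h2 := IntegrableAtFilter.eq_zero_of_tendsto (h.integrableAtFilter atBot) (fun s hs => by
    obtain ⟨a, ha⟩ := mem_atBot_sets.1 hs
    exact top_le_iff.1 (Real.volume_Iic (a := a) ▸ measure_mono (μ := volume) ha)) h1
  rwa [h2] at h1

lemma LocAC.deriv_sq (hf : LocAC f) :
    deriv (fun x => f x ^ 2) =ᵐ[volume] fun x => 2 * (f x * deriv f x) := by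
  filter_upwards [hf.ae_differentiableAt] with x hx
  rw [(hx.hasDerivAt.fun_pow 2).deriv]; simp; ring

lemma MemSob.integrable_mul_deriv (hf : MemSob 2 2 f) : Integrable (fun x => f x * deriv f x) :=
  hf.memLp.integrable_mul hf.memLp_deriv

lemma MemSob.integrable_deriv_sq (hf : MemSob 2 2 f) : Integrable (deriv fun x => f x ^ 2) :=
  (hf.integrable_mul_deriv.const_mul 2).congr hf.locAC.deriv_sq.symm

lemma MemSob.sq_tendsto_zero (hf : MemSob 2 2 f) :
    Tendsto (fun x => f x ^ 2) atTop (𝓝 0) ∧ Tendsto (fun x => f x ^ 2) atBot (𝓝 0) :=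
  ⟨(hf.locAC.pow 2).tendsto_atTop_zero hf.integrable_deriv_sq hf.memLp.integrable_sq,
    (hf.locAC.pow 2).tendsto_atBot_zero hf.integrable_deriv_sq hf.memLp.integrable_sq⟩

lemma tendsto_zero_of_sq {ι : Type*} {l : Filter ι} {u : ι → ℝ}
    (h : Tendsto (fun x => u x ^ 2) l (𝓝 0)) : Tendsto u l (𝓝 0) := by
  have := (Real.continuous_sqrt.tendsto 0).comp h
  simp only [Function.comp_def, Real.sqrt_zero, Real.sqrt_sq_eq_abs] at this
  exact (tendsto_zero_iff_abs_tendsto_zero _).2 this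

lemma MemSob.tendsto_atTop (hf : MemSob 2 2 f) : Tendsto f atTop (𝓝 0) :=
  tendsto_zero_of_sq hf.sq_tendsto_zero.1

lemma MemSob.tendsto_atBot (hf : MemSob 2 2 f) : Tendsto f atBot (𝓝 0) :=
  tendsto_zero_of_sq hf.sq_tendsto_zero.2

/-- Integrate (f²)' = 2 f f' from -∞, where f² vanishes. Keeping the product f f' under the
integral, rather than splitting it into norms, is what allows the energy to bound ū later. -/
lemma MemSob.sq_le (hf : MemSob 2 2 f) (x : ℝ) : f x ^ 2 ≤ 2 * ∫ t, |f t * deriv f t| := by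
  have h1 := intervalIntegral_tendsto_integral_Iic x hf.integrable_deriv_sq.integrableOn tendsto_id
  simp_rw [(hf.locAC.pow 2).integral_deriv] at h1
  have h2 := tendsto_nhds_unique h1 (hf.sq_tendsto_zero.2.const_sub (f x ^ 2))
  rw [sub_zero] at h2
  rw [← h2, ← integral_const_mul]
  refine (setIntegral_mono_on_ae hf.integrable_deriv_sq.integrableOn
    ((hf.integrable_mul_deriv.abs.const_mul 2).integrableOn) measurableSet_Iic ?_).trans
      (setIntegral_le_integral (hf.integrable_mul_deriv.abs.const_mul 2)
        (ae_of_all _ fun t => by positivity))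
  filter_upwards [hf.locAC.deriv_sq] with t ht _
  rw [ht]
  exact mul_le_mul_of_nonneg_left (le_abs_self _) (by norm_num)

end LocAC

/-! ### Square-integrable functions -/

/-- `L²(ℝ)`. -/
abbrev L2 : Type := Lp ℝ 2 (volume : Measure ℝ)

/-- Bounded continuous functions on the line. -/
abbrev BC : Type := BoundedContinuousFunction ℝ ℝ

lemma L2.integral_mul_le (u v : L2) : ∫ x, |u x * v x| ≤ ‖u‖ * ‖v‖ := by
  have h := real_inner_le_norm |u| |v|
  rw [norm_abs_eq_norm, norm_abs_eq_norm] at h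
  refine le_trans (le_of_eq ?_) h
  rw [L2.inner_def]
  refine integral_congr_ae ?_
  filter_upwards [Lp.coeFn_abs u, Lp.coeFn_abs v] with x h1 h2
  rw [h1, h2, abs_mul]
  simp [mul_comm]

lemma L2.norm_sq (u : L2) : ‖u‖ ^ 2 = ∫ x, u x ^ 2 := by
  rw [← real_inner_self_eq_norm_sq, L2.inner_def]
  refine integral_congr_ae (ae_of_all _ fun x => ?_)
  simp [sq]

lemma L2.integrable_mul (u v : L2) : Integrable (fun x => u x * v x) :=
  (Lp.memLp u).integrable_mul (Lp.memLp v)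

lemma L2.inner_eq (u v : L2) : inner ℝ u v = ∫ x, u x * v x := by
  rw [L2.inner_def]
  exact integral_congr_ae (ae_of_all _ fun x => by simp [mul_comm])

/-! ### Completeness of the Sobolev-type spaces -/

section Complete

variable {r p q : ℝ≥0∞} [Fact (1 ≤ r)] [Fact (1 ≤ p)] [Fact (1 ≤ q)]

lemma Sob.isometry_toPair : Isometry (Sob.toPair r p q) :=
  AddMonoidHomClass.isometry_of_norm _ fun _ => rfl

/-- On a bounded interval the L^q norm dominates the L¹ norm, with q = ∞ included. -/
lemma tendsto_intervalIntegral_of_Lp {v : ℕ → Lp ℝ q (volume : Measure ℝ)}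
    {w : Lp ℝ q (volume : Measure ℝ)} (h : Tendsto v atTop (𝓝 w)) (a b : ℝ) :
    Tendsto (fun n => ∫ x in a..b, v n x) atTop (𝓝 (∫ x in a..b, w x)) := by
  have hloc : ∀ u : Lp ℝ q (volume : Measure ℝ), IntegrableOn u (uIoc a b) := fun u =>
    (((Lp.memLp u).locallyIntegrable Fact.out).integrableOn_isCompact
      (isCompact_uIcc (a := a) (b := b))).mono_set uIoc_subset_uIcc
  have key : Tendsto (fun n => ∫ x in uIoc a b, v n x) atTop (𝓝 (∫ x in uIoc a b, w x)) := by
    have h1 : Tendsto (fun n => eLpNorm (v n - w : Lp ℝ q (volume : Measure ℝ)) q volume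
        * (volume.restrict (uIoc a b) univ) ^ (1 / (1 : ℝ≥0∞).toReal - 1 / q.toReal))
        atTop (𝓝 0) := by
      have h2 := (Lp.tendsto_Lp_iff_tendsto_eLpNorm' _ _).1 h
      have h3 := ENNReal.Tendsto.mul_const (b := (volume.restrict (uIoc a b) univ) ^
        (1 / (1 : ℝ≥0∞).toReal - 1 / q.toReal)) h2 (Or.inr ?_)
      · rw [zero_mul] at h3
        refine h3.congr fun n => ?_
        congr 1
        exact eLpNorm_congr_ae (Lp.coeFn_sub _ _).symm
      · refine ENNReal.rpow_ne_top_of_nonneg ?_ ?_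
        · have hq : (1 : ℝ≥0∞) ≤ q := Fact.out
          rcases eq_or_ne q ∞ with rfl | hq'
          · simp
          · have := ENNReal.toReal_mono hq' hq
            simp only [ENNReal.toReal_one] at this ⊢
            rw [div_one, sub_nonneg, div_le_one (by linarith)]
            exact this
        · simp [uIoc]
    have h4 := tendsto_setIntegral_of_L1' (μ := volume.restrict (uIoc a b)) (w : ℝ → ℝ)
      (Lp.aestronglyMeasurable w).restrict (F := fun n => (v n : ℝ → ℝ)) (l := atTop)
      (Eventually.of_forall fun n => hloc (v n)) (by
        refine tendsto_of_tendsto_of_tendsto_of_le_of_le tendsto_const_nhds h1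
          (fun _ => bot_le) fun n => ?_
        have e : eLpNorm (⇑(v n) - ⇑w) 1 (volume.restrict (uIoc a b)) =
            eLpNorm (v n - w : Lp ℝ q (volume : Measure ℝ)) 1 (volume.restrict (uIoc a b)) :=
          eLpNorm_congr_ae (ae_restrict_of_ae (Lp.coeFn_sub _ _).symm)
        rw [e]
        refine (eLpNorm_le_eLpNorm_mul_rpow_measure_univ (Fact.out : (1 : ℝ≥0∞) ≤ q)
          (Lp.aestronglyMeasurable (v n - w)).restrict).trans ?_
        exact mul_le_mul_left (eLpNorm_mono_measure _ Measure.restrict_le_self) _) univ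
    simpa using h4
  simp_rw [intervalIntegral.intervalIntegral_eq_integral_uIoc]
  exact key.const_smul _

/-- The space is isometric to the range of f ↦ (f, f_ξ), and this range is closed: the second
component of a limit is the weak derivative of the first, as one sees by passing to the limit in the
fundamental theorem of calculus. -/
instance Sob.completeSpace : CompleteSpace (Sob r p q) := by
  refine Sob.isometry_toPair.isUniformInducing.completeSpace (IsClosed.isComplete ?_)
  refine isClosed_of_closure_subset fun z hz => ?_
  obtain ⟨s, hs, hsz⟩ := mem_closure_iff_seq_limit.1 hz
  choose f hf using hs
  have hpair : Tendsto (fun n => WithLp.ofLp (s n)) atTop (𝓝 (WithLp.ofLp z)) :=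
    ((WithLp.prod_continuous_ofLp r _ _).tendsto z).comp hsz
  have h1 : Tendsto (fun n => (f n).memSob.memLp.toLp (f n)) atTop (𝓝 z.fst) := by
    refine ((continuous_fst.tendsto _).comp hpair).congr fun n => ?_
    simp only [Function.comp, ← hf n]; rfl
  have h2 : Tendsto (fun n => (f n).memSob.memLp_deriv.toLp (deriv (f n))) atTop (𝓝 z.snd) := by
    refine ((continuous_snd.tendsto _).comp hpair).congr fun n => ?_
    simp only [Function.comp, ← hf n]; rfl
  obtain ⟨ns, hns, hae⟩ := (tendstoInMeasure_of_tendsto_Lp h1).exists_seq_tendsto_ae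
  have hall : ∀ᵐ x : ℝ, ∀ n, ((f n).memSob.memLp.toLp (f n)) x = f n x :=
    ae_all_iff.2 fun n => MemLp.coeFn_toLp _
  have hae' : ∀ᵐ x : ℝ, Tendsto (fun k => f (ns k) x) atTop (𝓝 (z.fst x)) := by
    filter_upwards [hae, hall] with x hx hx'
    simpa only [hx'] using hx
  obtain ⟨x₀, hx₀⟩ := hae'.exists
  have hloc : LocallyIntegrable z.snd volume := (Lp.memLp z.snd).locallyIntegrable Fact.out
  have hint : ∀ x, Tendsto (fun k => ∫ t in x₀..x, deriv (f (ns k)) t) atTop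
      (𝓝 (∫ t in x₀..x, z.snd t)) := by
    intro x
    refine (tendsto_intervalIntegral_of_Lp (h2.comp hns.tendsto_atTop) x₀ x).congr fun k => ?_
    refine intervalIntegral.integral_congr_ae ?_
    filter_upwards [MemLp.coeFn_toLp (f (ns k)).memSob.memLp_deriv] with t ht _ using ht
  -- The continuous representative of the limit: the primitive of the limiting derivative,
  -- normalized at a point x₀ at which a subsequence converges.
  set F : ℝ → ℝ := fun x => z.fst x₀ + ∫ t in x₀..x, z.snd t with hF
  have hFae : F =ᵐ[volume] z.fst := by
    filter_upwards [hae'] with x hx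
    refine tendsto_nhds_unique ((hx₀.add (hint x)).congr fun k => ?_) hx
    rw [(f (ns k)).memSob.locAC.integral_deriv]; ring
  have hd : deriv F =ᵐ[volume] z.snd := LocAC.deriv_primitive hloc _ _
  have hmem : MemSob p q F := ⟨LocAC.primitive hloc _ _, (Lp.memLp z.fst).ae_eq hFae.symm,
    (Lp.memLp z.snd).ae_eq hd.symm⟩
  refine ⟨Sob.mk hmem, (WithLp.ofLp_injective r) (Prod.ext ?_ ?_)⟩
  · exact Lp.ext ((MemLp.coeFn_toLp hmem.memLp).trans hFae)
  · exact Lp.ext ((MemLp.coeFn_toLp hmem.memLp_deriv).trans hd)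

end Complete

/-! ### Embeddings and multiplication operators -/

lemma abs_le_of_ae_abs_le {f : ℝ → ℝ} {C : ℝ} (hf : Continuous f) (h : ∀ᵐ x : ℝ, |f x| ≤ C)
    (x : ℝ) : |f x| ≤ C := by
  have hd : Dense {x | |f x| ≤ C} := Measure.dense_of_ae h
  have hcl : IsClosed {x | |f x| ≤ C} := isClosed_le hf.abs continuous_const
  have : x ∈ closure {x | |f x| ≤ C} := hd x
  rwa [hcl.closure_eq] at this

lemma V.abs_le (f : V) (x : ℝ) : |f x| ≤ (eLpNorm f ∞ volume).toReal := by
  refine abs_le_of_ae_abs_le f.memSob.locAC.continuous ?_ x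
  have h : ∀ᵐ x : ℝ, ‖f x‖ₑ ≤ eLpNorm f ∞ volume := by
    rw [eLpNorm_exponent_top]; exact ae_le_eLpNormEssSup
  filter_upwards [h] with x hx
  rw [← Real.norm_eq_abs, ← toReal_enorm]
  exact ENNReal.toReal_mono f.memSob.memLp.2.ne hx

lemma V.abs_le_norm (f : V) (x : ℝ) : |f x| ≤ ‖f‖ := by
  rw [V.norm_def]
  exact (V.abs_le f x).trans (le_add_of_nonneg_right ENNReal.toReal_nonneg)

/-- The inclusion of `V` in the bounded continuous functions. -/
def V.toBC : V →L[ℝ] BC := LinearMap.mkContinuous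
  { toFun := fun f => BoundedContinuousFunction.ofNormedAddCommGroup f f.memSob.locAC.continuous
      ‖f‖ (V.abs_le_norm f)
    map_add' := fun _ _ => rfl
    map_smul' := fun _ _ => rfl } 1 fun f => by
      rw [one_mul]
      exact (BoundedContinuousFunction.norm_le (norm_nonneg _)).2 (V.abs_le_norm f)

/-- `f ↦ f_ξ` on `V`. -/
def V.dL : V →L[ℝ] L2 := LinearMap.mkContinuous
  (LinearMap.snd ℝ _ _ ∘ₗ (WithLp.linearEquiv 1 ℝ _).toLinearMap ∘ₗ Sob.toPair 1 ∞ 2) 1 fun f => by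
    rw [one_mul, V.norm_def]
    exact (Lp.norm_toLp _ f.memSob.memLp_deriv).le.trans
      (le_add_of_nonneg_left ENNReal.toReal_nonneg)

lemma V.coeFn_dL (f : V) : V.dL f =ᵐ[volume] deriv f := MemLp.coeFn_toLp f.memSob.memLp_deriv

lemma V.norm_eq (f : V) : ‖f‖ = ‖V.toBC f‖ + ‖V.dL f‖ := by
  have h2 : ‖V.dL f‖ = (eLpNorm (deriv f) 2 volume).toReal := Lp.norm_toLp _ f.memSob.memLp_deriv
  rw [V.norm_def, h2]
  congr 1
  refine le_antisymm ?_ ((BoundedContinuousFunction.norm_le ENNReal.toReal_nonneg).2 (V.abs_le f))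
  refine ENNReal.toReal_le_of_le_ofReal (norm_nonneg _) ?_
  rw [eLpNorm_exponent_top]
  refine eLpNormEssSup_le_of_ae_enorm_bound (ae_of_all _ fun x => ?_)
  rw [← ofReal_norm]
  exact ENNReal.ofReal_le_ofReal ((V.toBC f).norm_coe_le_norm x)

/-- The inclusion of `H¹` in `L²`. -/
def H1.toL2 : H1 →L[ℝ] L2 := LinearMap.mkContinuous
  (LinearMap.fst ℝ _ _ ∘ₗ (WithLp.linearEquiv 2 ℝ _).toLinearMap ∘ₗ Sob.toPair 2 2 2) 1 fun f => by
    rw [one_mul, H1.norm_def]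
    exact (Lp.norm_toLp _ f.memSob.memLp).le.trans
      (Real.le_sqrt_of_sq_le (le_add_of_nonneg_right (sq_nonneg _)))

/-- `f ↦ f_ξ` on `H¹`. -/
def H1.dL : H1 →L[ℝ] L2 := LinearMap.mkContinuous
  (LinearMap.snd ℝ _ _ ∘ₗ (WithLp.linearEquiv 2 ℝ _).toLinearMap ∘ₗ Sob.toPair 2 2 2) 1 fun f => by
    rw [one_mul, H1.norm_def]
    exact (Lp.norm_toLp _ f.memSob.memLp_deriv).le.trans
      (Real.le_sqrt_of_sq_le (le_add_of_nonneg_left (sq_nonneg _)))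

lemma H1.coeFn_toL2 (f : H1) : H1.toL2 f =ᵐ[volume] f := MemLp.coeFn_toLp f.memSob.memLp

lemma H1.coeFn_dL (f : H1) : H1.dL f =ᵐ[volume] deriv f := MemLp.coeFn_toLp f.memSob.memLp_deriv

lemma H1.norm_eq (f : H1) : ‖f‖ = √(‖H1.toL2 f‖ ^ 2 + ‖H1.dL f‖ ^ 2) := by
  rw [H1.norm_def]
  have h1 : ‖H1.toL2 f‖ = (eLpNorm f 2 volume).toReal := Lp.norm_toLp _ f.memSob.memLp
  have h2 : ‖H1.dL f‖ = (eLpNorm (deriv f) 2 volume).toReal := Lp.norm_toLp _ f.memSob.memLp_deriv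
  rw [h1, h2]

lemma H1.norm_le (f : H1) : ‖f‖ ≤ ‖H1.toL2 f‖ + ‖H1.dL f‖ := by
  rw [H1.norm_eq]
  refine Real.sqrt_le_iff.2 ⟨by positivity, ?_⟩
  nlinarith [norm_nonneg (H1.toL2 f), norm_nonneg (H1.dL f)]

/-- f(x)² ≤ 2 ∫ |f f_ξ| ≤ 2 ‖f‖ ‖f_ξ‖ ≤ ‖f‖² + ‖f_ξ‖² in L² norms, which gives the embedding with
constant 1. -/
lemma H1.abs_le_norm (f : H1) (x : ℝ) : |f x| ≤ ‖f‖ := by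
  refine abs_le_of_sq_le_sq' ?_ (norm_nonneg _) |> abs_le.2
  have h1 := f.memSob.sq_le x
  have h2 := L2.integral_mul_le (H1.toL2 f) (H1.dL f)
  have h3 : ∫ t, |f t * deriv f t| = ∫ t, |H1.toL2 f t * H1.dL f t| := by
    refine integral_congr_ae ?_
    filter_upwards [H1.coeFn_toL2 f, H1.coeFn_dL f] with t h1 h2
    rw [h1, h2]
  rw [H1.norm_eq, Real.sq_sqrt (by positivity)]
  rw [h3] at h1
  nlinarith [sq_nonneg (‖H1.toL2 f‖ - ‖H1.dL f‖)]

/-- The inclusion of `H¹` in the bounded continuous functions. -/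
def H1.toBC : H1 →L[ℝ] BC := LinearMap.mkContinuous
  { toFun := fun f => BoundedContinuousFunction.ofNormedAddCommGroup f f.memSob.locAC.continuous
      ‖f‖ (H1.abs_le_norm f)
    map_add' := fun _ _ => rfl
    map_smul' := fun _ _ => rfl } 1 fun f => by
      rw [one_mul]
      exact (BoundedContinuousFunction.norm_le (norm_nonneg _)).2 (H1.abs_le_norm f)

lemma memLp_bc_mul (f : BC) {u : ℝ → ℝ} (hu : MemLp u 2 volume) :
    MemLp (fun x => f x * u x) 2 volume :=
  hu.of_le_mul (c := ‖f‖) (f.continuous.aestronglyMeasurable.mul hu.1) (ae_of_all _ fun x => by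
    rw [norm_mul]
    exact mul_le_mul_of_nonneg_right (f.norm_coe_le_norm x) (norm_nonneg _))

/-- Multiplication of an `L²` function by a bounded continuous function. -/
def mulL : BC →L[ℝ] L2 →L[ℝ] L2 := LinearMap.mkContinuous₂
  (LinearMap.mk₂ ℝ (fun (f : BC) (u : L2) => (memLp_bc_mul f (Lp.memLp u)).toLp _)
    (fun f g u => Lp.ext <| by
      filter_upwards [MemLp.coeFn_toLp (memLp_bc_mul (f + g) (Lp.memLp u)),
        MemLp.coeFn_toLp (memLp_bc_mul f (Lp.memLp u)),
        MemLp.coeFn_toLp (memLp_bc_mul g (Lp.memLp u)), Lp.coeFn_add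
          ((memLp_bc_mul f (Lp.memLp u)).toLp _) ((memLp_bc_mul g (Lp.memLp u)).toLp _)]
        with x h1 h2 h3 h4
      rw [h1, h4, Pi.add_apply, h2, h3]
      simp [add_mul])
    (fun c f u => Lp.ext <| by
      filter_upwards [MemLp.coeFn_toLp (memLp_bc_mul (c • f) (Lp.memLp u)),
        MemLp.coeFn_toLp (memLp_bc_mul f (Lp.memLp u)), Lp.coeFn_smul c
          ((memLp_bc_mul f (Lp.memLp u)).toLp _)] with x h1 h2 h3
      rw [h1, h3, Pi.smul_apply, h2]
      simp [mul_assoc])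
    (fun f u v => Lp.ext <| by
      filter_upwards [MemLp.coeFn_toLp (memLp_bc_mul f (Lp.memLp (u + v))),
        MemLp.coeFn_toLp (memLp_bc_mul f (Lp.memLp u)),
        MemLp.coeFn_toLp (memLp_bc_mul f (Lp.memLp v)), Lp.coeFn_add u v, Lp.coeFn_add
          ((memLp_bc_mul f (Lp.memLp u)).toLp _) ((memLp_bc_mul f (Lp.memLp v)).toLp _)]
        with x h1 h2 h3 h4 h5
      rw [h1, h5, Pi.add_apply, h2, h3, h4]
      simp [mul_add])
    (fun c f u => Lp.ext <| by
      filter_upwards [MemLp.coeFn_toLp (memLp_bc_mul f (Lp.memLp (c • u))),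
        MemLp.coeFn_toLp (memLp_bc_mul f (Lp.memLp u)), Lp.coeFn_smul c u, Lp.coeFn_smul c
          ((memLp_bc_mul f (Lp.memLp u)).toLp _)] with x h1 h2 h3 h4
      rw [h1, h4, Pi.smul_apply, h2, h3]
      simp; ring)) 1 fun f u => by
    rw [one_mul]
    refine Lp.norm_le_mul_norm_of_ae_le_mul ?_
    filter_upwards [MemLp.coeFn_toLp (memLp_bc_mul f (Lp.memLp u))] with x hx
    simp only [LinearMap.mk₂_apply]
    rw [hx, norm_mul]
    exact mul_le_mul_of_nonneg_right (f.norm_coe_le_norm x) (norm_nonneg _)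

lemma coeFn_mulL (f : BC) (u : L2) : mulL f u =ᵐ[volume] fun x => f x * u x :=
  MemLp.coeFn_toLp (memLp_bc_mul f (Lp.memLp u))

/-- Multiplication of bounded continuous functions. -/
def mulBC : BC →L[ℝ] BC →L[ℝ] BC := ContinuousLinearMap.mul ℝ BC

/-! ### Superposition operators -/

/-- A function `φ(ξ, z)` that is, together with its Lipschitz constants in bounded `z`, of size
`O(e^{-k|ξ|})`. -/
structure Nem (k : ℕ) where
  φ : ℝ → ℝ → ℝ
  cont : Continuous fun p : ℝ × ℝ => φ p.1 p.2
  bdd : ∃ C : ℝ, ∀ ξ, |φ ξ 0| ≤ C * Real.exp (-(k * |ξ|))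
  lip : ∀ R : ℝ, ∃ C : ℝ, 0 ≤ C ∧ ∀ ξ z₁ z₂, |z₁| ≤ R → |z₂| ≤ R →
    |φ ξ z₁ - φ ξ z₂| ≤ C * Real.exp (-(k * |ξ|)) * |z₁ - z₂|

namespace Nem

variable {k : ℕ} (N : Nem k)

lemma weight_le (ξ : ℝ) : Real.exp (-(k * |ξ|)) ≤ 1 :=
  Real.exp_le_one_iff.2 (neg_nonpos.2 (by positivity))

lemma bound (R : ℝ) : ∃ C : ℝ, ∀ ξ z, |z| ≤ R → |N.φ ξ z| ≤ C * Real.exp (-(k * |ξ|)) := by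
  obtain ⟨C, hC⟩ := N.bdd
  obtain ⟨D, hD, h⟩ := N.lip (max R 0)
  refine ⟨C + D * max R 0, fun ξ z hz => ?_⟩
  have h1 := h ξ z 0 (hz.trans (le_max_left _ _)) (by simp)
  rw [sub_zero] at h1
  have h2 := hC ξ
  have h3 : |N.φ ξ z| ≤ |N.φ ξ 0| + |N.φ ξ z - N.φ ξ 0| := by
    have := abs_add_le (N.φ ξ 0) (N.φ ξ z - N.φ ξ 0)
    rwa [add_sub_cancel] at this
  have h4 : D * Real.exp (-(k * |ξ|)) * |z| ≤ D * Real.exp (-(k * |ξ|)) * max R 0 := by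
    gcongr; exact hz.trans (le_max_left _ _)
  linarith

lemma continuous_comp (ζ : BC) : Continuous fun ξ => N.φ ξ (ζ ξ) :=
  N.cont.comp (continuous_id.prodMk ζ.continuous)

lemma exists_bound (ζ : BC) : ∃ C : ℝ, ∀ ξ, |N.φ ξ (ζ ξ)| ≤ C * Real.exp (-(k * |ξ|)) := by
  obtain ⟨C, hC⟩ := N.bound ‖ζ‖
  exact ⟨C, fun ξ => hC ξ _ (ζ.norm_coe_le_norm ξ)⟩

/-- `ζ ↦ φ(·, ζ(·))` as a map into the bounded continuous functions. -/
def toBC (ζ : BC) : BC := BoundedContinuousFunction.ofNormedAddCommGroup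
  (fun ξ => N.φ ξ (ζ ξ)) (N.continuous_comp ζ) (max (N.exists_bound ζ).choose 0) fun ξ =>
    ((N.exists_bound ζ).choose_spec ξ).trans (by
      calc _ ≤ max (N.exists_bound ζ).choose 0 * Real.exp (-(k * |ξ|)) := by
            gcongr; exact le_max_left _ _
        _ ≤ max (N.exists_bound ζ).choose 0 * 1 := by gcongr; exact weight_le ξ
        _ = _ := mul_one _)

lemma lipB_toBC : LipB N.toBC := by
  intro R
  obtain ⟨C, hC, h⟩ := N.lip R
  refine ⟨C, hC, fun ζ η hζ hη => ?_⟩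
  refine (BoundedContinuousFunction.norm_le (by positivity)).2 fun ξ => ?_
  have h1 := h ξ (ζ ξ) (η ξ) ((ζ.norm_coe_le_norm ξ).trans hζ) ((η.norm_coe_le_norm ξ).trans hη)
  have h2 : |ζ ξ - η ξ| ≤ ‖ζ - η‖ := (ζ - η).norm_coe_le_norm ξ
  calc |N.φ ξ (ζ ξ) - N.φ ξ (η ξ)| ≤ C * Real.exp (-(k * |ξ|)) * |ζ ξ - η ξ| := h1
    _ ≤ C * 1 * ‖ζ - η‖ := by gcongr; exact weight_le ξ
    _ = _ := by rw [mul_one]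

end Nem

/-- The weight `e^{-|ξ|}`. -/
def rho (ξ : ℝ) : ℝ := Real.exp (-|ξ|)

lemma rho_pos (ξ : ℝ) : 0 < rho ξ := Real.exp_pos _

lemma continuous_rho : Continuous rho := Real.continuous_exp.comp continuous_abs.neg

lemma rho_le_one (ξ : ℝ) : rho ξ ≤ 1 := Real.exp_le_one_iff.2 (neg_nonpos.2 (abs_nonneg ξ))

lemma integrable_rho : Integrable rho := by
  rw [← integrableOn_univ, ← Iic_union_Ioi (a := (0 : ℝ))]
  refine IntegrableOn.union ?_ ?_
  · exact (integrableOn_exp_Iic 0).congr_fun (fun x hx => by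
      rw [rho, abs_of_nonpos hx, neg_neg]) measurableSet_Iic
  · exact (integrableOn_exp_neg_Ioi 0).congr_fun (fun x hx => by
      rw [rho, abs_of_pos hx]) measurableSet_Ioi

lemma memLp_rho : MemLp rho 2 volume := by
  refine (memLp_two_iff_integrable_sq continuous_rho.aestronglyMeasurable).2 ?_
  refine integrable_rho.mono' (continuous_rho.pow 2).aestronglyMeasurable (ae_of_all _ fun x => ?_)
  rw [Real.norm_of_nonneg (sq_nonneg _), sq]
  exact mul_le_of_le_one_left (rho_pos x).le (rho_le_one x)

/-- The weight `e^{-|ξ|}` as an element of `L²`. -/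
def rhoL : L2 := memLp_rho.toLp rho

lemma coeFn_rhoL : rhoL =ᵐ[volume] rho := MemLp.coeFn_toLp memLp_rho

namespace Nem

variable (N : Nem 1)

lemma memLp_comp (ζ : BC) : MemLp (fun ξ => N.φ ξ (ζ ξ)) 2 volume := by
  obtain ⟨C, hC⟩ := N.exists_bound ζ
  refine memLp_rho.of_le_mul (c := C) (N.continuous_comp ζ).aestronglyMeasurable
    (ae_of_all _ fun ξ => ?_)
  rw [Real.norm_of_nonneg (rho_pos ξ).le]
  simpa [rho] using hC ξ

/-- `ζ ↦ φ(·, ζ(·))` as a map into `L²`. -/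
def toL2 (ζ : BC) : L2 := (N.memLp_comp ζ).toLp _

lemma coeFn_toL2 (ζ : BC) : N.toL2 ζ =ᵐ[volume] fun ξ => N.φ ξ (ζ ξ) :=
  MemLp.coeFn_toLp (N.memLp_comp ζ)

/-- The Lipschitz constant of φ(ξ, ·) carries the square-integrable weight e^{-|ξ|}, which turns a
sup-norm difference of the arguments into an L² difference of the values. -/
lemma lipB_toL2 : LipB N.toL2 := by
  intro R
  obtain ⟨C, hC, h⟩ := N.lip R
  refine ⟨C * ‖rhoL‖, by positivity, fun ζ η hζ hη => ?_⟩
  have : ‖N.toL2 ζ - N.toL2 η‖ ≤ C * ‖ζ - η‖ * ‖rhoL‖ := by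
    refine Lp.norm_le_mul_norm_of_ae_le_mul ?_
    filter_upwards [N.coeFn_toL2 ζ, N.coeFn_toL2 η, Lp.coeFn_sub (N.toL2 ζ) (N.toL2 η), coeFn_rhoL]
      with ξ h1 h2 h3 h4
    rw [h3, Pi.sub_apply, h1, h2, h4, Real.norm_of_nonneg (rho_pos ξ).le]
    have h1 := h ξ (ζ ξ) (η ξ) ((ζ.norm_coe_le_norm ξ).trans hζ)
      ((η.norm_coe_le_norm ξ).trans hη)
    have h2 : |ζ ξ - η ξ| ≤ ‖ζ - η‖ := (ζ - η).norm_coe_le_norm ξ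
    rw [Nat.cast_one, one_mul] at h1
    calc ‖N.φ ξ (ζ ξ) - N.φ ξ (η ξ)‖ ≤ C * rho ξ * |ζ ξ - η ξ| := h1
      _ ≤ C * rho ξ * ‖ζ - η‖ := by gcongr; exact mul_nonneg hC (rho_pos ξ).le
      _ = _ := by ring
  calc _ ≤ _ := this
    _ = _ := by ring

/-- Superposition with a translate of a differentiable function with exponentially small
derivative. -/
def shift (f b : ℝ → ℝ) (hf : Differentiable ℝ f) (hb : Continuous b)
    (hfb : ∃ C : ℝ, ∀ x, |f x - b x| ≤ C * rho x) (hf' : ∃ C : ℝ, ∀ x, |deriv f x| ≤ C * rho x) :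
    Nem 1 where
  φ ξ z := f (ξ + z) - b ξ
  cont := (hf.continuous.comp (continuous_fst.add continuous_snd)).sub (hb.comp continuous_fst)
  bdd := by
    obtain ⟨C, hC⟩ := hfb
    exact ⟨C, fun ξ => by simpa [rho] using hC ξ⟩
  lip R := by
    obtain ⟨C, hC⟩ := hf'
    have hC0 : 0 ≤ C := by
      have h := (abs_nonneg _).trans (hC 0)
      exact nonneg_of_mul_nonneg_left h (rho_pos 0)
    -- A translation by at most R changes the weight e^{-|ξ|} by a factor of at most e^R.
    refine ⟨C * Real.exp R, by positivity, fun ξ z₁ z₂ h1 h2 => ?_⟩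
    have key := Convex.norm_image_sub_le_of_norm_deriv_le (f := f) (s := Icc (ξ - R) (ξ + R))
      (C := C * Real.exp R * Real.exp (-|ξ|)) (x := ξ + z₂) (y := ξ + z₁)
      (fun x _ => hf x) (fun x hx => (hC x).trans ?_) (convex_Icc _ _)
      ⟨by linarith [(abs_le.1 h2).1], by linarith [(abs_le.1 h2).2]⟩
      ⟨by linarith [(abs_le.1 h1).1], by linarith [(abs_le.1 h1).2]⟩
    · rw [Nat.cast_one, one_mul]
      simpa [Real.norm_eq_abs] using key
    · rw [mul_assoc, ← Real.exp_add]
      refine mul_le_mul_of_nonneg_left (Real.exp_le_exp.2 ?_) hC0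
      have h3 : |ξ - x| ≤ R := abs_le.2 ⟨by linarith [hx.2], by linarith [hx.1]⟩
      linarith [abs_sub_abs_le_abs_sub ξ x]

/-- Superposition with a translate of a bounded Lipschitz function. -/
def shiftBdd (f : ℝ → ℝ) {K : ℝ≥0} (hf : LipschitzWith K f) {C : ℝ} (hC : ∀ x, |f x| ≤ C) :
    Nem 0 where
  φ ξ z := f (ξ + z)
  cont := hf.continuous.comp (continuous_fst.add continuous_snd)
  bdd := ⟨C, fun ξ => by simpa using hC ξ⟩
  lip R := ⟨K, K.2, fun ξ z₁ z₂ _ _ => by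
    simpa [Real.dist_eq] using hf.dist_le_mul (ξ + z₁) (ξ + z₂)⟩

/-- Superposition with the exponential function. -/
def exp : Nem 0 where
  φ _ z := Real.exp z
  cont := Real.continuous_exp.comp continuous_snd
  bdd := ⟨1, fun ξ => by simp⟩
  lip R := by
    refine ⟨Real.exp R, (Real.exp_pos R).le, fun ξ z₁ z₂ h1 h2 => ?_⟩
    have key := Convex.norm_image_sub_le_of_norm_deriv_le (f := Real.exp) (s := Icc (-R) R)
      (C := Real.exp R) (x := z₂) (y := z₁) (fun x _ => Real.differentiableAt_exp)
      (fun x hx => by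
        rw [Real.deriv_exp, Real.norm_of_nonneg (Real.exp_pos x).le]
        exact Real.exp_le_exp.2 hx.2) (convex_Icc _ _) (abs_le.1 h2) (abs_le.1 h1)
    simpa using key

end Nem

/-! ### One-sided exponential convolutions -/

/-- `∫_{-∞}^x e^{η - x} v(η) dη`. -/
def kp (v : ℝ → ℝ) (x : ℝ) : ℝ := ∫ η in Iic x, Real.exp (η - x) * v η

/-- `∫_x^∞ e^{x - η} v(η) dη`. -/
def km (v : ℝ → ℝ) (x : ℝ) : ℝ := ∫ η in Ioi x, Real.exp (x - η) * v η

section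

variable {v : ℝ → ℝ}

lemma memLp_rho_sub (x : ℝ) : MemLp (fun η => rho (η - x)) 2 volume :=
  memLp_rho.comp_measurePreserving (measurePreserving_sub_right volume x)

lemma integrable_rho_mul (hv : MemLp v 2 volume) (x : ℝ) :
    Integrable (fun η => rho (η - x) * v η) := (memLp_rho_sub x).integrable_mul hv

lemma rho_sub_of_le {η x : ℝ} (h : η ≤ x) : rho (η - x) = Real.exp (η - x) := by
  rw [rho, abs_of_nonpos (sub_nonpos.2 h), neg_neg]

lemma rho_sub_of_ge {η x : ℝ} (h : x ≤ η) : rho (η - x) = Real.exp (x - η) := by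
  rw [rho, abs_of_nonneg (sub_nonneg.2 h), neg_sub]

lemma integrableOn_kp (hv : MemLp v 2 volume) (x : ℝ) :
    IntegrableOn (fun η => Real.exp (η - x) * v η) (Iic x) :=
  (integrable_rho_mul hv x).integrableOn.congr_fun (fun η hη => by
    simp only [rho_sub_of_le hη]) measurableSet_Iic

lemma integrableOn_km (hv : MemLp v 2 volume) (x : ℝ) :
    IntegrableOn (fun η => Real.exp (x - η) * v η) (Ioi x) :=
  (integrable_rho_mul hv x).integrableOn.congr_fun (fun η hη => by
    simp only [rho_sub_of_ge (le_of_lt hη)]) measurableSet_Ioi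

lemma integrableOn_exp_mul (hv : MemLp v 2 volume) (x : ℝ) :
    IntegrableOn (fun η => Real.exp η * v η) (Iic x) := by
  refine IntegrableOn.congr_fun ((integrableOn_kp hv x).const_mul (Real.exp x)) (fun η _ => ?_)
    measurableSet_Iic
  rw [← mul_assoc, ← Real.exp_add, add_sub_cancel]

lemma integrableOn_exp_neg_mul (hv : MemLp v 2 volume) (x : ℝ) :
    IntegrableOn (fun η => Real.exp (-η) * v η) (Ioi x) := by
  refine IntegrableOn.congr_fun ((integrableOn_km hv x).const_mul (Real.exp (-x))) (fun η _ => ?_)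
    measurableSet_Ioi
  rw [← mul_assoc, ← Real.exp_add]; ring_nf

lemma kp_eq' (v : ℝ → ℝ) (x : ℝ) :
    kp v x = Real.exp (-x) * ∫ η in Iic x, Real.exp η * v η := by
  rw [kp, ← integral_const_mul]
  refine integral_congr_ae (ae_of_all _ fun η => ?_)
  simp only
  rw [← mul_assoc, ← Real.exp_add]; ring_nf

lemma km_eq' (v : ℝ → ℝ) (x : ℝ) :
    km v x = Real.exp x * ∫ η in Ioi x, Real.exp (-η) * v η := by
  rw [km, ← integral_const_mul]
  refine integral_congr_ae (ae_of_all _ fun η => ?_)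
  simp only
  rw [← mul_assoc, ← Real.exp_add]; ring_nf

/-- Splitting e^{η - x} makes the convolution a smooth function times a primitive, from which
absolute continuity and the derivative can be read off. -/
lemma kp_eq (hv : MemLp v 2 volume) (x : ℝ) :
    kp v x = Real.exp (-x) * (kp v 0 + ∫ η in (0 : ℝ)..x, Real.exp η * v η) := by
  rw [kp_eq', kp_eq' v 0, ← intervalIntegral.integral_Iic_sub_Iic (integrableOn_exp_mul hv 0)
    (integrableOn_exp_mul hv x)]
  simp

lemma km_eq (hv : MemLp v 2 volume) (x : ℝ) :
    km v x = Real.exp x * (km v 0 + ∫ η in (0 : ℝ)..x, -(Real.exp (-η) * v η)) := by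
  rw [km_eq', km_eq' v 0, intervalIntegral.integral_neg,
    ← intervalIntegral.integral_Ioi_sub_Ioi' (integrableOn_exp_neg_mul hv 0)
    (integrableOn_exp_neg_mul hv x)]
  simp

lemma locallyIntegrable_exp_mul (hv : MemLp v 2 volume) :
    LocallyIntegrable (fun η => Real.exp η * v η) volume :=
  (hv.locallyIntegrable (by norm_num)).continuous_mul Real.continuous_exp

lemma locallyIntegrable_exp_neg_mul (hv : MemLp v 2 volume) :
    LocallyIntegrable (fun η => -(Real.exp (-η) * v η)) volume :=
  ((hv.locallyIntegrable (by norm_num)).continuous_mul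
    (Real.continuous_exp.comp continuous_neg)).neg

lemma contDiff_exp_neg : ContDiff ℝ 1 fun x : ℝ => Real.exp (-x) := Real.contDiff_exp.comp contDiff_neg

lemma locAC_kp (hv : MemLp v 2 volume) : LocAC (kp v) := by
  rw [funext (kp_eq hv)]
  exact (LocAC.of_contDiff contDiff_exp_neg).mul
    (LocAC.primitive (locallyIntegrable_exp_mul hv) _ _)

lemma locAC_km (hv : MemLp v 2 volume) : LocAC (km v) := by
  rw [funext (km_eq hv)]
  exact (LocAC.of_contDiff Real.contDiff_exp).mul
    (LocAC.primitive (locallyIntegrable_exp_neg_mul hv) _ _)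

/-- Differentiability of the primitive is a hypothesis so that both versions follow: almost
everywhere for v in L², everywhere for continuous v. -/
lemma hasDerivAt_kp_of (hv : MemLp v 2 volume) {x : ℝ}
    (hx : HasDerivAt (fun x => ∫ η in (0 : ℝ)..x, Real.exp η * v η) (Real.exp x * v x) x) :
    HasDerivAt (kp v) (v x - kp v x) x := by
  have h := ((hasDerivAt_neg x).exp).mul (hx.const_add (kp v 0))
  have e : kp v = (fun x => Real.exp (-x)) * fun x => kp v 0 + ∫ η in (0 : ℝ)..x, Real.exp η * v η :=
    funext (kp_eq hv)
  rw [← e] at h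
  refine h.congr_deriv ?_
  rw [kp_eq hv x]
  have : Real.exp (-x) * (Real.exp x * v x) = v x := by
    rw [← mul_assoc, ← Real.exp_add, neg_add_cancel, Real.exp_zero, one_mul]
  rw [this]; ring

lemma hasDerivAt_km_of (hv : MemLp v 2 volume) {x : ℝ}
    (hx : HasDerivAt (fun x => ∫ η in (0 : ℝ)..x, -(Real.exp (-η) * v η))
      (-(Real.exp (-x) * v x)) x) :
    HasDerivAt (km v) (km v x - v x) x := by
  have h := (Real.hasDerivAt_exp x).mul (hx.const_add (km v 0))
  have e : km v = Real.exp * fun x => km v 0 + ∫ η in (0 : ℝ)..x, -(Real.exp (-η) * v η) :=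
    funext (km_eq hv)
  rw [← e] at h
  refine h.congr_deriv ?_
  rw [km_eq hv x]
  have : Real.exp x * (Real.exp (-x) * v x) = v x := by
    rw [← mul_assoc, ← Real.exp_add, add_neg_cancel, Real.exp_zero, one_mul]
  rw [mul_neg, this]; ring

lemma ae_hasDerivAt_kp (hv : MemLp v 2 volume) :
    ∀ᵐ x : ℝ, HasDerivAt (kp v) (v x - kp v x) x := by
  filter_upwards [LocallyIntegrable.ae_hasDerivAt_integral (locallyIntegrable_exp_mul hv)]
    with x hx using hasDerivAt_kp_of hv (hx 0)

lemma ae_hasDerivAt_km (hv : MemLp v 2 volume) :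
    ∀ᵐ x : ℝ, HasDerivAt (km v) (km v x - v x) x := by
  filter_upwards [LocallyIntegrable.ae_hasDerivAt_integral (locallyIntegrable_exp_neg_mul hv)]
    with x hx using hasDerivAt_km_of hv (hx 0)

lemma hasDerivAt_kp (hv : MemLp v 2 volume) (hc : Continuous v) (x : ℝ) :
    HasDerivAt (kp v) (v x - kp v x) x :=
  hasDerivAt_kp_of hv ((Real.continuous_exp.mul hc).integral_hasStrictDerivAt 0 x).hasDerivAt

lemma hasDerivAt_km (hv : MemLp v 2 volume) (hc : Continuous v) (x : ℝ) :
    HasDerivAt (km v) (km v x - v x) x :=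
  hasDerivAt_km_of hv
    (((Real.continuous_exp.comp continuous_neg).mul hc).neg.integral_hasStrictDerivAt 0 x).hasDerivAt

/-- The mass of the exponential kernel. -/
def rhoMass : ℝ≥0∞ := ∫⁻ x, ‖rho x‖ₑ

/-! ### Young's inequality for the exponential kernel. -/

lemma rhoMass_ne_top : rhoMass ≠ ⊤ := integrable_rho.2.ne

/-- Cauchy–Schwarz for the measure with density e^{-|η-x|}, whose total mass does not depend on x; s
is the square root of that density. -/
lemma lintegral_rho_mul_sq_le (hv : AEMeasurable v volume) (x : ℝ) :
    (∫⁻ η, ‖rho (η - x)‖ₑ * ‖v η‖ₑ) ^ 2 ≤ rhoMass * ∫⁻ η, ‖rho (η - x)‖ₑ * ‖v η‖ₑ ^ 2 := by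
  let s : ℝ → ℝ≥0∞ := fun η => ‖rho (η - x)‖ₑ ^ (1 / 2 : ℝ)
  have hρ : Measurable fun η => ‖rho (η - x)‖ₑ :=
    (continuous_rho.comp (continuous_id.sub continuous_const)).measurable.enorm
  have hs : ∀ η, s η * s η = ‖rho (η - x)‖ₑ := fun η => by
    rw [← ENNReal.rpow_add_of_nonneg _ _ (by norm_num) (by norm_num)]; norm_num
  have hsm : Measurable s := hρ.pow_const _
  have h := ENNReal.lintegral_mul_le_Lp_mul_Lq volume Real.HolderConjugate.two_two
    (f := s) (g := fun η => s η * ‖v η‖ₑ) hsm.aemeasurable (hsm.aemeasurable.mul hv.enorm)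
  have e1 : ∀ η, (s * fun η => s η * ‖v η‖ₑ) η = ‖rho (η - x)‖ₑ * ‖v η‖ₑ := fun η => by
    simp only [Pi.mul_apply]; rw [← mul_assoc, hs]
  have e2 : ∀ η, s η ^ (2 : ℝ) = ‖rho (η - x)‖ₑ := fun η => by
    rw [ENNReal.rpow_two, sq, hs]
  have e3 : ∀ η, (s η * ‖v η‖ₑ) ^ (2 : ℝ) = ‖rho (η - x)‖ₑ * ‖v η‖ₑ ^ 2 := fun η => by
    rw [ENNReal.rpow_two, mul_pow, sq (s η), hs]
  simp_rw [e1, e2, e3] at h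
  have e4 : ∫⁻ η, ‖rho (η - x)‖ₑ = rhoMass := lintegral_sub_right_eq_self (fun η => ‖rho η‖ₑ) x
  rw [e4] at h
  calc _ ≤ _ := pow_le_pow_left' h 2
    _ = _ := by
      rw [mul_pow, ← ENNReal.rpow_natCast, ← ENNReal.rpow_natCast, ← ENNReal.rpow_mul,
        ← ENNReal.rpow_mul]
      norm_num

/-- Schur's test: after Cauchy–Schwarz, Tonelli's theorem exchanges the integrals and the kernel has
the same mass in either variable. -/
lemma lintegral_sq_le_of_le (hv : MemLp v 2 volume) {u : ℝ → ℝ}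
    (hu : ∀ x, ‖u x‖ₑ ≤ ∫⁻ η, ‖rho (η - x)‖ₑ * ‖v η‖ₑ) :
    ∫⁻ x, ‖u x‖ₑ ^ 2 ≤ rhoMass ^ 2 * ∫⁻ x, ‖v x‖ₑ ^ 2 := by
  have hm := hv.1.aemeasurable
  have hρ : Measurable fun p : ℝ × ℝ => ‖rho (p.2 - p.1)‖ₑ :=
    (continuous_rho.comp (continuous_snd.sub continuous_fst)).measurable.enorm
  calc ∫⁻ x, ‖u x‖ₑ ^ 2 ≤ ∫⁻ x, rhoMass * ∫⁻ η, ‖rho (η - x)‖ₑ * ‖v η‖ₑ ^ 2 :=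
        lintegral_mono fun x => (pow_le_pow_left' (hu x) 2).trans (lintegral_rho_mul_sq_le hm x)
    _ = rhoMass * ∫⁻ x, ∫⁻ η, ‖rho (η - x)‖ₑ * ‖v η‖ₑ ^ 2 :=
        lintegral_const_mul' _ _ rhoMass_ne_top
    _ = rhoMass * ∫⁻ η, ∫⁻ x, ‖rho (η - x)‖ₑ * ‖v η‖ₑ ^ 2 := by
        rw [lintegral_lintegral_swap]
        exact hρ.aemeasurable.mul ((hm.enorm.pow_const 2).comp_snd)
    _ = rhoMass * ∫⁻ η, rhoMass * ‖v η‖ₑ ^ 2 := by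
        congr 1
        refine lintegral_congr fun η => ?_
        rw [lintegral_mul_const' _ _ (by finiteness)]
        congr 1
        exact lintegral_sub_left_eq_self (fun x => ‖rho x‖ₑ) η
    _ = _ := by rw [lintegral_const_mul' _ _ rhoMass_ne_top, sq, mul_assoc]

lemma eLpNorm_le_of_le (hv : MemLp v 2 volume) {u : ℝ → ℝ}
    (hu : ∀ x, ‖u x‖ₑ ≤ ∫⁻ η, ‖rho (η - x)‖ₑ * ‖v η‖ₑ) :
    eLpNorm u 2 volume ≤ rhoMass * eLpNorm v 2 volume := by
  have h := lintegral_sq_le_of_le hv hu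
  have e : ∀ w : ℝ → ℝ, ∫⁻ x, ‖w x‖ₑ ^ 2 = eLpNorm w 2 volume ^ 2 := fun w => by
    have := eLpNorm_nnreal_pow_eq_lintegral (f := w) (μ := volume) (p := 2) (by norm_num)
    norm_num at this
    exact this.symm
  rw [e, e, ← mul_pow] at h
  exact (ENNReal.pow_le_pow_left_iff two_ne_zero).1 h

lemma enorm_kp_le (v : ℝ → ℝ) (x : ℝ) : ‖kp v x‖ₑ ≤ ∫⁻ η, ‖rho (η - x)‖ₑ * ‖v η‖ₑ := by
  refine (enorm_integral_le_lintegral_enorm _).trans ?_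
  refine (setLIntegral_mono' measurableSet_Iic fun η hη => ?_).trans (setLIntegral_le_lintegral _ _)
  rw [enorm_mul, rho_sub_of_le hη]

lemma enorm_km_le (v : ℝ → ℝ) (x : ℝ) : ‖km v x‖ₑ ≤ ∫⁻ η, ‖rho (η - x)‖ₑ * ‖v η‖ₑ := by
  refine (enorm_integral_le_lintegral_enorm _).trans ?_
  refine (setLIntegral_mono' measurableSet_Ioi fun η hη => ?_).trans (setLIntegral_le_lintegral _ _)
  rw [enorm_mul, rho_sub_of_ge (le_of_lt hη)]

lemma memLp_kp (hv : MemLp v 2 volume) : MemLp (kp v) 2 volume :=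
  ⟨(locAC_kp hv).continuous.aestronglyMeasurable, (eLpNorm_le_of_le hv (enorm_kp_le v)).trans_lt
    (ENNReal.mul_lt_top rhoMass_ne_top.lt_top hv.2)⟩

lemma memLp_km (hv : MemLp v 2 volume) : MemLp (km v) 2 volume :=
  ⟨(locAC_km hv).continuous.aestronglyMeasurable, (eLpNorm_le_of_le hv (enorm_km_le v)).trans_lt
    (ENNReal.mul_lt_top rhoMass_ne_top.lt_top hv.2)⟩

lemma memSob_kp (hv : MemLp v 2 volume) : MemSob 2 2 (kp v) :=
  ⟨locAC_kp hv, memLp_kp hv, (hv.sub (memLp_kp hv)).ae_eq (by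
    filter_upwards [ae_hasDerivAt_kp hv] with x hx using hx.deriv.symm)⟩

lemma memSob_km (hv : MemLp v 2 volume) : MemSob 2 2 (km v) :=
  ⟨locAC_km hv, memLp_km hv, ((memLp_km hv).sub hv).ae_eq (by
    filter_upwards [ae_hasDerivAt_km hv] with x hx using hx.deriv.symm)⟩

end

/-- Both convolutions satisfy a first-order equation f_ξ = ±(v - f), so that the L² bound for f
yields the H¹ bound at no cost. The sign s distinguishes the left from the right convolution. -/
lemma H1.norm_le_of_eLpNorm {f : H1} {v : L2} (h1 : eLpNorm f 2 volume ≤ rhoMass * eLpNorm v 2 volume)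
    {s : ℝ} (hs : |s| = 1) (h2 : deriv f =ᵐ[volume] fun x => s * (v x - f x)) :
    ‖f‖ ≤ (2 * rhoMass.toReal + 1) * ‖v‖ := by
  have e1 : ‖H1.toL2 f‖ ≤ rhoMass.toReal * ‖v‖ := by
    have : ‖H1.toL2 f‖ = (eLpNorm f 2 volume).toReal := Lp.norm_toLp _ f.memSob.memLp
    rw [this, Lp.norm_def, ← ENNReal.toReal_mul]
    exact ENNReal.toReal_mono (ENNReal.mul_ne_top rhoMass_ne_top (Lp.memLp v).2.ne) h1
  have e2 : H1.dL f = s • (v - H1.toL2 f) := by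
    refine Lp.ext ?_
    filter_upwards [H1.coeFn_dL f, H1.coeFn_toL2 f, h2, Lp.coeFn_sub v (H1.toL2 f),
      Lp.coeFn_smul s (v - H1.toL2 f)] with x a1 a2 a3 a4 a5
    rw [a1, a3, a5, Pi.smul_apply, a4, Pi.sub_apply, a2, smul_eq_mul]
  have e3 : ‖H1.dL f‖ ≤ ‖v‖ + ‖H1.toL2 f‖ := by
    rw [e2, norm_smul, Real.norm_eq_abs, hs, one_mul]; exact norm_sub_le _ _
  linarith [H1.norm_le f]

/-- `v ↦ ∫_{-∞}^x e^{η - x} v(η) dη` as an operator from `L²` to `H¹`. -/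
def Kp : L2 →L[ℝ] H1 := LinearMap.mkContinuous
  { toFun := fun v => Sob.mk (memSob_kp (Lp.memLp v))
    map_add' := fun u v => Sob.ext fun x => by
      have : kp (u + v : L2) x = kp u x + kp v x := by
        rw [kp, kp, kp, ← integral_add (integrableOn_kp (Lp.memLp u) x)
          (integrableOn_kp (Lp.memLp v) x)]
        refine integral_congr_ae (ae_restrict_of_ae ?_)
        filter_upwards [Lp.coeFn_add u v] with η hη
        rw [hη, Pi.add_apply, mul_add]
      exact this
    map_smul' := fun c v => Sob.ext fun x => by
      have : kp (c • v : L2) x = c * kp v x := by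
        rw [kp, kp, ← integral_const_mul]
        refine integral_congr_ae (ae_restrict_of_ae ?_)
        filter_upwards [Lp.coeFn_smul c v] with η hη
        rw [hη, Pi.smul_apply, smul_eq_mul]; ring
      exact this } (2 * rhoMass.toReal + 1) fun v =>
    H1.norm_le_of_eLpNorm (s := 1) (eLpNorm_le_of_le (Lp.memLp v) (enorm_kp_le v)) (by simp) (by
      filter_upwards [ae_hasDerivAt_kp (Lp.memLp v)] with x hx
      rw [one_mul]; exact hx.deriv)

/-- `v ↦ ∫_x^∞ e^{x - η} v(η) dη` as an operator from `L²` to `H¹`. -/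
def Km : L2 →L[ℝ] H1 := LinearMap.mkContinuous
  { toFun := fun v => Sob.mk (memSob_km (Lp.memLp v))
    map_add' := fun u v => Sob.ext fun x => by
      have : km (u + v : L2) x = km u x + km v x := by
        rw [km, km, km, ← integral_add (integrableOn_km (Lp.memLp u) x)
          (integrableOn_km (Lp.memLp v) x)]
        refine integral_congr_ae (ae_restrict_of_ae ?_)
        filter_upwards [Lp.coeFn_add u v] with η hη
        rw [hη, Pi.add_apply, mul_add]
      exact this
    map_smul' := fun c v => Sob.ext fun x => by
      have : km (c • v : L2) x = c * km v x := by
        rw [km, km, ← integral_const_mul]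
        refine integral_congr_ae (ae_restrict_of_ae ?_)
        filter_upwards [Lp.coeFn_smul c v] with η hη
        rw [hη, Pi.smul_apply, smul_eq_mul]; ring
      exact this } (2 * rhoMass.toReal + 1) fun v =>
    H1.norm_le_of_eLpNorm (s := -1) (eLpNorm_le_of_le (Lp.memLp v) (enorm_km_le v)) (by simp) (by
      filter_upwards [ae_hasDerivAt_km (Lp.memLp v)] with x hx
      rw [neg_one_mul, neg_sub]; exact hx.deriv)

/-! ### The function `g` -/

lemma decay_of_support {f : ℝ → ℝ} (hf : Continuous f) (h0 : ∀ x, x ∉ Icc (0 : ℝ) 1 → f x = 0) :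
    ∃ C : ℝ, ∀ x, |f x| ≤ C * rho x := by
  obtain ⟨C, hC⟩ := (isCompact_Icc (a := (0 : ℝ)) (b := 1)).exists_bound_of_continuousOn
    (f := fun x => f x / rho x) (hf.div continuous_rho fun x => (rho_pos x).ne').continuousOn
  refine ⟨max C 0, fun x => ?_⟩
  by_cases hx : x ∈ Icc (0 : ℝ) 1
  · have := hC x hx
    rw [Real.norm_eq_abs, abs_div, abs_of_pos (rho_pos x), div_le_iff₀ (rho_pos x)] at this
    exact this.trans (mul_le_mul_of_nonneg_right (le_max_left _ _) (rho_pos x).le)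
  · rw [h0 x hx, abs_zero]
    exact mul_nonneg (le_max_right _ _) (rho_pos x).le

namespace PartitionFunction

variable (χ : PartitionFunction)

lemma continuous : Continuous χ := χ.contDiff.continuous

lemma differentiable : Differentiable ℝ χ := χ.contDiff.differentiable (by simp)

lemma contDiff_deriv : ContDiff ℝ ∞ (deriv χ) :=
  ((contDiff_infty_iff_deriv (f := (χ : ℝ → ℝ))).1 χ.contDiff).2

lemma deriv_eq_zero {x : ℝ} (hx : x ∉ Icc (0 : ℝ) 1) : deriv χ x = 0 := by
  rw [mem_Icc, not_and_or, not_le, not_le] at hx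
  rcases hx with hx | hx
  · have : (χ : ℝ → ℝ) =ᶠ[𝓝 x] fun _ => 0 := by
      filter_upwards [Iio_mem_nhds hx] with z hz using χ.eq_zero z (le_of_lt hz)
    rw [this.deriv_eq, deriv_const]
  · have : (χ : ℝ → ℝ) =ᶠ[𝓝 x] fun _ => 1 := by
      filter_upwards [Ioi_mem_nhds hx] with z hz using χ.eq_one z (le_of_lt hz)
    rw [this.deriv_eq, deriv_const]

lemma deriv_deriv_eq_zero {x : ℝ} (hx : x ∉ Icc (0 : ℝ) 1) : deriv (deriv χ) x = 0 := by
  have : deriv χ =ᶠ[𝓝 x] fun _ => 0 := by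
    filter_upwards [isClosed_Icc.isOpen_compl.mem_nhds hx] with z hz using χ.deriv_eq_zero hz
  rw [this.deriv_eq, deriv_const]

lemma monotone : Monotone χ := monotone_of_deriv_nonneg χ.differentiable χ.deriv_nonneg

lemma mem_Icc (x : ℝ) : χ x ∈ Icc (0 : ℝ) 1 := by
  constructor
  · rw [← χ.eq_zero (min x 0) (min_le_right _ _)]; exact χ.monotone (min_le_left _ _)
  · rw [← χ.eq_one (max x 1) (le_max_right _ _)]; exact χ.monotone (le_max_left _ _)

lemma abs_le_one (x : ℝ) : |χ x| ≤ 1 := abs_le.2 ⟨by linarith [(χ.mem_Icc x).1], (χ.mem_Icc x).2⟩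

lemma deriv_decay : ∃ C : ℝ, ∀ x, |deriv χ x| ≤ C * rho x :=
  decay_of_support χ.contDiff_deriv.continuous fun _ hx => χ.deriv_eq_zero hx

/-- `(χ²)'' = 2 χ'² + 2 χ χ''`. -/
def ddsq (z : ℝ) : ℝ := 2 * deriv χ z ^ 2 + 2 * χ z * deriv (deriv χ) z

lemma continuous_ddsq : Continuous χ.ddsq :=
  ((χ.contDiff_deriv.continuous.pow 2).const_mul 2).add ((χ.continuous.const_mul 2).mul
    (χ.contDiff_deriv.continuous_deriv (by simp)))

lemma ddsq_eq_zero {x : ℝ} (hx : x ∉ Icc (0 : ℝ) 1) : χ.ddsq x = 0 := by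
  simp [ddsq, χ.deriv_eq_zero hx, χ.deriv_deriv_eq_zero hx]

lemma memLp_of_decay {f : ℝ → ℝ} (hf : Continuous f) (h : ∃ C : ℝ, ∀ x, |f x| ≤ C * rho x) :
    MemLp f 2 volume := by
  obtain ⟨C, hC⟩ := h
  refine memLp_rho.of_le_mul (c := C) hf.aestronglyMeasurable (ae_of_all _ fun x => ?_)
  rw [Real.norm_of_nonneg (rho_pos x).le]; exact hC x

lemma memLp_ddsq : MemLp χ.ddsq 2 volume :=
  memLp_of_decay χ.continuous_ddsq (decay_of_support χ.continuous_ddsq fun _ h => χ.ddsq_eq_zero h)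

lemma rho_sub_le (η x : ℝ) : rho (η - x) ≤ Real.exp |η| * rho x := by
  rw [rho, rho, ← Real.exp_add]
  refine Real.exp_le_exp.2 ?_
  have := abs_sub_abs_le_abs_sub x η
  rw [abs_sub_comm] at this
  linarith

lemma integrable_exp_ddsq : Integrable fun η => Real.exp |η| * |χ.ddsq η| :=
  Continuous.integrable_of_hasCompactSupport
    ((Real.continuous_exp.comp continuous_abs).mul χ.continuous_ddsq.abs)
    (HasCompactSupport.intro isCompact_Icc fun x hx => by rw [χ.ddsq_eq_zero hx]; simp)

/-- As (χ²)'' has compact support, its convolution with e^{-|x|}, even restricted to part of the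
line, inherits the decay e^{-|x|}: one has e^{-|η-x|} ≤ e^{|η|} e^{-|x|}. -/
lemma abs_setIntegral_ddsq_le (s : Set ℝ) (hs : MeasurableSet s) (x : ℝ) (u : ℝ → ℝ)
    (hu : ∀ η ∈ s, u η = rho (η - x) * χ.ddsq η) :
    |∫ η in s, u η| ≤ (∫ η, Real.exp |η| * |χ.ddsq η|) * rho x := by
  have h1 : Integrable fun η => Real.exp |η| * |χ.ddsq η| * rho x :=
    χ.integrable_exp_ddsq.mul_const _
  rw [setIntegral_congr_fun hs hu, ← integral_mul_const]
  refine (abs_integral_le_integral_abs).trans ?_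
  refine (integral_mono (integrable_rho_mul χ.memLp_ddsq x).abs.integrableOn h1.integrableOn
    fun η => ?_).trans (setIntegral_le_integral h1 (ae_of_all _ fun η => ?_))
  · simp only [abs_mul, abs_of_pos (rho_pos _)]
    have := mul_le_mul_of_nonneg_right (rho_sub_le η x) (abs_nonneg (χ.ddsq η))
    linarith
  · have := (rho_pos x).le
    positivity

lemma kp_ddsq_decay (x : ℝ) :
    |kp χ.ddsq x| ≤ (∫ η, Real.exp |η| * |χ.ddsq η|) * rho x :=
  χ.abs_setIntegral_ddsq_le _ measurableSet_Iic x _ fun η hη => by rw [rho_sub_of_le hη]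

lemma km_ddsq_decay (x : ℝ) :
    |km χ.ddsq x| ≤ (∫ η, Real.exp |η| * |χ.ddsq η|) * rho x :=
  χ.abs_setIntegral_ddsq_le _ measurableSet_Ioi x _ fun η hη => by rw [rho_sub_of_ge (le_of_lt hη)]

/-- `g''`. -/
def g2 (x : ℝ) : ℝ := (kp χ.ddsq x + km χ.ddsq x) / 2

/-- `g'`. -/
def g1 (x : ℝ) : ℝ := 2 * χ x * deriv χ x + (km χ.ddsq x - kp χ.ddsq x) / 2

lemma hasDerivAt_g2 (x : ℝ) : HasDerivAt χ.g2 ((km χ.ddsq x - kp χ.ddsq x) / 2) x := by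
  have := ((hasDerivAt_kp χ.memLp_ddsq χ.continuous_ddsq x).add
    (hasDerivAt_km χ.memLp_ddsq χ.continuous_ddsq x)).div_const 2
  refine this.congr_deriv ?_
  ring

lemma hasDerivAt_deriv (x : ℝ) : HasDerivAt (deriv χ) (deriv (deriv χ) x) x :=
  (χ.contDiff_deriv.differentiable (by simp) x).hasDerivAt

/-- The jumps of the one-sided convolutions contribute -(χ²)'', which cancels the derivative of
2χχ'. Together with `gFun_eq` this says g - g'' = χ², the property for which g was chosen. -/
lemma hasDerivAt_g1 (x : ℝ) : HasDerivAt χ.g1 (χ.g2 x) x := by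
  have := (((χ.differentiable x).hasDerivAt.const_mul 2).mul (χ.hasDerivAt_deriv x)).add
    (((hasDerivAt_km χ.memLp_ddsq χ.continuous_ddsq x).sub
      (hasDerivAt_kp χ.memLp_ddsq χ.continuous_ddsq x)).div_const 2)
  refine this.congr_deriv ?_
  simp only [g2, ddsq]; ring

lemma gFun_eq (x : ℝ) : gFun χ x = χ x ^ 2 + χ.g2 x := by
  have h := integral_add_compl (measurableSet_Iic (a := x)) (integrable_rho_mul χ.memLp_ddsq x)
  rw [compl_Iic] at h
  have e1 : ∫ η in Iic x, rho (η - x) * χ.ddsq η = kp χ.ddsq x :=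
    setIntegral_congr_fun measurableSet_Iic fun η hη => by simp only [rho_sub_of_le hη]
  have e2 : ∫ η in Ioi x, rho (η - x) * χ.ddsq η = km χ.ddsq x :=
    setIntegral_congr_fun measurableSet_Ioi fun η hη => by simp only [rho_sub_of_ge (le_of_lt hη)]
  rw [e1, e2] at h
  have e3 : ∫ z, Real.exp (-|x - z|) * (2 * deriv χ z ^ 2 + 2 * χ z * deriv (deriv χ) z) =
      ∫ η, rho (η - x) * χ.ddsq η := by
    refine integral_congr_ae (ae_of_all _ fun z => ?_)
    simp only [rho, ddsq, abs_sub_comm]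
  rw [gFun, e3, ← h, g2]; ring

lemma hasDerivAt_gFun (x : ℝ) : HasDerivAt (gFun χ) (χ.g1 x) x := by
  rw [funext χ.gFun_eq]
  have := ((χ.differentiable x).hasDerivAt.fun_pow 2).add (χ.hasDerivAt_g2 x)
  refine this.congr_deriv ?_
  simp [g1]

lemma deriv_gFun : deriv (gFun χ) = χ.g1 := funext fun x => (χ.hasDerivAt_gFun x).deriv

lemma g2_decay : ∃ C : ℝ, ∀ x, |χ.g2 x| ≤ C * rho x := by
  refine ⟨∫ η, Real.exp |η| * |χ.ddsq η|, fun x => ?_⟩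
  have h1 := abs_le.1 (χ.kp_ddsq_decay x)
  have h2 := abs_le.1 (χ.km_ddsq_decay x)
  rw [g2]
  exact abs_le.2 ⟨by linarith, by linarith⟩

lemma deriv_g2_decay : ∃ C : ℝ, ∀ x, |deriv χ.g2 x| ≤ C * rho x := by
  refine ⟨∫ η, Real.exp |η| * |χ.ddsq η|, fun x => ?_⟩
  have h1 := abs_le.1 (χ.kp_ddsq_decay x)
  have h2 := abs_le.1 (χ.km_ddsq_decay x)
  rw [(χ.hasDerivAt_g2 x).deriv]
  exact abs_le.2 ⟨by linarith, by linarith⟩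

lemma g1_decay : ∃ C : ℝ, ∀ x, |χ.g1 x| ≤ C * rho x := by
  obtain ⟨D, hD⟩ := χ.deriv_decay
  refine ⟨2 * D + ∫ η, Real.exp |η| * |χ.ddsq η|, fun x => ?_⟩
  have h1 := abs_le.1 (χ.kp_ddsq_decay x)
  have h2 := abs_le.1 (χ.km_ddsq_decay x)
  have h3 : |χ x * deriv χ x| ≤ D * rho x := by
    rw [abs_mul]
    exact (mul_le_of_le_one_left (abs_nonneg _) (χ.abs_le_one x)).trans (hD x)
  have h4 := abs_le.1 h3
  rw [g1]
  exact abs_le.2 ⟨by linarith, by linarith⟩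

/-- `ζ ↦ χ(ξ + ζ)`. -/
def chiN : Nem 0 := Nem.shiftBdd χ χ.lip.choose_spec χ.abs_le_one

/-- `ζ ↦ χ(ξ + ζ) - χ(ξ)`. -/
def dchiN : Nem 1 := Nem.shift χ χ χ.differentiable χ.continuous ⟨0, fun x => by simp⟩ χ.deriv_decay

/-- `ζ ↦ g'(ξ + ζ)`. -/
def g1N : Nem 1 := Nem.shift χ.g1 0 (fun x => (χ.hasDerivAt_g1 x).differentiableAt)
  continuous_const (by simpa using χ.g1_decay) (by
    rw [show deriv χ.g1 = χ.g2 from funext fun x => (χ.hasDerivAt_g1 x).deriv]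
    exact χ.g2_decay)

/-- `ζ ↦ g''(ξ + ζ)`. -/
def g2N : Nem 1 := Nem.shift χ.g2 0 (fun x => (χ.hasDerivAt_g2 x).differentiableAt)
  continuous_const (by simpa using χ.g2_decay) χ.deriv_g2_decay

@[simp] lemma chiN_φ (ξ z : ℝ) : χ.chiN.φ ξ z = χ (ξ + z) := rfl
@[simp] lemma dchiN_φ (ξ z : ℝ) : χ.dchiN.φ ξ z = χ (ξ + z) - χ ξ := rfl
@[simp] lemma g1N_φ (ξ z : ℝ) : χ.g1N.φ ξ z = χ.g1 (ξ + z) := by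
  change χ.g1 (ξ + z) - 0 = _; rw [sub_zero]
@[simp] lemma g2N_φ (ξ z : ℝ) : χ.g2N.φ ξ z = χ.g2 (ξ + z) := by
  change χ.g2 (ξ + z) - 0 = _; rw [sub_zero]

lemma memLp_deriv : MemLp (deriv χ) 2 volume :=
  memLp_of_decay χ.contDiff_deriv.continuous χ.deriv_decay

/-- `χ'` as an element of `L²`. -/
def dL : L2 := χ.memLp_deriv.toLp _

lemma coeFn_dL : χ.dL =ᵐ[volume] deriv χ := MemLp.coeFn_toLp _

/-- `χ` as a bounded continuous function. -/
def toBC : BC := BoundedContinuousFunction.ofNormedAddCommGroup χ χ.continuous 1 χ.abs_le_one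

lemma locAC : LocAC χ := LocAC.of_contDiff (χ.contDiff.of_le (by simp))

end PartitionFunction

/-! ### The components of `E` -/

namespace E

lemma mk_norm (ζ : V) (u : H1) (c : ℝ) (h : L2) : ‖mk ζ u c h‖ = ‖ζ‖ + (‖u‖ + |c|) + ‖h‖ :=
  norm_def _

/-- `X ↦ ζ`. -/
def zetaL : E →L[ℝ] V := LinearMap.mkContinuous
  { toFun := zeta, map_add' := fun _ _ => rfl, map_smul' := fun _ _ => rfl } 1 fun X => by
    rw [one_mul, norm_def]
    have : (0 : ℝ) ≤ ‖X.ubar‖ + |X.c| + ‖X.h‖ := by positivity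
    change ‖X.zeta‖ ≤ _
    linarith

/-- `X ↦ ū`. -/
def ubarL : E →L[ℝ] H1 := LinearMap.mkContinuous
  { toFun := ubar, map_add' := fun _ _ => rfl, map_smul' := fun _ _ => rfl } 1 fun X => by
    rw [one_mul, norm_def]
    have : (0 : ℝ) ≤ ‖X.zeta‖ + |X.c| + ‖X.h‖ := by positivity
    change ‖X.ubar‖ ≤ _
    linarith

/-- `X ↦ c`. -/
def cL : E →L[ℝ] ℝ := LinearMap.mkContinuous
  { toFun := c, map_add' := fun _ _ => rfl, map_smul' := fun _ _ => rfl } 1 fun X => by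
    rw [one_mul, norm_def]
    have : (0 : ℝ) ≤ ‖X.zeta‖ + ‖X.ubar‖ + ‖X.h‖ := by positivity
    change |X.c| ≤ _
    linarith

/-- `X ↦ h`. -/
def hL : E →L[ℝ] L2 := LinearMap.mkContinuous
  { toFun := h, map_add' := fun _ _ => rfl, map_smul' := fun _ _ => rfl } 1 fun X => by
    rw [one_mul, norm_def]
    have : (0 : ℝ) ≤ ‖X.zeta‖ + ‖X.ubar‖ + |X.c| := by positivity
    change ‖X.h‖ ≤ _
    linarith

end E

section LipB

variable {W : Type*} [NormedAddCommGroup W] [NormedSpace ℝ W]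

lemma LipB.mkE {F₁ : W → V} {F₂ : W → H1} {F₃ : W → ℝ} {F₄ : W → L2} (h₁ : LipB F₁)
    (h₂ : LipB F₂) (h₃ : LipB F₃) (h₄ : LipB F₄) :
    LipB (fun x => E.mk (F₁ x) (F₂ x) (F₃ x) (F₄ x)) := by
  intro R
  obtain ⟨C₁, hC₁, h₁⟩ := h₁ R
  obtain ⟨C₂, hC₂, h₂⟩ := h₂ R
  obtain ⟨C₃, hC₃, h₃⟩ := h₃ R
  obtain ⟨C₄, hC₄, h₄⟩ := h₄ R
  refine ⟨C₁ + (C₂ + C₃) + C₄, by positivity, fun x y hx hy => ?_⟩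
  have : E.mk (F₁ x) (F₂ x) (F₃ x) (F₄ x) - E.mk (F₁ y) (F₂ y) (F₃ y) (F₄ y) =
    E.mk (F₁ x - F₁ y) (F₂ x - F₂ y) (F₃ x - F₃ y) (F₄ x - F₄ y) := rfl
  rw [this, E.mk_norm, ← Real.norm_eq_abs, add_mul, add_mul, add_mul]
  exact add_le_add (add_le_add (h₁ x y hx hy) (add_le_add (h₂ x y hx hy) (h₃ x y hx hy)))
    (h₄ x y hx hy)

lemma LipB.toH1 {F : W → H1} (h₁ : LipB fun x => H1.toL2 (F x)) (h₂ : LipB fun x => H1.dL (F x)) :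
    LipB F := by
  intro R
  obtain ⟨C₁, hC₁, h₁⟩ := h₁ R
  obtain ⟨C₂, hC₂, h₂⟩ := h₂ R
  refine ⟨C₁ + C₂, by positivity, fun x y hx hy => (H1.norm_le _).trans ?_⟩
  rw [map_sub, map_sub, add_mul]
  exact add_le_add (h₁ x y hx hy) (h₂ x y hx hy)

lemma LipB.toV {F : W → V} (h₁ : LipB fun x => V.toBC (F x)) (h₂ : LipB fun x => V.dL (F x)) :
    LipB F := by
  intro R
  obtain ⟨C₁, hC₁, h₁⟩ := h₁ R
  obtain ⟨C₂, hC₂, h₂⟩ := h₂ R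
  refine ⟨C₁ + C₂, by positivity, fun x y hx hy => ?_⟩
  rw [V.norm_eq, map_sub, map_sub, add_mul]
  exact add_le_add (h₁ x y hx hy) (h₂ x y hx hy)

lemma LipB.smul {W₁ : Type*} [NormedAddCommGroup W₁] [NormedSpace ℝ W₁] {F : W → ℝ} {G : W → W₁}
    (hF : LipB F) (hG : LipB G) : LipB (fun x => F x • G x) :=
  LipB.bilin (ContinuousLinearMap.lsmul ℝ ℝ) hF hG

end LipB

/-! ### Representatives -/

/-- The function `f` represents `u ∈ L²`. -/
def Rep (u : L2) (f : ℝ → ℝ) : Prop := u =ᵐ[volume] f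

namespace Rep

variable {u v : L2} {f g : ℝ → ℝ}

lemma add (hu : Rep u f) (hv : Rep v g) : Rep (u + v) fun x => f x + g x := by
  filter_upwards [hu, hv, Lp.coeFn_add u v] with x h1 h2 h3
  rw [h3, Pi.add_apply, h1, h2]

lemma sub (hu : Rep u f) (hv : Rep v g) : Rep (u - v) fun x => f x - g x := by
  filter_upwards [hu, hv, Lp.coeFn_sub u v] with x h1 h2 h3
  rw [h3, Pi.sub_apply, h1, h2]

lemma smul (c : ℝ) (hu : Rep u f) : Rep (c • u) fun x => c * f x := by
  filter_upwards [hu, Lp.coeFn_smul c u] with x h1 h2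
  rw [h2, Pi.smul_apply, h1, smul_eq_mul]

lemma mulL (b : BC) (hu : Rep u f) : Rep (mulL b u) fun x => b x * f x := by
  filter_upwards [hu, coeFn_mulL b u] with x h1 h2
  rw [h2, h1]

lemma congr (hu : Rep u f) (h : f =ᵐ[volume] g) : Rep u g := EventuallyEq.trans hu h

lemma refl (u : L2) : Rep u u := EventuallyEq.rfl

end Rep

/-! ### The vector field -/

namespace E

variable (χ : PartitionFunction) (X : E)

/-- `ζ` as a bounded continuous function. -/
def zB : BC := V.toBC X.zeta

/-- `ζ_ξ ∈ L²`. -/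
def zx : L2 := V.dL X.zeta

/-- `χ ∘ y`. -/
def chiy : BC := χ.chiN.toBC X.zB

/-- `Ū` as a bounded continuous function. -/
def UbB : BC := H1.toBC X.ubar - X.c • χ.dchiN.toBC X.zB

/-- `Ū` as an element of `L²`. -/
def UbL : L2 := H1.toL2 X.ubar - X.c • χ.dchiN.toL2 X.zB

/-- `U`. -/
def UB : BC := H1.toBC X.ubar + X.c • χ.toBC

/-- `U_ξ`. -/
def Ux : L2 := H1.dL X.ubar + X.c • χ.dL

/-- `2 Ū² + 4 c Ū χ ∘ y` as a bounded continuous function. -/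
def eB : BC := (2 : ℝ) • mulBC (X.UbB χ) (X.UbB χ) + (4 : ℝ) • X.c • mulBC (X.UbB χ) (X.chiy χ)

/-- `2 Ū² + 4 c Ū χ ∘ y` as an element of `L²`. -/
def eL : L2 := (2 : ℝ) • mulL (X.UbB χ) (X.UbL χ) + (4 : ℝ) • X.c • mulL (X.chiy χ) (X.UbL χ)

/-- The density as an element of `L²`. -/
def dens : L2 := X.eL χ + mulL (X.eB χ) X.zx + X.h

/-- `e^ζ`. -/
def expP : BC := Nem.exp.toBC X.zB

/-- `e^{-ζ}`. -/
def expM : BC := Nem.exp.toBC (-X.zB)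

/-- Left part of the convolution. -/
def KP : H1 := Kp (mulL X.expP (X.dens χ))

/-- Right part of the convolution. -/
def KM : H1 := Km (mulL X.expM (X.dens χ))

/-- Integral over `(-∞, ξ]` of `e^{-(y(ξ) - y(η))}` times the density. -/
def aB : BC := mulBC X.expM (H1.toBC (X.KP χ))
def aL : L2 := mulL X.expM (H1.toL2 (X.KP χ))

/-- Integral over `[ξ, ∞)` of `e^{-(y(η) - y(ξ))}` times the density. -/
def bB : BC := mulBC X.expP (H1.toBC (X.KM χ))
def bL : L2 := mulL X.expP (H1.toL2 (X.KM χ))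

/-- `P - c² g ∘ y`. -/
def pB : BC := (1 / 4 : ℝ) • (X.aB χ + X.bB χ)
def pL : L2 := (1 / 4 : ℝ) • (X.aL χ + X.bL χ)

/-- `Q`. -/
def QB : BC := (1 / 4 : ℝ) • (X.bB χ - X.aB χ) + X.c • X.c • χ.g1N.toBC X.zB
def QL : L2 := (1 / 4 : ℝ) • (X.bL χ - X.aL χ) + X.c • X.c • χ.g1N.toL2 X.zB

/-- `U² - P`. -/
def AB : BC := mulBC (X.UbB χ) (X.UbB χ) + (2 : ℝ) • X.c • mulBC (X.UbB χ) (X.chiy χ) - X.pB χ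
  - X.c • X.c • χ.g2N.toBC X.zB
def AL : L2 := mulL (X.UbB χ) (X.UbL χ) + (2 : ℝ) • X.c • mulL (X.chiy χ) (X.UbL χ) - X.pL χ
  - X.c • X.c • χ.g2N.toL2 X.zB

/-- `-Q_ξ`. -/
def mQx : L2 := (1 / 2 : ℝ) • X.h + X.AL χ + mulL (X.AB χ) X.zx

@[simp] lemma zB_apply (ξ : ℝ) : X.zB ξ = X.zeta ξ := rfl
@[simp] lemma chiy_apply (ξ : ℝ) : X.chiy χ ξ = χ (X.y ξ) := rfl
@[simp] lemma UbB_apply (ξ : ℝ) : X.UbB χ ξ = X.Ubar χ ξ := by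
  change X.ubar ξ - X.c * (χ (X.y ξ) - χ ξ) = X.ubar ξ + X.c * χ ξ - X.c * χ (X.y ξ)
  ring
@[simp] lemma UB_apply (ξ : ℝ) : X.UB χ ξ = X.U χ ξ := rfl
@[simp] lemma expP_apply (ξ : ℝ) : X.expP ξ = Real.exp (X.zeta ξ) := rfl
@[simp] lemma expM_apply (ξ : ℝ) : X.expM ξ = Real.exp (-X.zeta ξ) := rfl
lemma eB_apply (ξ : ℝ) : X.eB χ ξ = 2 * X.Ubar χ ξ ^ 2 + 4 * X.c * X.Ubar χ ξ * χ (X.y ξ) := by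
  change 2 * (X.UbB χ ξ * X.UbB χ ξ) + 4 * (X.c * (X.UbB χ ξ * χ (X.y ξ))) = _
  rw [UbB_apply]; ring
lemma aB_apply (ξ : ℝ) : X.aB χ ξ = Real.exp (-X.zeta ξ) * X.KP χ ξ := rfl
lemma bB_apply (ξ : ℝ) : X.bB χ ξ = Real.exp (X.zeta ξ) * X.KM χ ξ := rfl
lemma pB_apply (ξ : ℝ) : X.pB χ ξ = 1 / 4 * (X.aB χ ξ + X.bB χ ξ) := rfl
lemma QB_apply (ξ : ℝ) :
    X.QB χ ξ = 1 / 4 * (X.bB χ ξ - X.aB χ ξ) + X.c ^ 2 * χ.g1 (X.y ξ) := by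
  change 1 / 4 * (X.bB χ ξ - X.aB χ ξ) + X.c * (X.c * χ.g1N.φ ξ (X.zeta ξ)) = _
  rw [PartitionFunction.g1N_φ, y]; ring
lemma AB_apply (ξ : ℝ) : X.AB χ ξ = X.Ubar χ ξ ^ 2 + 2 * X.c * X.Ubar χ ξ * χ (X.y ξ) - X.pB χ ξ
    - X.c ^ 2 * χ.g2 (X.y ξ) := by
  change X.UbB χ ξ * X.UbB χ ξ + 2 * (X.c * (X.UbB χ ξ * χ (X.y ξ))) - X.pB χ ξ
    - X.c * (X.c * χ.g2N.φ ξ (X.zeta ξ)) = _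
  rw [PartitionFunction.g2N_φ, y, UbB_apply]; ring

/-- U² = Ū² + 2cŪ χ∘y + c² χ²∘y, and the last term, which is not square integrable when c ≠ 0, is
cancelled by c² g∘y up to the decaying c² g''∘y. Hence U² - P lies in L², although neither term need
do so. -/
lemma AB_eq (ξ : ℝ) : X.AB χ ξ = X.U χ ξ ^ 2 - (X.pB χ ξ + X.c ^ 2 * gFun χ (X.y ξ)) := by
  rw [AB_apply, PartitionFunction.gFun_eq, Ubar]; ring

lemma rep_UbL : Rep (X.UbL χ) (X.Ubar χ) := by
  refine (Rep.sub (H1.coeFn_toL2 X.ubar) (Rep.smul X.c (χ.dchiN.coeFn_toL2 X.zB))).congr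
    (ae_of_all _ fun ξ => ?_)
  exact X.UbB_apply χ ξ

lemma rep_Ux' : Rep (X.Ux χ) fun ξ => deriv X.ubar ξ + X.c * deriv χ ξ :=
  Rep.add (H1.coeFn_dL _) (Rep.smul _ χ.coeFn_dL)

lemma hasDerivAt_U {ξ : ℝ} (h : DifferentiableAt ℝ X.ubar ξ) :
    HasDerivAt (X.U χ) (deriv X.ubar ξ + X.c * deriv χ ξ) ξ :=
  h.hasDerivAt.add ((χ.differentiable ξ).hasDerivAt.const_mul X.c)

lemma ae_hasDerivAt_U : ∀ᵐ ξ : ℝ, HasDerivAt (X.U χ) (X.Ux χ ξ) ξ := by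
  filter_upwards [X.rep_Ux' χ, X.ubar.memSob.locAC.ae_differentiableAt] with ξ h1 h2
  rw [h1]; exact X.hasDerivAt_U χ h2

lemma rep_Ux : Rep (X.Ux χ) (deriv (X.U χ)) := by
  filter_upwards [X.ae_hasDerivAt_U χ] with ξ h using h.deriv.symm

lemma ae_hasDerivAt_zeta : ∀ᵐ ξ : ℝ, HasDerivAt X.zeta (X.zx ξ) ξ := by
  filter_upwards [V.coeFn_dL X.zeta, X.zeta.memSob.locAC.ae_differentiableAt] with ξ h1 h2
  rw [zx, h1]; exact h2.hasDerivAt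

lemma ae_hasDerivAt_y : ∀ᵐ ξ : ℝ, HasDerivAt X.y (1 + X.zx ξ) ξ := by
  filter_upwards [X.ae_hasDerivAt_zeta] with ξ h using (hasDerivAt_id ξ).add h

lemma ae_deriv_y : deriv X.y =ᵐ[volume] fun ξ => 1 + X.zx ξ := by
  filter_upwards [X.ae_hasDerivAt_y] with ξ h using h.deriv

lemma rep_eL : Rep (X.eL χ) (X.eB χ) := by
  refine (Rep.add (((X.rep_UbL χ).mulL _).smul 2)
    ((((X.rep_UbL χ).mulL _).smul X.c).smul 4)).congr (ae_of_all _ fun ξ => ?_)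
  simp only [eB_apply, UbB_apply, chiy_apply]; ring

lemma rep_dens' : Rep (X.dens χ) fun ξ => X.eB χ ξ * (1 + X.zx ξ) + X.h ξ := by
  refine (((X.rep_eL χ).add ((Rep.refl X.zx).mulL _)).add (Rep.refl X.h)).congr
    (ae_of_all _ fun ξ => ?_)
  simp only; ring

lemma rep_dens : Rep (X.dens χ) (X.density χ) := by
  refine (X.rep_dens' χ).congr ?_
  filter_upwards [X.ae_deriv_y] with ξ h
  rw [density, h, eB_apply]

lemma rep_aL : Rep (X.aL χ) (X.aB χ) := Rep.mulL _ (H1.coeFn_toL2 _)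
lemma rep_bL : Rep (X.bL χ) (X.bB χ) := Rep.mulL _ (H1.coeFn_toL2 _)
lemma rep_pL : Rep (X.pL χ) (X.pB χ) := ((X.rep_aL χ).add (X.rep_bL χ)).smul _
lemma rep_QL : Rep (X.QL χ) (X.QB χ) :=
  (((X.rep_bL χ).sub (X.rep_aL χ)).smul _).add
    (Rep.smul _ (Rep.smul _ (χ.g1N.coeFn_toL2 X.zB)))

lemma rep_AL : Rep (X.AL χ) (X.AB χ) := by
  refine (((((X.rep_UbL χ).mulL _).add ((((X.rep_UbL χ).mulL _).smul X.c).smul 2)).sub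
    (X.rep_pL χ)).sub (Rep.smul _ (Rep.smul _ (χ.g2N.coeFn_toL2 X.zB)))).congr
      (ae_of_all _ fun ξ => ?_)
  simp only [AB_apply, UbB_apply, chiy_apply, PartitionFunction.g2N_φ, zB_apply, y]; ring

lemma rep_mQx : Rep (X.mQx χ) fun ξ => 1 / 2 * X.h ξ + X.AB χ ξ * (1 + X.zx ξ) := by
  refine ((((Rep.refl X.h).smul _).add (X.rep_AL χ)).add ((Rep.refl X.zx).mulL _)).congr
    (ae_of_all _ fun ξ => ?_)
  simp only; ring

lemma ae_hasDerivAt_aB :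
    ∀ᵐ ξ : ℝ, HasDerivAt (X.aB χ) (X.dens χ ξ - (1 + X.zx ξ) * X.aB χ ξ) ξ := by
  filter_upwards [X.ae_hasDerivAt_zeta, ae_hasDerivAt_kp (Lp.memLp (mulL X.expP (X.dens χ))),
    coeFn_mulL X.expP (X.dens χ)] with ξ h1 h2 h3
  have h := h1.neg.exp.mul h2
  have e : (X.aB χ : ℝ → ℝ) = (fun ξ => Real.exp ((-⇑X.zeta) ξ)) * kp (mulL X.expP (X.dens χ)) := rfl
  rw [← e] at h
  refine h.congr_deriv ?_
  rw [h3, aB_apply, expP_apply]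
  have e2 : Real.exp ((-⇑X.zeta) ξ) * Real.exp (X.zeta ξ) = 1 := by
    rw [← Real.exp_add]; simp
  have e3 : X.KP χ ξ = kp (mulL X.expP (X.dens χ)) ξ := rfl
  rw [e3]
  simp only [Pi.neg_apply] at e2 ⊢
  linear_combination X.dens χ ξ * e2

lemma ae_hasDerivAt_bB :
    ∀ᵐ ξ : ℝ, HasDerivAt (X.bB χ) ((1 + X.zx ξ) * X.bB χ ξ - X.dens χ ξ) ξ := by
  filter_upwards [X.ae_hasDerivAt_zeta, ae_hasDerivAt_km (Lp.memLp (mulL X.expM (X.dens χ))),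
    coeFn_mulL X.expM (X.dens χ)] with ξ h1 h2 h3
  have h := h1.exp.mul h2
  have e : (X.bB χ : ℝ → ℝ) = (fun ξ => Real.exp (X.zeta ξ)) * km (mulL X.expM (X.dens χ)) := rfl
  rw [← e] at h
  refine h.congr_deriv ?_
  rw [h3, bB_apply, expM_apply]
  have e2 : Real.exp (X.zeta ξ) * Real.exp (-X.zeta ξ) = 1 := by
    rw [← Real.exp_add]; simp
  have e3 : X.KM χ ξ = km (mulL X.expM (X.dens χ)) ξ := rfl
  rw [e3]
  linear_combination -X.dens χ ξ * e2

/-- Differentiating the two one-sided integrals gives y_ξ times the nonlocal part of P, minus half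
the density. The polynomial part of the density combines with P and c² g'' into U² - P, leaving -Q_ξ
= ½ h + (U² - P) y_ξ. This closes the system for (y_ξ, U_ξ, h). -/
lemma ae_hasDerivAt_QB : ∀ᵐ ξ : ℝ, HasDerivAt (X.QB χ) (-X.mQx χ ξ) ξ := by
  filter_upwards [X.ae_hasDerivAt_aB χ, X.ae_hasDerivAt_bB χ, X.ae_hasDerivAt_y,
    X.rep_mQx χ, X.rep_dens' χ] with ξ h1 h2 h3 h4 h5
  have h := ((h2.sub h1).const_mul (1 / 4)).add
    (((χ.hasDerivAt_g1 (X.y ξ)).comp ξ h3).const_mul (X.c ^ 2))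
  have e : (X.QB χ : ℝ → ℝ) = (fun ξ => 1 / 4 * (⇑(X.bB χ) - ⇑(X.aB χ)) ξ) +
      fun ξ => X.c ^ 2 * (χ.g1 ∘ X.y) ξ := funext (X.QB_apply χ)
  rw [← e] at h
  refine h.congr_deriv ?_
  rw [h4, h5, AB_apply, pB_apply, eB_apply]; ring

/-- `P_ξ = Q y_ξ`. -/
lemma ae_hasDerivAt_P : ∀ᵐ ξ : ℝ, HasDerivAt (fun ξ => X.pB χ ξ + X.c ^ 2 * gFun χ (X.y ξ))
    (X.QB χ ξ * (1 + X.zx ξ)) ξ := by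
  filter_upwards [X.ae_hasDerivAt_aB χ, X.ae_hasDerivAt_bB χ, X.ae_hasDerivAt_y] with ξ h1 h2 h3
  have h := ((h1.add h2).const_mul (1 / 4)).add
    (((χ.hasDerivAt_gFun (X.y ξ)).comp ξ h3).const_mul (X.c ^ 2))
  refine h.congr_deriv ?_
  rw [QB_apply]; ring

lemma locAC_zeta : LocAC X.zeta := X.zeta.memSob.locAC

lemma locAC_y : LocAC X.y := LocAC.id.add' X.locAC_zeta

lemma locAC_U : LocAC (X.U χ) := X.ubar.memSob.locAC.add' (χ.locAC.const_mul X.c)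

lemma locAC_aB : LocAC (X.aB χ) :=
  (LocAC.comp_left contDiff_exp_neg X.locAC_zeta).mul (X.KP χ).memSob.locAC

lemma locAC_bB : LocAC (X.bB χ) :=
  (LocAC.comp_left Real.contDiff_exp X.locAC_zeta).mul (X.KM χ).memSob.locAC

lemma locAC_pB : LocAC (X.pB χ) := ((X.locAC_aB χ).add' (X.locAC_bB χ)).const_mul _

lemma _root_.CamassaHolm.PartitionFunction.contDiff_g2 : ContDiff ℝ 1 χ.g2 := by
  refine contDiff_one_iff_deriv.2 ⟨fun x => (χ.hasDerivAt_g2 x).differentiableAt, ?_⟩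
  rw [show deriv χ.g2 = fun x => (km χ.ddsq x - kp χ.ddsq x) / 2 from
    funext fun x => (χ.hasDerivAt_g2 x).deriv]
  exact ((locAC_km χ.memLp_ddsq).sub (locAC_kp χ.memLp_ddsq)).continuous.div_const 2

lemma _root_.CamassaHolm.PartitionFunction.contDiff_g1 : ContDiff ℝ 1 χ.g1 := by
  refine contDiff_one_iff_deriv.2 ⟨fun x => (χ.hasDerivAt_g1 x).differentiableAt, ?_⟩
  rw [show deriv χ.g1 = χ.g2 from funext fun x => (χ.hasDerivAt_g1 x).deriv]
  exact χ.contDiff_g2.continuous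

lemma _root_.CamassaHolm.PartitionFunction.contDiff_gFun : ContDiff ℝ 1 (gFun χ) := by
  refine contDiff_one_iff_deriv.2 ⟨fun x => (χ.hasDerivAt_gFun x).differentiableAt, ?_⟩
  rw [χ.deriv_gFun]
  exact χ.contDiff_g1.continuous

lemma locAC_QB : LocAC (X.QB χ) := by
  rw [funext (X.QB_apply χ)]
  exact (((X.locAC_bB χ).sub (X.locAC_aB χ)).const_mul _).add'
    ((LocAC.comp_left χ.contDiff_g1 X.locAC_y).const_mul _)

/-- Q vanishes at both ends in the H¹ sense, with no multiple of χ left over. So U_t = -Q only moves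
ū, and c is conserved. -/
lemma memSob_mQ : MemSob 2 2 (fun ξ => -X.QB χ ξ) := by
  refine ⟨(X.locAC_QB χ).neg, ((Lp.memLp (X.QL χ)).ae_eq (X.rep_QL χ)).neg,
    (Lp.memLp (X.mQx χ)).ae_eq ?_⟩
  filter_upwards [X.ae_hasDerivAt_QB χ] with ξ h
  have := h.neg.deriv
  rw [neg_neg] at this
  exact this.symm

/-- `-Q` as an element of `H¹`. -/
def mQ : H1 := Sob.mk (X.memSob_mQ χ)

lemma mQ_apply (ξ : ℝ) : X.mQ χ ξ = -X.QB χ ξ := rfl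

lemma toL2_mQ : H1.toL2 (X.mQ χ) = -X.QL χ := by
  refine Lp.ext ?_
  filter_upwards [H1.coeFn_toL2 (X.mQ χ), Lp.coeFn_neg (X.QL χ), X.rep_QL χ] with ξ h1 h2 h3
  rw [h1, h2, Pi.neg_apply, h3, mQ_apply]

lemma dL_mQ : H1.dL (X.mQ χ) = X.mQx χ := by
  refine Lp.ext ?_
  filter_upwards [H1.coeFn_dL (X.mQ χ), X.ae_hasDerivAt_QB χ] with ξ h1 h2
  have := h2.neg.deriv
  rw [neg_neg] at this
  rw [h1]; exact this

lemma memSob_U : MemSob ∞ 2 (X.U χ) :=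
  ⟨X.locAC_U χ, memLp_top_of_bound (X.UB χ).continuous.aestronglyMeasurable ‖X.UB χ‖
    (ae_of_all _ fun ξ => (X.UB χ).norm_coe_le_norm ξ),
    (Lp.memLp (X.Ux χ)).ae_eq (X.rep_Ux χ)⟩

/-- `U` as an element of `V`. -/
def UV : V := Sob.mk (X.memSob_U χ)

lemma toBC_UV : V.toBC (X.UV χ) = X.UB χ := rfl

lemma dL_UV : V.dL (X.UV χ) = X.Ux χ := by
  refine Lp.ext ?_
  filter_upwards [V.coeFn_dL (X.UV χ), X.rep_Ux χ] with ξ h1 h2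
  rw [h1, h2]; rfl

/-- The vector field of the system, in a form that makes sense on all of `E`. -/
def field : E := mk (X.UV χ) (X.mQ χ) 0 ((2 : ℝ) • mulL (X.AB χ) (X.Ux χ))

end E

/-! ### The vector field is Lipschitz on bounded sets -/

namespace E

variable (χ : PartitionFunction)

lemma lipB_c : LipB c := LipB.clm cL
lemma lipB_h : LipB h := LipB.clm hL
lemma lipB_ubar : LipB ubar := LipB.clm ubarL
lemma lipB_zB : LipB zB := LipB.clm (V.toBC ∘L zetaL)
lemma lipB_zx : LipB zx := LipB.clm (V.dL ∘L zetaL)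
lemma lipB_chiy : LipB (chiy χ) := χ.chiN.lipB_toBC.comp lipB_zB
lemma lipB_UbB : LipB (UbB χ) :=
  (LipB.clm_comp H1.toBC lipB_ubar).sub (lipB_c.smul (χ.dchiN.lipB_toBC.comp lipB_zB))
lemma lipB_UbL : LipB (UbL χ) :=
  (LipB.clm_comp H1.toL2 lipB_ubar).sub (lipB_c.smul (χ.dchiN.lipB_toL2.comp lipB_zB))
lemma lipB_UB : LipB (UB χ) :=
  (LipB.clm_comp H1.toBC lipB_ubar).add (lipB_c.smul (LipB.const _))
lemma lipB_Ux : LipB (Ux χ) :=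
  (LipB.clm_comp H1.dL lipB_ubar).add (lipB_c.smul (LipB.const _))
lemma lipB_eB : LipB (eB χ) :=
  ((LipB.bilin mulBC (lipB_UbB χ) (lipB_UbB χ)).smul_const 2).add
    ((lipB_c.smul (LipB.bilin mulBC (lipB_UbB χ) (lipB_chiy χ))).smul_const 4)
lemma lipB_eL : LipB (eL χ) :=
  ((LipB.bilin mulL (lipB_UbB χ) (lipB_UbL χ)).smul_const 2).add
    ((lipB_c.smul (LipB.bilin mulL (lipB_chiy χ) (lipB_UbL χ))).smul_const 4)
lemma lipB_dens : LipB (dens χ) :=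
  ((lipB_eL χ).add (LipB.bilin mulL (lipB_eB χ) lipB_zx)).add lipB_h
lemma lipB_expP : LipB expP := Nem.exp.lipB_toBC.comp lipB_zB
lemma lipB_expM : LipB expM := Nem.exp.lipB_toBC.comp lipB_zB.neg
lemma lipB_KP : LipB (KP χ) := LipB.clm_comp Kp (LipB.bilin mulL lipB_expP (lipB_dens χ))
lemma lipB_KM : LipB (KM χ) := LipB.clm_comp Km (LipB.bilin mulL lipB_expM (lipB_dens χ))
lemma lipB_aB : LipB (aB χ) := LipB.bilin mulBC lipB_expM (LipB.clm_comp H1.toBC (lipB_KP χ))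
lemma lipB_aL : LipB (aL χ) := LipB.bilin mulL lipB_expM (LipB.clm_comp H1.toL2 (lipB_KP χ))
lemma lipB_bB : LipB (bB χ) := LipB.bilin mulBC lipB_expP (LipB.clm_comp H1.toBC (lipB_KM χ))
lemma lipB_bL : LipB (bL χ) := LipB.bilin mulL lipB_expP (LipB.clm_comp H1.toL2 (lipB_KM χ))
lemma lipB_pB : LipB (pB χ) := ((lipB_aB χ).add (lipB_bB χ)).smul_const _
lemma lipB_pL : LipB (pL χ) := ((lipB_aL χ).add (lipB_bL χ)).smul_const _
lemma lipB_QL : LipB (QL χ) := (((lipB_bL χ).sub (lipB_aL χ)).smul_const _).add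
  (lipB_c.smul (lipB_c.smul (χ.g1N.lipB_toL2.comp lipB_zB)))
lemma lipB_AB : LipB (AB χ) :=
  (((LipB.bilin mulBC (lipB_UbB χ) (lipB_UbB χ)).add
    ((lipB_c.smul (LipB.bilin mulBC (lipB_UbB χ) (lipB_chiy χ))).smul_const 2)).sub
      (lipB_pB χ)).sub (lipB_c.smul (lipB_c.smul (χ.g2N.lipB_toBC.comp lipB_zB)))
lemma lipB_AL : LipB (AL χ) :=
  (((LipB.bilin mulL (lipB_UbB χ) (lipB_UbL χ)).add
    ((lipB_c.smul (LipB.bilin mulL (lipB_chiy χ) (lipB_UbL χ))).smul_const 2)).sub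
      (lipB_pL χ)).sub (lipB_c.smul (lipB_c.smul (χ.g2N.lipB_toL2.comp lipB_zB)))
lemma lipB_mQx : LipB (mQx χ) :=
  ((lipB_h.smul_const _).add (lipB_AL χ)).add (LipB.bilin mulL (lipB_AB χ) lipB_zx)

/-- Maps that are Lipschitz on bounded sets are closed under sums, composition and bounded bilinear
maps, and every constituent of the field is obtained this way from ζ, ū, c, h. Norms in V and H¹ are
checked on the function and on its derivative separately. -/
lemma lipB_field : LipB (field χ) := by
  refine LipB.mkE (LipB.toV ?_ ?_) (LipB.toH1 ?_ ?_) (LipB.const 0) ?_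
  · exact lipB_UB χ
  · simp only [dL_UV]; exact lipB_Ux χ
  · simp only [toL2_mQ]; exact (lipB_QL χ).neg
  · simp only [dL_mQ]; exact lipB_mQx χ
  · exact (LipB.bilin mulL (lipB_AB χ) (lipB_Ux χ)).smul_const 2

end E

/-! ### The field coincides with the right-hand side of the system -/

namespace E

variable (χ : PartitionFunction) {X : E}

/-- Monotonicity of y fixes the sign inside the absolute value. The kernel then factors into
functions of ξ and of η and the fixed convolution kernel e^{η - ξ}, which is how a nonlinear
dependence on y becomes a linear operator between multiplications. -/
lemma exp_kernel_left (hy : Monotone X.y) {ξ η : ℝ} (h : η ≤ ξ) :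
    Real.exp (-|X.y ξ - X.y η|) = Real.exp (-X.zeta ξ) * (Real.exp (η - ξ) * Real.exp (X.zeta η)) := by
  rw [abs_of_nonneg (sub_nonneg.2 (hy h)), ← Real.exp_add, ← Real.exp_add, y, y]
  congr 1; ring

lemma exp_kernel_right (hy : Monotone X.y) {ξ η : ℝ} (h : ξ ≤ η) :
    Real.exp (-|X.y ξ - X.y η|) = Real.exp (X.zeta ξ) * (Real.exp (ξ - η) * Real.exp (-X.zeta η)) := by
  rw [abs_of_nonpos (sub_nonpos.2 (hy h)), ← Real.exp_add, ← Real.exp_add, y, y]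
  congr 1; ring

lemma integral_left (hy : Monotone X.y) (ξ : ℝ) :
    IntegrableOn (fun η => Real.exp (-|X.y ξ - X.y η|) * X.density χ η) (Iic ξ) ∧
    ∫ η in Iic ξ, Real.exp (-|X.y ξ - X.y η|) * X.density χ η = X.aB χ ξ := by
  have h : (fun η => Real.exp (-X.zeta ξ) * (Real.exp (η - ξ) * mulL X.expP (X.dens χ) η))
      =ᵐ[volume.restrict (Iic ξ)] fun η => Real.exp (-|X.y ξ - X.y η|) * X.density χ η := by
    filter_upwards [ae_restrict_of_ae (coeFn_mulL X.expP (X.dens χ)),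
      ae_restrict_of_ae (X.rep_dens χ), ae_restrict_mem measurableSet_Iic] with η h1 h2 h3
    rw [h1, h2, exp_kernel_left hy h3, expP_apply]; ring
  refine ⟨((integrableOn_kp (Lp.memLp _) ξ).const_mul _).congr h, ?_⟩
  rw [← integral_congr_ae h, integral_const_mul]; rfl

lemma integral_right (hy : Monotone X.y) (ξ : ℝ) :
    IntegrableOn (fun η => Real.exp (-|X.y ξ - X.y η|) * X.density χ η) (Ioi ξ) ∧
    ∫ η in Ioi ξ, Real.exp (-|X.y ξ - X.y η|) * X.density χ η = X.bB χ ξ := by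
  have h : (fun η => Real.exp (X.zeta ξ) * (Real.exp (ξ - η) * mulL X.expM (X.dens χ) η))
      =ᵐ[volume.restrict (Ioi ξ)] fun η => Real.exp (-|X.y ξ - X.y η|) * X.density χ η := by
    filter_upwards [ae_restrict_of_ae (coeFn_mulL X.expM (X.dens χ)),
      ae_restrict_of_ae (X.rep_dens χ), ae_restrict_mem measurableSet_Ioi] with η h1 h2 h3
    rw [h1, h2, exp_kernel_right hy (le_of_lt h3), expM_apply]; ring
  refine ⟨((integrableOn_km (Lp.memLp _) ξ).const_mul _).congr h, ?_⟩
  rw [← integral_congr_ae h, integral_const_mul]; rfl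

lemma integrable_kernel (hy : Monotone X.y) (ξ : ℝ) :
    Integrable (fun η => Real.exp (-|X.y ξ - X.y η|) * X.density χ η) := by
  rw [← integrableOn_univ, ← Iic_union_Ioi (a := ξ)]
  exact (integral_left χ hy ξ).1.union (integral_right χ hy ξ).1

lemma P_eq (hy : Monotone X.y) (ξ : ℝ) : P χ X ξ = X.pB χ ξ + X.c ^ 2 * gFun χ (X.y ξ) := by
  have h := integral_add_compl (measurableSet_Iic (a := ξ)) (integrable_kernel χ hy ξ)
  rw [compl_Iic, (integral_left χ hy ξ).2, (integral_right χ hy ξ).2] at h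
  rw [P, ← h, pB_apply]

lemma Q_eq (hy : Monotone X.y) (ξ : ℝ) : Q χ X ξ = X.QB χ ξ := by
  have e1 : (fun η => Real.exp (-|X.y ξ - X.y η|) * X.density χ η) =ᵐ[volume.restrict (Iic ξ)]
      fun η => Real.sign (ξ - η) * Real.exp (-|X.y ξ - X.y η|) * X.density χ η := by
    filter_upwards [ae_restrict_mem measurableSet_Iic,
      ae_restrict_of_ae (Measure.ae_ne volume ξ)] with η h1 h2
    rw [Real.sign_of_pos (sub_pos.2 (lt_of_le_of_ne h1 h2)), one_mul]
  have e2 : (fun η => -(Real.exp (-|X.y ξ - X.y η|) * X.density χ η)) =ᵐ[volume.restrict (Ioi ξ)]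
      fun η => Real.sign (ξ - η) * Real.exp (-|X.y ξ - X.y η|) * X.density χ η := by
    filter_upwards [ae_restrict_mem measurableSet_Ioi] with η h1
    rw [Real.sign_of_neg (sub_neg.2 h1)]; ring
  have i1 := Integrable.congr (integral_left χ hy ξ).1 e1
  have i2 := Integrable.congr (integral_right χ hy ξ).1.neg e2
  have i : Integrable fun η => Real.sign (ξ - η) * Real.exp (-|X.y ξ - X.y η|) * X.density χ η := by
    rw [← integrableOn_univ, ← Iic_union_Ioi (a := ξ)]
    exact IntegrableOn.union i1 i2
  have h := integral_add_compl (measurableSet_Iic (a := ξ)) i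
  rw [compl_Iic, ← integral_congr_ae e1, ← integral_congr_ae e2, integral_neg,
    (integral_left χ hy ξ).2, (integral_right χ hy ξ).2] at h
  rw [Q, ← h, QB_apply, χ.deriv_gFun]; ring

lemma isVelocity_field (hy : Monotone X.y) : IsVelocity χ X (X.field χ) where
  zeta_eq _ := rfl
  U_eq ξ := by
    rw [Q_eq χ hy]
    change -X.QB χ ξ + 0 * χ ξ = _
    ring
  h_eq := by
    have : Rep (X.field χ).h _ := ((X.rep_Ux χ).mulL (X.AB χ)).smul 2
    filter_upwards [this] with ξ h
    rw [h, AB_eq, P_eq χ hy]; ring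

/-- The velocity is unique. -/
lemma _root_.CamassaHolm.IsVelocity.eq_field (hy : Monotone X.y) {D : E} (hD : IsVelocity χ X D) :
    D = X.field χ := by
  have hF := isVelocity_field χ hy
  have hU : ∀ ξ, D.U χ ξ = (X.field χ).U χ ξ := fun ξ => by rw [hD.U_eq, hF.U_eq]
  -- The constant c is determined by U as its limit at +∞, since ū vanishes there and χ = 1.
  have hc : D.c = (X.field χ).c := by
    have key : ∀ Y : E, Tendsto (Y.U χ) atTop (𝓝 Y.c) := fun Y => by
      have h1 := Y.ubar.memSob.tendsto_atTop.add
        (tendsto_const_nhds (x := Y.c) (f := atTop (α := ℝ)))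
      rw [zero_add] at h1
      refine h1.congr' ?_
      filter_upwards [eventually_ge_atTop 1] with ξ hξ
      rw [E.U, χ.eq_one ξ hξ, mul_one]
    exact tendsto_nhds_unique (key D) ((key (X.field χ)).congr fun ξ => (hU ξ).symm)
  refine E.ext_of χ (fun ξ => ?_) hU hc ?_
  · rw [y, y, hD.zeta_eq, hF.zeta_eq]
  · filter_upwards [hD.h_eq, hF.h_eq] with ξ h1 h2
    rw [h1, h2]

lemma monotone_y_of_deriv_nonneg (h : ∀ᵐ ξ : ℝ, 0 ≤ deriv X.y ξ) : Monotone X.y := by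
  intro a b hab
  have := X.locAC_y.integral_deriv a b
  have h2 := intervalIntegral.integral_nonneg_of_ae (μ := volume) hab h
  linarith

end E

/-! ### Propagation of the light cone -/

section Calculus

variable {W₁ W₂ : Type*} [NormedAddCommGroup W₁] [NormedSpace ℝ W₁]
  [NormedAddCommGroup W₂] [NormedSpace ℝ W₂]

lemma HasDerivWithinAt.clm_apply' (L : W₁ →L[ℝ] W₂) {f : ℝ → W₁} {f' : W₁} {s : Set ℝ} {t : ℝ}
    (h : HasDerivWithinAt f f' s t) : HasDerivWithinAt (fun t => L (f t)) (L f') s t :=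
  L.hasFDerivAt.comp_hasDerivWithinAt t h

end Calculus

lemma mulL_mul (f g : BC) (u : L2) : mulL (f * g) u = mulL f (mulL g u) := by
  refine Lp.ext ?_
  filter_upwards [coeFn_mulL (f * g) u, coeFn_mulL f (mulL g u), coeFn_mulL g u] with x h1 h2 h3
  rw [h1, h2, h3, BoundedContinuousFunction.mul_apply, mul_assoc]

lemma norm_mulL_le (f : BC) (u : L2) : ‖mulL f u‖ ≤ ‖f‖ * ‖u‖ := by
  refine Lp.norm_le_mul_norm_of_ae_le_mul ?_
  filter_upwards [coeFn_mulL f u] with x hx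
  rw [hx, norm_mul]
  exact mul_le_mul_of_nonneg_right (f.norm_coe_le_norm x) (norm_nonneg _)

/-- The linear system `v₁' = v₂`, `v₂' = A v₁ + ½ v₃`, `v₃' = 2 A v₂` in `L²`. -/
structure LinSys (A : ℝ → BC) (τ : ℝ) (v₁ v₂ v₃ : ℝ → L2) : Prop where
  one : ∀ t ∈ Icc 0 τ, HasDerivWithinAt v₁ (v₂ t) (Icc 0 τ) t
  two : ∀ t ∈ Icc 0 τ,
    HasDerivWithinAt v₂ (mulL (A t) (v₁ t) + (1 / 2 : ℝ) • v₃ t) (Icc 0 τ) t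
  three : ∀ t ∈ Icc 0 τ, HasDerivWithinAt v₃ ((2 : ℝ) • mulL (A t) (v₂ t)) (Icc 0 τ) t

/-- The system `p' = ½ q`, `q' = A p` of bounded continuous functions. -/
structure SpinSys (A : ℝ → BC) (τ : ℝ) (p q : ℝ → BC) : Prop where
  one : ∀ t ∈ Icc 0 τ, HasDerivWithinAt p ((1 / 2 : ℝ) • q t) (Icc 0 τ) t
  two : ∀ t ∈ Icc 0 τ, HasDerivWithinAt q (A t * p t) (Icc 0 τ) t

section LinSys

variable {A : ℝ → BC} {τ : ℝ} {v₁ v₂ v₃ w₁ w₂ w₃ : ℝ → L2} {p q p' q' : ℝ → BC}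

lemma LinSys.add (h : LinSys A τ v₁ v₂ v₃) (h' : LinSys A τ w₁ w₂ w₃) :
    LinSys A τ (fun t => v₁ t + w₁ t) (fun t => v₂ t + w₂ t) (fun t => v₃ t + w₃ t) where
  one t ht := (h.one t ht).add (h'.one t ht)
  two t ht := ((h.two t ht).add (h'.two t ht)).congr_deriv (by rw [map_add]; module)
  three t ht := ((h.three t ht).add (h'.three t ht)).congr_deriv (by rw [map_add]; module)

lemma LinSys.smul (c : ℝ) (h : LinSys A τ v₁ v₂ v₃) :
    LinSys A τ (fun t => c • v₁ t) (fun t => c • v₂ t) (fun t => c • v₃ t) where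
  one t ht := (h.one t ht).const_smul c
  two t ht := ((h.two t ht).const_smul c).congr_deriv (by rw [map_smul]; module)
  three t ht := ((h.three t ht).const_smul c).congr_deriv (by rw [map_smul]; module)

/-- The difference of two solutions has norm growing at a bounded rate and starts at 0. The constant
1 + 2K dominates the linear right-hand side in the maximum norm. -/
lemma LinSys.eq (h : LinSys A τ v₁ v₂ v₃) (h' : LinSys A τ w₁ w₂ w₃) {K : ℝ} (hK0 : 0 ≤ K)
    (hK : ∀ t ∈ Icc 0 τ, ‖A t‖ ≤ K) (h1 : v₁ 0 = w₁ 0) (h2 : v₂ 0 = w₂ 0) (h3 : v₃ 0 = w₃ 0) :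
    ∀ t ∈ Icc 0 τ, v₁ t = w₁ t ∧ v₂ t = w₂ t ∧ v₃ t = w₃ t := by
  have H := h.add (h'.smul (-1))
  let D : ℝ → L2 × L2 × L2 := fun t => (v₁ t + (-1 : ℝ) • w₁ t, v₂ t + (-1 : ℝ) • w₂ t,
    v₃ t + (-1 : ℝ) • w₃ t)
  have hD : ∀ t ∈ Icc 0 τ, HasDerivWithinAt D ((D t).2.1,
      mulL (A t) (D t).1 + (1 / 2 : ℝ) • (D t).2.2, (2 : ℝ) • mulL (A t) (D t).2.1) (Icc 0 τ) t :=
    fun t ht => (H.one t ht).prodMk ((H.two t ht).prodMk (H.three t ht))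
  have key := eq_zero_of_abs_deriv_le_mul_abs_self_of_eq_zero_right (f := D) (K := 1 + 2 * K)
    (a := 0) (b := τ)
    (fun t ht => (hD t ht).continuousWithinAt) (fun t ht =>
      (hD t ⟨ht.1, ht.2.le⟩).mono_of_mem_nhdsWithin (mem_of_superset
        (Icc_mem_nhdsGE ht.2) (Icc_subset_Icc_left ht.1))) (by simp [D, h1, h2, h3]) (by
      intro t ht
      have hA := hK t ⟨ht.1, ht.2.le⟩
      have d1 : ‖(D t).1‖ ≤ ‖D t‖ := norm_fst_le _
      have d2 : ‖(D t).2.1‖ ≤ ‖D t‖ := (norm_fst_le _).trans (norm_snd_le _)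
      have d3 : ‖(D t).2.2‖ ≤ ‖D t‖ := (norm_snd_le _).trans (norm_snd_le _)
      have hn := norm_nonneg (D t)
      have m1 : ‖mulL (A t) (D t).1‖ ≤ K * ‖D t‖ :=
        (norm_mulL_le _ _).trans (mul_le_mul hA d1 (norm_nonneg _) hK0)
      have m2 : ‖mulL (A t) (D t).2.1‖ ≤ K * ‖D t‖ :=
        (norm_mulL_le _ _).trans (mul_le_mul hA d2 (norm_nonneg _) hK0)
      have hKn : 0 ≤ K * ‖D t‖ := by positivity
      refine max_le (by linarith) (max_le ((norm_add_le _ _).trans ?_) ?_)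
      · rw [norm_smul]; norm_num; linarith
      · rw [norm_smul]; norm_num; linarith)
  intro t ht
  have h0 := key t ht
  simp only [D, neg_smul, one_smul, Prod.mk_eq_zero, ← sub_eq_add_neg, sub_eq_zero] at h0
  exact h0

/-- The linear system is the symmetric square of p' = ½ q, q' = A p: products of two solutions of
the latter, symmetrized in the middle component, solve the former. -/
lemma SpinSys.linSys (h : SpinSys A τ p q) (h' : SpinSys A τ p' q') (v : L2) :
    LinSys A τ (fun t => mulL (p t * p' t) v)
      (fun t => mulL ((1 / 2 : ℝ) • (p t * q' t + q t * p' t)) v)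
      (fun t => mulL (q t * q' t) v) where
  one t ht := (HasDerivWithinAt.clm_apply' (mulL.flip v)
    ((h.one t ht).mul (h'.one t ht))).congr_deriv (by
      rw [ContinuousLinearMap.flip_apply]
      congr 2
      ext x; simp; ring)
  two t ht := (HasDerivWithinAt.clm_apply' (mulL.flip v)
    ((((h.one t ht).mul (h'.two t ht)).add ((h.two t ht).mul (h'.one t ht))).const_smul
      (1 / 2 : ℝ))).congr_deriv (by
        rw [ContinuousLinearMap.flip_apply, ← mulL_mul, ← _root_.smul_apply,
          ← map_smul, ← _root_.add_apply, ← map_add]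
        congr 2
        ext x; simp; ring)
  three t ht := (HasDerivWithinAt.clm_apply' (mulL.flip v)
    ((h.two t ht).mul (h'.two t ht))).congr_deriv (by
      rw [ContinuousLinearMap.flip_apply, ← mulL_mul, ← _root_.smul_apply, ← map_smul]
      congr 2
      ext x; simp; ring)

/-- Evaluation of bounded continuous functions. -/
def evalBC (x : ℝ) : BC →L[ℝ] ℝ := BoundedContinuousFunction.evalCLM ℝ x

lemma evalBC_apply (x : ℝ) (f : BC) : evalBC x f = f x := rfl

/-- e^{Ct} s is nondecreasing and e^{-Ct} s is nonincreasing. The upper bound is Grönwall's; the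
lower one keeps y_ξ + h away from 0. -/
lemma exp_bounds_of_deriv {s s' : ℝ → ℝ} {C : ℝ}
    (h : ∀ t ∈ Icc 0 τ, HasDerivWithinAt s (s' t) (Icc 0 τ) t)
    (hb : ∀ t ∈ Icc 0 τ, |s' t| ≤ C * s t) :
    ∀ t ∈ Icc 0 τ, s 0 * Real.exp (-(C * t)) ≤ s t ∧ s t ≤ s 0 * Real.exp (C * t) := by
  have hmono : ∀ ε : ℝ, ∀ t ∈ Icc 0 τ, HasDerivWithinAt (fun t => Real.exp (ε * t) * s t)
      (Real.exp (ε * t) * (ε * s t + s' t)) (Icc 0 τ) t := fun ε t ht => by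
    have h1 : HasDerivWithinAt (fun t => Real.exp (ε * t)) (Real.exp (ε * t) * ε) (Icc 0 τ) t := by
      have := (((hasDerivAt_id t).const_mul ε).exp).hasDerivWithinAt (s := Icc 0 τ)
      simpa using this
    exact (h1.mul (h t ht)).congr_deriv (by ring)
  have hup := monotoneOn_of_hasDerivWithinAt_nonneg (convex_Icc 0 τ)
    (fun t ht => (hmono C t ht).continuousWithinAt)
    (fun t ht => (hmono C t (interior_subset ht)).mono interior_subset) (fun t ht => by
      have h1 := (abs_le.1 (hb t (interior_subset ht))).1
      exact mul_nonneg (Real.exp_pos _).le (by linarith))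
  have hdn := antitoneOn_of_hasDerivWithinAt_nonpos (convex_Icc 0 τ)
    (fun t ht => (hmono (-C) t ht).continuousWithinAt)
    (fun t ht => (hmono (-C) t (interior_subset ht)).mono interior_subset) (fun t ht => by
      have h1 := (abs_le.1 (hb t (interior_subset ht))).2
      exact mul_nonpos_of_nonneg_of_nonpos (Real.exp_pos _).le (by linarith))
  intro t ht
  have h0 : (0 : ℝ) ∈ Icc 0 τ := ⟨le_rfl, ht.1.trans ht.2⟩
  have e1 := hup h0 ht ht.1
  have e2 := hdn h0 ht ht.1
  simp only [mul_zero, Real.exp_zero, one_mul] at e1 e2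
  have e3 : Real.exp (C * t) * Real.exp (-(C * t)) = 1 := by rw [← Real.exp_add]; simp
  have e4 : -C * t = -(C * t) := by ring
  rw [e4] at e2
  constructor
  · calc s 0 * Real.exp (-(C * t)) ≤ Real.exp (C * t) * s t * Real.exp (-(C * t)) := by gcongr
      _ = s t := by linear_combination s t * e3
  · calc s t = Real.exp (-(C * t)) * s t * Real.exp (C * t) := by linear_combination -s t * e3
      _ ≤ _ := by gcongr

end LinSys

/-- A point of the light cone is the square of a vector of the plane; the sign of u is put into β.
-/
lemma exists_spinor {y u h : ℝ} (hy : 0 ≤ y) (hh : 0 ≤ h) (e : y * h = u ^ 2) :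
    ∃ α β : ℝ, y = α ^ 2 ∧ u = α * β ∧ h = β ^ 2 := by
  have h1 : √y * √h = |u| := by rw [← Real.sqrt_mul hy, e, Real.sqrt_sq_eq_abs]
  rcases le_total 0 u with hu | hu
  · exact ⟨√y, √h, (Real.sq_sqrt hy).symm, by rw [h1, abs_of_nonneg hu], (Real.sq_sqrt hh).symm⟩
  · exact ⟨√y, -√h, (Real.sq_sqrt hy).symm, by rw [mul_neg, h1, abs_of_nonpos hu, neg_neg],
      by rw [neg_sq, Real.sq_sqrt hh]⟩

/-- The pointwise constraints of `ℱ`, with constants. -/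
def Cone (χ : PartitionFunction) (K : ℝ) (X : E) : Prop :=
  ∀ᵐ ξ : ℝ, (0 ≤ 1 + X.zx ξ ∧ 0 ≤ X.h ξ ∧ (1 + X.zx ξ) * X.h ξ = X.Ux χ ξ ^ 2) ∧
    K⁻¹ ≤ 1 + X.zx ξ + X.h ξ ∧ 1 + X.zx ξ + X.h ξ ≤ K

lemma Cone.mono {χ : PartitionFunction} {K K' : ℝ} {X : E} (h : Cone χ K X) (hK : 0 < K)
    (hK' : K ≤ K') : Cone χ K' X := by
  filter_upwards [h] with ξ hξ
  exact ⟨hξ.1, (inv_anti₀ hK hK').trans hξ.2.1, hξ.2.2.trans hK'⟩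

lemma Cone.monotone_y {χ : PartitionFunction} {K : ℝ} {X : E} (h : Cone χ K X) : Monotone X.y := by
  refine E.monotone_y_of_deriv_nonneg ?_
  filter_upwards [h, X.ae_deriv_y] with ξ h1 h2
  rw [h2]; exact h1.1.1

/-- The state space of the system augmented by two spinors. -/
abbrev Aug : Type := E × ((BC × BC) × (BC × BC))

/-- The system augmented by two solutions of `p' = ½ q`, `q' = (U² - P) p`. -/
def augField (χ : PartitionFunction) (Z : Aug) : Aug :=
  (Z.1.field χ, (((1 / 2 : ℝ) • Z.2.1.2, mulBC (Z.1.AB χ) Z.2.1.1),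
    ((1 / 2 : ℝ) • Z.2.2.2, mulBC (Z.1.AB χ) Z.2.2.1)))

/-- The initial value for the augmented system. -/
def augInit (X : E) : Aug := (X, ((1, 0), (0, 1)))

lemma lipB_augField (χ : PartitionFunction) : LipB (augField χ) := by
  have f1 : LipB fun Z : Aug => Z.1 := LipB.clm (ContinuousLinearMap.fst ℝ E ((BC × BC) × (BC × BC)))
  have f2 : LipB fun Z : Aug => Z.2 := LipB.clm (ContinuousLinearMap.snd ℝ E ((BC × BC) × (BC × BC)))
  have g1 : LipB fun Z : Aug => Z.2.1 :=
    LipB.clm_comp (ContinuousLinearMap.fst ℝ (BC × BC) (BC × BC)) f2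
  have g2 : LipB fun Z : Aug => Z.2.2 :=
    LipB.clm_comp (ContinuousLinearMap.snd ℝ (BC × BC) (BC × BC)) f2
  have a1 : LipB fun Z : Aug => Z.2.1.1 := LipB.clm_comp (ContinuousLinearMap.fst ℝ BC BC) g1
  have a2 : LipB fun Z : Aug => Z.2.1.2 := LipB.clm_comp (ContinuousLinearMap.snd ℝ BC BC) g1
  have b1 : LipB fun Z : Aug => Z.2.2.1 := LipB.clm_comp (ContinuousLinearMap.fst ℝ BC BC) g2
  have b2 : LipB fun Z : Aug => Z.2.2.2 := LipB.clm_comp (ContinuousLinearMap.snd ℝ BC BC) g2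
  have hA := (E.lipB_AB χ).comp f1
  exact ((E.lipB_field χ).comp f1).prodMk
    (((a2.smul_const _).prodMk (LipB.bilin mulBC hA a1)).prodMk
      ((b2.smul_const _).prodMk (LipB.bilin mulBC hA b1)))

section Aug

variable {χ : PartitionFunction} {Z : ℝ → Aug} {τ : ℝ}

lemma SolvesOn.fst (h : SolvesOn (augField χ) Z τ) : SolvesOn (E.field χ) (fun t => (Z t).1) τ :=
  fun t ht => HasDerivWithinAt.clm_apply' (ContinuousLinearMap.fst ℝ _ _) (h t ht)

lemma SolvesOn.spin₁ (h : SolvesOn (augField χ) Z τ) :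
    SpinSys (fun t => (Z t).1.AB χ) τ (fun t => (Z t).2.1.1) (fun t => (Z t).2.1.2) := by
  have h1 := fun t ht => HasDerivWithinAt.clm_apply' (ContinuousLinearMap.fst ℝ _ _)
    (HasDerivWithinAt.clm_apply' (ContinuousLinearMap.snd ℝ _ _) (h t ht))
  exact ⟨fun t ht => HasDerivWithinAt.clm_apply' (ContinuousLinearMap.fst ℝ _ _) (h1 t ht),
    fun t ht => HasDerivWithinAt.clm_apply' (ContinuousLinearMap.snd ℝ _ _) (h1 t ht)⟩

lemma SolvesOn.spin₂ (h : SolvesOn (augField χ) Z τ) :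
    SpinSys (fun t => (Z t).1.AB χ) τ (fun t => (Z t).2.2.1) (fun t => (Z t).2.2.2) := by
  have h1 := fun t ht => HasDerivWithinAt.clm_apply' (ContinuousLinearMap.snd ℝ _ _)
    (HasDerivWithinAt.clm_apply' (ContinuousLinearMap.snd ℝ _ _) (h t ht))
  exact ⟨fun t ht => HasDerivWithinAt.clm_apply' (ContinuousLinearMap.fst ℝ _ _) (h1 t ht),
    fun t ht => HasDerivWithinAt.clm_apply' (ContinuousLinearMap.snd ℝ _ _) (h1 t ht)⟩

end Aug

/-! ### The equations for the components, and the linear system for the derivatives. -/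

section Field

variable {χ : PartitionFunction} {X : ℝ → E} {τ : ℝ}

lemma SolvesOn.zeta (h : SolvesOn (E.field χ) X τ) :
    ∀ t ∈ Icc 0 τ, HasDerivWithinAt (fun t => (X t).zeta) ((X t).UV χ) (Icc 0 τ) t :=
  fun t ht => HasDerivWithinAt.clm_apply' E.zetaL (h t ht)

lemma SolvesOn.ubar (h : SolvesOn (E.field χ) X τ) :
    ∀ t ∈ Icc 0 τ, HasDerivWithinAt (fun t => (X t).ubar) ((X t).mQ χ) (Icc 0 τ) t :=
  fun t ht => HasDerivWithinAt.clm_apply' E.ubarL (h t ht)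

lemma SolvesOn.h (h : SolvesOn (E.field χ) X τ) :
    ∀ t ∈ Icc 0 τ, HasDerivWithinAt (fun t => (X t).h)
      ((2 : ℝ) • mulL ((X t).AB χ) ((X t).Ux χ)) (Icc 0 τ) t :=
  fun t ht => HasDerivWithinAt.clm_apply' E.hL (h t ht)

lemma SolvesOn.hasDeriv_c (h : SolvesOn (E.field χ) X τ) :
    ∀ t ∈ Icc 0 τ, HasDerivWithinAt (fun t => (X t).c) 0 (Icc 0 τ) t :=
  fun t ht => HasDerivWithinAt.clm_apply' E.cL (h t ht)

lemma SolvesOn.c_eq (h : SolvesOn (E.field χ) X τ) : ∀ t ∈ Icc 0 τ, (X t).c = (X 0).c := by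
  intro t ht
  have := (convex_Icc 0 τ).norm_image_sub_le_of_norm_hasDerivWithin_le (C := 0) h.hasDeriv_c
    (fun _ _ => by simp) ⟨le_rfl, ht.1.trans ht.2⟩ ht
  rw [zero_mul] at this
  exact sub_eq_zero.1 (norm_le_zero_iff.1 this)

lemma SolvesOn.zx (h : SolvesOn (E.field χ) X τ) :
    ∀ t ∈ Icc 0 τ, HasDerivWithinAt (fun t => (X t).zx) ((X t).Ux χ) (Icc 0 τ) t :=
  fun t ht => (HasDerivWithinAt.clm_apply' V.dL (h.zeta t ht)).congr_deriv (E.dL_UV χ _)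

lemma SolvesOn.Ux (h : SolvesOn (E.field χ) X τ) :
    ∀ t ∈ Icc 0 τ, HasDerivWithinAt (fun t => (X t).Ux χ) ((X t).mQx χ) (Icc 0 τ) t :=
  fun t ht => ((HasDerivWithinAt.clm_apply' H1.dL (h.ubar t ht)).add
    ((h.hasDeriv_c t ht).smul_const χ.dL)).congr_deriv (by rw [E.dL_mQ]; simp)

/-- The weight `e^{-|ξ|}` as a bounded continuous function. -/
def rhoB : BC := BoundedContinuousFunction.ofNormedAddCommGroup rho continuous_rho 1 fun x => by
  rw [Real.norm_of_nonneg (rho_pos x).le]; exact rho_le_one x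

lemma rhoB_apply (x : ℝ) : rhoB x = rho x := rfl

/-- y_ξ = 1 + ζ_ξ is not square integrable. Multiplication by the positive, time-independent weight
e^{-|ξ|} puts it into L² and commutes with the linear system, so nothing is lost. -/
lemma SolvesOn.linSys (h : SolvesOn (E.field χ) X τ) :
    LinSys (fun t => (X t).AB χ) τ (fun t => rhoL + mulL rhoB (X t).zx)
      (fun t => mulL rhoB ((X t).Ux χ)) (fun t => mulL rhoB (X t).h) where
  one t ht := (HasDerivWithinAt.clm_apply' (mulL rhoB) (h.zx t ht)).const_add rhoL
  two t ht := (HasDerivWithinAt.clm_apply' (mulL rhoB) (h.Ux t ht)).congr_deriv (by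
    have e1 : Rep (mulL rhoB ((X t).mQx χ)) _ := ((X t).rep_mQx χ).mulL rhoB
    have e2 : Rep (mulL ((X t).AB χ) (rhoL + mulL rhoB (X t).zx) +
        (1 / 2 : ℝ) • mulL rhoB (X t).h) _ :=
      ((Rep.add coeFn_rhoL ((Rep.refl _).mulL rhoB)).mulL _).add
        (((Rep.refl (X t).h).mulL rhoB).smul _)
    refine Lp.ext (e1.trans (EventuallyEq.trans (ae_of_all _ fun ξ => ?_) e2.symm))
    simp only [rhoB_apply]; ring)
  three t ht := (HasDerivWithinAt.clm_apply' (mulL rhoB) (h.h t ht)).congr_deriv (by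
    rw [map_smul, ← mulL_mul, ← mulL_mul, mul_comm])

end Field

set_option maxHeartbeats 1000000 in
/-- Along the flow, `(y_ξ, U_ξ, h)` stays in the light cone, and `y_ξ + h` grows or decays at most
exponentially. -/
theorem Cone.propagate {χ : PartitionFunction} {Z : ℝ → Aug} {τ K₀ K : ℝ} {X₀ : E}
    (hZ : SolvesOn (augField χ) Z τ) (h0 : Z 0 = augInit X₀) (hX₀ : Cone χ K₀ X₀) (hK0 : 0 ≤ K)
    (hK : ∀ t ∈ Icc 0 τ, ‖(Z t).1.AB χ‖ ≤ K) :
    ∀ t ∈ Icc 0 τ, Cone χ (K₀ * Real.exp ((K + 1 / 2) * t)) (Z t).1 := by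
  intro t ht
  have s1 := hZ.spin₁
  have s2 := hZ.spin₂
  set p₁ := fun t => (Z t).2.1.1 with hp₁
  set q₁ := fun t => (Z t).2.1.2 with hq₁
  set p₂ := fun t => (Z t).2.2.1 with hp₂
  set q₂ := fun t => (Z t).2.2.2 with hq₂
  have ep₁ : p₁ 0 = 1 := by simp [hp₁, h0, augInit]
  have eq₁ : q₁ 0 = 0 := by simp [hq₁, h0, augInit]
  have ep₂ : p₂ 0 = 0 := by simp [hp₂, h0, augInit]
  have eq₂ : q₂ 0 = 1 := by simp [hq₂, h0, augInit]
  have eX : (Z 0).1 = X₀ := by rw [h0]; rfl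
  have one_mulL : ∀ v : L2, mulL 1 v = v := fun v => Lp.ext (by
    filter_upwards [coeFn_mulL 1 v] with x hx; rw [hx]; simp)
  set a₀ := rhoL + mulL rhoB X₀.zx
  set b₀ := mulL rhoB (X₀.Ux χ)
  set c₀ := mulL rhoB X₀.h
  -- The expansion of (p₁α₀ + p₂β₀)², of its product with q₁α₀ + q₂β₀, and of (q₁α₀ + q₂β₀)², with
  -- a₀, b₀, c₀ in place of α₀², α₀β₀, β₀². It depends only on L² data, and α₀, β₀ need not be
  -- chosen measurably in ξ.
  have W := ((s1.linSys s1 a₀).add ((s1.linSys s2 b₀).smul 2)).add (s2.linSys s2 c₀)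
  obtain ⟨e1, e2, e3⟩ := hZ.fst.linSys.eq W hK0 hK
    (by simp [ep₁, ep₂, eX, one_mulL, a₀]) (by
      simp only [eX, ep₁, ep₂, eq₁, eq₂, mul_zero, mul_one, add_zero, zero_add, smul_zero, map_zero,
        _root_.zero_apply]
      rw [map_smul, _root_.smul_apply, one_mulL, smul_smul]; norm_num; rfl)
    (by simp [eq₁, eq₂, eX, one_mulL, c₀]) t ht
  have ra : Rep a₀ fun ξ => rho ξ * (1 + X₀.zx ξ) :=
    (Rep.add coeFn_rhoL ((Rep.refl _).mulL rhoB)).congr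
      (ae_of_all _ fun ξ => by simp only [rhoB_apply]; ring)
  have rb : Rep b₀ fun ξ => rho ξ * X₀.Ux χ ξ := (Rep.refl _).mulL rhoB
  have rc : Rep c₀ fun ξ => rho ξ * X₀.h ξ := (Rep.refl _).mulL rhoB
  have l1 : Rep (rhoL + mulL rhoB (Z t).1.zx) fun ξ => rho ξ * (1 + (Z t).1.zx ξ) :=
    (Rep.add coeFn_rhoL ((Rep.refl _).mulL rhoB)).congr
      (ae_of_all _ fun ξ => by simp only [rhoB_apply]; ring)
  have l2 : Rep (mulL rhoB ((Z t).1.Ux χ)) fun ξ => rho ξ * (Z t).1.Ux χ ξ :=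
    (Rep.refl _).mulL rhoB
  have l3 : Rep (mulL rhoB (Z t).1.h) fun ξ => rho ξ * (Z t).1.h ξ := (Rep.refl _).mulL rhoB
  have w1 := ((ra.mulL (p₁ t * p₁ t)).add ((rb.mulL (p₁ t * p₂ t)).smul 2)).add
    (rc.mulL (p₂ t * p₂ t))
  have w2 := ((ra.mulL ((1 / 2 : ℝ) • (p₁ t * q₁ t + q₁ t * p₁ t))).add
    ((rb.mulL ((1 / 2 : ℝ) • (p₁ t * q₂ t + q₁ t * p₂ t))).smul 2)).add
    (rc.mulL ((1 / 2 : ℝ) • (p₂ t * q₂ t + q₂ t * p₂ t)))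
  have w3 := ((ra.mulL (q₁ t * q₁ t)).add ((rb.mulL (q₁ t * q₂ t)).smul 2)).add
    (rc.mulL (q₂ t * q₂ t))
  rw [← e1] at w1
  rw [← e2] at w2
  rw [← e3] at w3
  filter_upwards [hX₀, l1.symm.trans w1, l2.symm.trans w2, l3.symm.trans w3] with ξ hξ f1 f2 f3
  obtain ⟨⟨hy, hh, he⟩, hlo, hhi⟩ := hξ
  -- From here on ξ is fixed: the time-dependent coefficients are continuous functions of ξ, so they
  -- can be evaluated at ξ for all times at once.
  obtain ⟨α₀, β₀, hα, hαβ, hβ⟩ := exists_spinor hy hh he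
  simp only [BoundedContinuousFunction.mul_apply, BoundedContinuousFunction.coe_smul,
    BoundedContinuousFunction.coe_add, Pi.add_apply, smul_eq_mul, hα, hαβ, hβ] at f1 f2 f3
  set α : ℝ → ℝ := fun t => p₁ t ξ * α₀ + p₂ t ξ * β₀ with hαdef
  set β : ℝ → ℝ := fun t => q₁ t ξ * α₀ + q₂ t ξ * β₀ with hβdef
  have hρ := (rho_pos ξ).ne'
  have g1 : 1 + (Z t).1.zx ξ = α t ^ 2 := by
    refine mul_left_cancel₀ hρ (f1.trans ?_)
    simp only [hαdef]; ring
  have g2 : (Z t).1.Ux χ ξ = α t * β t := by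
    refine mul_left_cancel₀ hρ (f2.trans ?_)
    simp only [hαdef, hβdef]; ring
  have g3 : (Z t).1.h ξ = β t ^ 2 := by
    refine mul_left_cancel₀ hρ (f3.trans ?_)
    simp only [hβdef]; ring
  have dα : ∀ t ∈ Icc 0 τ, HasDerivWithinAt α (1 / 2 * β t) (Icc 0 τ) t := fun t ht =>
    ((((HasDerivWithinAt.clm_apply' (evalBC ξ) (s1.one t ht)).mul_const α₀).add
      ((HasDerivWithinAt.clm_apply' (evalBC ξ) (s2.one t ht)).mul_const β₀))).congr_deriv (by
        simp only [evalBC_apply, BoundedContinuousFunction.coe_smul, smul_eq_mul, hβdef]; ring)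
  have dβ : ∀ t ∈ Icc 0 τ, HasDerivWithinAt β ((Z t).1.AB χ ξ * α t) (Icc 0 τ) t := fun t ht =>
    ((((HasDerivWithinAt.clm_apply' (evalBC ξ) (s1.two t ht)).mul_const α₀).add
      ((HasDerivWithinAt.clm_apply' (evalBC ξ) (s2.two t ht)).mul_const β₀))).congr_deriv (by
        simp only [evalBC_apply, BoundedContinuousFunction.mul_apply, hαdef]; ring)
  have ds : ∀ t ∈ Icc 0 τ, HasDerivWithinAt (fun t => α t ^ 2 + β t ^ 2)
      (α t * β t * (1 + 2 * (Z t).1.AB χ ξ)) (Icc 0 τ) t := fun t ht =>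
    (((dα t ht).pow 2).add ((dβ t ht).pow 2)).congr_deriv (by simp; ring)
  -- (α² + β²)' = αβ (1 + 2A), and |αβ| ≤ ½(α² + β²) gives the rate K + ½.
  have key := exp_bounds_of_deriv (C := K + 1 / 2) ds (fun t ht => by
    have hA : |(Z t).1.AB χ ξ| ≤ K := (((Z t).1.AB χ).norm_coe_le_norm ξ).trans (hK t ht)
    have h1 : |1 + 2 * (Z t).1.AB χ ξ| ≤ 1 + 2 * K := by
      have := abs_le.1 hA
      exact abs_le.2 ⟨by linarith, by linarith⟩
    have h2 : |α t * β t| ≤ (α t ^ 2 + β t ^ 2) / 2 :=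
      abs_le.2 ⟨by nlinarith [sq_nonneg (α t + β t)], by nlinarith [sq_nonneg (α t - β t)]⟩
    rw [abs_mul]
    calc |α t * β t| * |1 + 2 * (Z t).1.AB χ ξ| ≤ (α t ^ 2 + β t ^ 2) / 2 * (1 + 2 * K) := by gcongr
      _ = _ := by ring) t ht
  have hs0 : α 0 ^ 2 + β 0 ^ 2 = 1 + X₀.zx ξ + X₀.h ξ := by
    rw [hα, hβ]; simp [hαdef, hβdef, ep₁, ep₂, eq₁, eq₂]
  rw [hs0] at key
  rw [g1, g2, g3]
  refine ⟨⟨sq_nonneg _, sq_nonneg _, by ring⟩, ?_, ?_⟩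
  · rw [mul_inv, ← Real.exp_neg]
    exact (mul_le_mul_of_nonneg_right hlo (Real.exp_pos _).le).trans key.1
  · exact key.2.trans (mul_le_mul_of_nonneg_right hhi (Real.exp_pos _).le)

/-! ### The energy -/

namespace E

variable {χ : PartitionFunction} {X : E} {K : ℝ}

/-- `ū` as a bounded continuous function. -/
def ubB (X : E) : BC := H1.toBC X.ubar

/-- `ū` as an element of `L²`. -/
def ubL (X : E) : L2 := H1.toL2 X.ubar

@[simp] lemma ubB_apply (X : E) (ξ : ℝ) : X.ubB ξ = X.ubar ξ := rfl

lemma rep_ubL (X : E) : Rep X.ubL X.ubar := H1.coeFn_toL2 _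

/-- The energy `∫ ū² y_ξ + h`. -/
def energy (X : E) : ℝ := ∫ ξ, (X.ubar ξ ^ 2 * (1 + X.zx ξ) + X.h ξ)

/-- The rate of change of the energy. -/
def rate (χ : PartitionFunction) (X : E) : ℝ :=
  ∫ ξ, (-2 * (X.ubar ξ * (X.QB χ ξ * (1 + X.zx ξ))) + X.ubar ξ ^ 2 * X.Ux χ ξ
    + 2 * (X.AB χ ξ * X.Ux χ ξ))

/-- `P`. -/
def Pf (χ : PartitionFunction) (X : E) (ξ : ℝ) : ℝ := X.pB χ ξ + X.c ^ 2 * gFun χ (X.y ξ)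

/-- h ≤ K h (y_ξ + h) = K (U_ξ² + h²). This is why h, a priori only in L², is integrable on a cone.
-/
lemma ae_le_of_cone (hK : 0 < K) (h : Cone χ K X) :
    ∀ᵐ ξ : ℝ, |X.h ξ| ≤ K * (X.Ux χ ξ ^ 2 + X.h ξ ^ 2) := by
  filter_upwards [h] with ξ ⟨⟨h1, h2, h3⟩, h4, _⟩
  have h5 := mul_le_mul_of_nonneg_left h4 (mul_nonneg hK.le h2)
  have h6 : K * X.h ξ * K⁻¹ = X.h ξ := by field_simp
  rw [h6] at h5
  rw [abs_of_nonneg h2, ← h3]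
  linarith

lemma integrable_Ux_sq_add (χ : PartitionFunction) (X : E) :
    Integrable fun ξ => X.Ux χ ξ ^ 2 + X.h ξ ^ 2 :=
  (Lp.memLp (X.Ux χ)).integrable_sq.add (Lp.memLp X.h).integrable_sq

lemma integrable_h (hK : 0 < K) (h : Cone χ K X) : Integrable X.h :=
  ((integrable_Ux_sq_add χ X).const_mul K).mono' (Lp.memLp X.h).1 (ae_le_of_cone hK h)

lemma integral_h_le (hK : 0 < K) (h : Cone χ K X) :
    ∫ ξ, X.h ξ ≤ K * (‖X.Ux χ‖ ^ 2 + ‖X.h‖ ^ 2) := by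
  rw [L2.norm_sq, L2.norm_sq, ← integral_add (Lp.memLp (X.Ux χ)).integrable_sq
    (Lp.memLp X.h).integrable_sq, ← integral_const_mul]
  refine integral_mono_ae (integrable_h hK h) ((integrable_Ux_sq_add χ X).const_mul K) ?_
  filter_upwards [ae_le_of_cone hK h] with ξ h1 using (le_abs_self _).trans h1

lemma integrable_ubar_sq (X : E) : Integrable fun ξ => X.ubar ξ ^ 2 :=
  X.ubar.memSob.memLp.integrable_sq

lemma integrable_ubar_sq_mul (X : E) (v : L2) : Integrable fun ξ => X.ubar ξ ^ 2 * v ξ := by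
  refine (L2.integrable_mul (mulL X.ubB X.ubL) v).congr ?_
  filter_upwards [X.rep_ubL.mulL X.ubB] with ξ h1
  rw [h1, ubB_apply, sq]

lemma integrable_ubar_sq_y (X : E) : Integrable fun ξ => X.ubar ξ ^ 2 * (1 + X.zx ξ) := by
  refine (X.integrable_ubar_sq.add (X.integrable_ubar_sq_mul X.zx)).congr (ae_of_all _ fun ξ => ?_)
  simp only [Pi.add_apply]; ring

lemma integrable_energy (hK : 0 < K) (h : Cone χ K X) :
    Integrable fun ξ => X.ubar ξ ^ 2 * (1 + X.zx ξ) + X.h ξ :=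
  X.integrable_ubar_sq_y.add (integrable_h hK h)

lemma energy_nonneg (h : Cone χ K X) : 0 ≤ X.energy := by
  refine integral_nonneg_of_ae ?_
  filter_upwards [h] with ξ ⟨⟨h1, h2, _⟩, _⟩
  exact add_nonneg (mul_nonneg (sq_nonneg _) h1) h2

lemma energy_le (hK : 0 < K) (h : Cone χ K X) :
    X.energy ≤ K * ‖X.ubL‖ ^ 2 + K * (‖X.Ux χ‖ ^ 2 + ‖X.h‖ ^ 2) := by
  rw [energy, integral_add X.integrable_ubar_sq_y (integrable_h hK h)]
  refine add_le_add ?_ (integral_h_le hK h)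
  have e : ‖X.ubL‖ ^ 2 = ∫ ξ, X.ubar ξ ^ 2 := by
    rw [L2.norm_sq]
    refine integral_congr_ae ?_
    filter_upwards [X.rep_ubL] with ξ h1; rw [h1]
  rw [e, ← integral_const_mul]
  refine integral_mono_ae X.integrable_ubar_sq_y (X.integrable_ubar_sq.const_mul K) ?_
  filter_upwards [h] with ξ ⟨⟨h1, h2, _⟩, _, h3⟩
  rw [mul_comm]
  exact mul_le_mul_of_nonneg_right (by linarith) (sq_nonneg _)

lemma _root_.CamassaHolm.PartitionFunction.tendsto_atTop (χ : PartitionFunction) :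
    Tendsto χ atTop (𝓝 1) :=
  tendsto_const_nhds.congr' (by filter_upwards [eventually_ge_atTop 1] with x hx
                                rw [χ.eq_one x hx])

lemma _root_.CamassaHolm.PartitionFunction.tendsto_atBot (χ : PartitionFunction) :
    Tendsto χ atBot (𝓝 0) :=
  tendsto_const_nhds.congr' (by filter_upwards [eventually_le_atBot 0] with x hx
                                rw [χ.eq_zero x hx])

lemma _root_.CamassaHolm.PartitionFunction.integrable_deriv (χ : PartitionFunction) :
    Integrable (deriv χ) :=
  χ.contDiff_deriv.continuous.integrable_of_hasCompactSupport
    (HasCompactSupport.intro isCompact_Icc fun _ hx => χ.deriv_eq_zero hx)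

lemma _root_.CamassaHolm.PartitionFunction.integral_deriv (χ : PartitionFunction) :
    ∫ x, deriv χ x = 1 := by
  rw [χ.locAC.integral_eq_of_tendsto χ.integrable_deriv χ.tendsto_atBot χ.tendsto_atTop, sub_zero]

/-- Integration against the probability density `χ'`. -/
lemma _root_.CamassaHolm.PartitionFunction.abs_integral_mul_deriv_le (χ : PartitionFunction)
    {f : ℝ → ℝ} {C : ℝ} (hf : ∀ x, |f x| ≤ C) : |∫ x, f x * deriv χ x| ≤ C := by
  have h := norm_integral_le_of_norm_le (f := fun x => f x * deriv χ x)
    (χ.integrable_deriv.const_mul C) (ae_of_all _ fun x => by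
      rw [norm_mul, Real.norm_eq_abs, Real.norm_of_nonneg (χ.deriv_nonneg x)]
      exact mul_le_mul_of_nonneg_right (hf x) (χ.deriv_nonneg x))
  rwa [integral_const_mul, χ.integral_deriv, mul_one] at h

/-- The energy controls `ū` uniformly. -/
lemma ubar_sq_le (hK : 0 < K) (h : Cone χ K X) (ξ : ℝ) :
    X.ubar ξ ^ 2 ≤ 2 * X.energy + 4 * X.c ^ 2 := by
  set M := ‖X.ubB‖
  have hM : ∀ x, |X.ubar x| ≤ M := X.ubB.norm_coe_le_norm
  have hM0 : 0 ≤ M := norm_nonneg _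
  have h1 : ∀ x, X.ubar x ^ 2 ≤ X.energy + 2 * |X.c| * M := by
    intro x
    refine (X.ubar.memSob.sq_le x).trans ?_
    have e1 : X.energy + 2 * |X.c| * M = ∫ ξ, (X.ubar ξ ^ 2 * (1 + X.zx ξ) + X.h ξ) +
        2 * |X.c| * M * deriv χ ξ := by
      rw [integral_add (integrable_energy hK h) (χ.integrable_deriv.const_mul _),
        integral_const_mul, χ.integral_deriv, mul_one, energy]
    rw [e1, ← integral_const_mul]
    refine integral_mono_ae (X.ubar.memSob.integrable_mul_deriv.abs.const_mul 2)
      ((integrable_energy hK h).add (χ.integrable_deriv.const_mul _)) ?_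
    filter_upwards [h, X.rep_Ux' χ] with ξ ⟨⟨h2, h3, h4⟩, _⟩ h5
    have e2 : deriv X.ubar ξ = X.Ux χ ξ - X.c * deriv χ ξ := by rw [h5]; ring
    -- The energy density is the sum of ū² y_ξ and h, whose product is (ū U_ξ)²; this is the
    -- inequality of arithmetic and geometric means.
    have h6 : |X.ubar ξ * X.Ux χ ξ| ≤ (X.ubar ξ ^ 2 * (1 + X.zx ξ) + X.h ξ) / 2 := by
      refine abs_le_of_sq_le_sq ?_ (by positivity)
      rw [mul_pow, ← h4]
      nlinarith [sq_nonneg (X.ubar ξ ^ 2 * (1 + X.zx ξ) - X.h ξ)]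
    have h7 : |X.ubar ξ * (X.c * deriv χ ξ)| ≤ |X.c| * M * deriv χ ξ := by
      rw [abs_mul, abs_mul, abs_of_nonneg (χ.deriv_nonneg ξ)]
      have := mul_le_mul_of_nonneg_right (hM ξ)
        (mul_nonneg (abs_nonneg X.c) (χ.deriv_nonneg ξ))
      linarith
    have h8 : |X.ubar ξ * deriv X.ubar ξ| ≤ |X.ubar ξ * X.Ux χ ξ| +
        |X.ubar ξ * (X.c * deriv χ ξ)| := by
      rw [e2, mul_sub]; exact abs_sub _ _
    linarith
  -- Taking the supremum gives M² ≤ E + 2|c| M, in which the last term is absorbed by ½ M² + 2c²;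
  -- hence the constants 2 and 4.
  have hMsq : M ^ 2 ≤ X.energy + 2 * |X.c| * M := by
    have hnn : 0 ≤ X.energy + 2 * |X.c| * M := (sq_nonneg _).trans (h1 0)
    have : M ≤ √(X.energy + 2 * |X.c| * M) :=
      (BoundedContinuousFunction.norm_le (Real.sqrt_nonneg _)).2 fun x =>
        Real.abs_le_sqrt (h1 x)
    calc M ^ 2 ≤ √(X.energy + 2 * |X.c| * M) ^ 2 := by gcongr
      _ = _ := Real.sq_sqrt hnn
  have h2 : X.ubar ξ ^ 2 ≤ M ^ 2 := sq_le_sq' (by linarith [abs_le.1 (hM ξ)])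
    ((le_abs_self _).trans (hM ξ))
  nlinarith [sq_nonneg (M - 2 * |X.c|), sq_abs X.c]

/-- With z = y(η) the integral becomes at most ∫ e^{-|y(ξ)-z|} dz = 2. Explicit primitives on either
side of ξ replace the substitution, as y may be constant on intervals; each side contributes at most
1. -/
lemma kernel_mass (hy : ∀ᵐ ξ : ℝ, 0 ≤ 1 + X.zx ξ) (ξ : ℝ) :
    Integrable (fun η => Real.exp (-|X.y ξ - X.y η|) * (1 + X.zx η)) ∧
    ∫ η, Real.exp (-|X.y ξ - X.y η|) * (1 + X.zx η) ≤ 2 := by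
  have hm : Monotone X.y := X.monotone_y_of_deriv_nonneg (by
    filter_upwards [hy, X.ae_deriv_y] with ξ h1 h2; rwa [h2])
  set f : ℝ → ℝ := fun η => Real.exp (-|X.y ξ - X.y η|) * (1 + X.zx η)
  have hf0 : ∀ᵐ η : ℝ, 0 ≤ f η := by
    filter_upwards [hy] with η h using mul_nonneg (Real.exp_pos _).le h
  have l1 : LocAC fun η => Real.exp (X.y η - X.y ξ) :=
    LocAC.comp_left Real.contDiff_exp (X.locAC_y.sub (LocAC.const _))
  have l2 : LocAC fun η => -Real.exp (X.y ξ - X.y η) :=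
    (LocAC.comp_left Real.contDiff_exp ((LocAC.const _).sub X.locAC_y)).neg
  have d1 : ∀ᵐ η : ℝ, η ≤ ξ → deriv (fun η => Real.exp (X.y η - X.y ξ)) η = f η := by
    filter_upwards [X.ae_hasDerivAt_y] with η h hη
    rw [((h.sub_const (X.y ξ)).exp).deriv]
    simp only [f]
    rw [abs_of_nonneg (sub_nonneg.2 (hm hη)), neg_sub]
  have d2 : ∀ᵐ η : ℝ, ξ ≤ η → deriv (fun η => -Real.exp (X.y ξ - X.y η)) η = f η := by
    filter_upwards [X.ae_hasDerivAt_y] with η h hη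
    rw [((h.const_sub (X.y ξ)).exp).fun_neg.deriv]
    simp only [f]
    rw [abs_of_nonpos (sub_nonpos.2 (hm hη)), neg_neg]; ring
  have i1 : ∀ a ≤ ξ, IntervalIntegrable f volume a ξ ∧ ∫ η in a..ξ, f η ≤ 1 := by
    intro a ha
    have e : ∀ᵐ η : ℝ, η ∈ uIoc a ξ → deriv (fun η => Real.exp (X.y η - X.y ξ)) η = f η := by
      filter_upwards [d1] with η h hη
      rw [uIoc_of_le ha] at hη; exact h hη.2
    refine ⟨(l1.intervalIntegrable_deriv a ξ).congr_ae ((ae_restrict_iff' measurableSet_uIoc).2 e), ?_⟩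
    rw [← intervalIntegral.integral_congr_ae e, l1.integral_deriv, sub_self, Real.exp_zero]
    linarith [Real.exp_pos (X.y a - X.y ξ)]
  have i2 : ∀ b ≥ ξ, IntervalIntegrable f volume ξ b ∧ ∫ η in ξ..b, f η ≤ 1 := by
    intro b hb
    have e : ∀ᵐ η : ℝ, η ∈ uIoc ξ b → deriv (fun η => -Real.exp (X.y ξ - X.y η)) η = f η := by
      filter_upwards [d2] with η h hη
      rw [uIoc_of_le hb] at hη; exact h hη.1.le
    refine ⟨(l2.intervalIntegrable_deriv ξ b).congr_ae ((ae_restrict_iff' measurableSet_uIoc).2 e), ?_⟩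
    rw [← intervalIntegral.integral_congr_ae e, l2.integral_deriv, sub_self, Real.exp_zero]
    linarith [Real.exp_pos (X.y ξ - X.y b)]
  have ta : Tendsto (fun n : ℕ => ξ - n) atTop atBot :=
    tendsto_atBot_add_const_left _ ξ (tendsto_neg_atTop_atBot.comp tendsto_natCast_atTop_atTop)
  have tb : Tendsto (fun n : ℕ => ξ + n) atTop atTop :=
    tendsto_atTop_add_const_left _ ξ tendsto_natCast_atTop_atTop
  have ii : ∀ n : ℕ, IntervalIntegrable f volume (ξ - n) (ξ + n) := fun n =>
    (i1 _ (by simp)).1.trans (i2 _ (by simp)).1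
  have hle : ∀ n : ℕ, ∫ η in (ξ - n)..(ξ + n), f η ≤ 2 := fun n => by
    rw [← intervalIntegral.integral_add_adjacent_intervals (i1 _ (by simp)).1 (i2 _ (by simp)).1]
    linarith [(i1 (ξ - n) (by simp)).2, (i2 (ξ + n) (by simp)).2]
  have hint : Integrable f := by
    refine integrable_of_intervalIntegral_norm_bounded 2
      (fun n : ℕ => ((intervalIntegrable_iff_integrableOn_Ioc_of_le ?_).1 (ii n))) ta tb
      (Eventually.of_forall fun n => ?_)
    · have : (0 : ℝ) ≤ n := by positivity
      linarith
    · refine le_trans (le_of_eq ?_) (hle n)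
      refine intervalIntegral.integral_congr_ae ?_
      filter_upwards [hf0] with η h _
      exact Real.norm_of_nonneg h
  exact ⟨hint, le_of_tendsto (intervalIntegral_tendsto_integral hint ta tb)
    (Eventually.of_forall hle)⟩

/-- The expression is the difference of squares 2(U² - c² χ²∘y), with 0 ≤ χ ≤ 1. -/
lemma abs_eB_le (χ : PartitionFunction) (X : E) (ξ : ℝ) :
    |X.eB χ ξ| ≤ 6 * X.ubar ξ ^ 2 + 10 * X.c ^ 2 := by
  obtain ⟨a0, a1⟩ := χ.mem_Icc ξ
  obtain ⟨b0, b1⟩ := χ.mem_Icc (X.y ξ)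
  have e : X.eB χ ξ = 2 * ((X.ubar ξ + X.c * χ ξ) ^ 2 - (X.c * χ (X.y ξ)) ^ 2) := by
    rw [eB_apply, Ubar, U]; ring
  have q1 : (X.c * χ ξ) ^ 2 ≤ X.c ^ 2 := by
    rw [mul_pow]; exact mul_le_of_le_one_right (sq_nonneg _) (by nlinarith)
  have q2 : (X.c * χ (X.y ξ)) ^ 2 ≤ X.c ^ 2 := by
    rw [mul_pow]; exact mul_le_of_le_one_right (sq_nonneg _) (by nlinarith)
  rw [e]
  refine abs_le.2 ⟨?_, ?_⟩
  · nlinarith [sq_nonneg (X.ubar ξ + X.c * χ ξ), sq_nonneg (X.ubar ξ), sq_nonneg X.c]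
  · nlinarith [sq_nonneg (X.ubar ξ - X.c * χ ξ), sq_nonneg (X.c * χ (X.y ξ)),
      sq_nonneg (X.ubar ξ), sq_nonneg X.c]

/-- The energy controls the nonlocal part of `P` uniformly. -/
lemma abs_pB_le (hK : 0 < K) (h : Cone χ K X) (ξ : ℝ) :
    |X.pB χ ξ| ≤ 3 / 2 * X.energy + 5 * X.c ^ 2 := by
  have e : X.pB χ ξ = 1 / 4 * ∫ η, Real.exp (-|X.y ξ - X.y η|) * X.density χ η := by
    have h1 := P_eq χ h.monotone_y ξ
    rw [P] at h1; linarith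
  have km := kernel_mass (X := X) (by filter_upwards [h] with η h1 using h1.1.1) ξ
  have key : |∫ η, Real.exp (-|X.y ξ - X.y η|) * X.density χ η| ≤
      ∫ η, (6 * (X.ubar η ^ 2 * (1 + X.zx η) + X.h η) +
        10 * X.c ^ 2 * (Real.exp (-|X.y ξ - X.y η|) * (1 + X.zx η))) := by
    rw [← Real.norm_eq_abs]
    refine norm_integral_le_of_norm_le (((integrable_energy hK h).const_mul 6).add
      (km.1.const_mul _)) ?_
    filter_upwards [h, X.rep_dens χ, X.rep_dens' χ] with η ⟨⟨h1, h2, _⟩, _⟩ h3 h4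
    rw [← h3, h4, norm_mul, Real.norm_of_nonneg (Real.exp_pos _).le, Real.norm_eq_abs]
    have he : Real.exp (-|X.y ξ - X.y η|) ≤ 1 :=
      Real.exp_le_one_iff.2 (neg_nonpos.2 (abs_nonneg _))
    have h5 : |X.eB χ η * (1 + X.zx η) + X.h η| ≤
        (6 * (X.ubar η ^ 2 * (1 + X.zx η) + X.h η)) + 10 * X.c ^ 2 * (1 + X.zx η) := by
      refine (abs_add_le _ _).trans ?_
      rw [abs_mul, abs_of_nonneg h1, abs_of_nonneg h2]
      have := mul_le_mul_of_nonneg_right (abs_eB_le χ X η) h1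
      linarith
    -- On the energy part the kernel is merely bounded by 1. On the c² part, not integrable by
    -- itself, it is kept and contributes its mass 2, so the total is ¼(6E + 20c²).
    have h6 : 0 ≤ 6 * (X.ubar η ^ 2 * (1 + X.zx η) + X.h η) := by positivity
    have h7 := mul_le_of_le_one_left h6 he
    have h8 := mul_le_mul_of_nonneg_left h5 (Real.exp_pos (-|X.y ξ - X.y η|)).le
    linarith
  rw [integral_add ((integrable_energy hK h).const_mul 6) (km.1.const_mul _),
    integral_const_mul, integral_const_mul, ← energy] at key
  have h9 := mul_le_mul_of_nonneg_left km.2 (by positivity : 0 ≤ 10 * X.c ^ 2)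
  rw [e, abs_mul, abs_of_pos (by norm_num : (0 : ℝ) < 1 / 4)]
  linarith

lemma _root_.CamassaHolm.PartitionFunction.exists_gFun_le (χ : PartitionFunction) :
    ∃ G : ℝ, 0 ≤ G ∧ ∀ x, |gFun χ x| ≤ G := by
  obtain ⟨C, hC⟩ := χ.g2_decay
  refine ⟨1 + |C|, by positivity, fun x => ?_⟩
  rw [χ.gFun_eq]
  refine (abs_add_le _ _).trans (add_le_add ?_ ((hC x).trans ?_))
  · rw [abs_of_nonneg (sq_nonneg _)]
    obtain ⟨h0, h1⟩ := χ.mem_Icc x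
    nlinarith
  · calc C * rho x ≤ |C| * rho x := mul_le_mul_of_nonneg_right (le_abs_self _) (rho_pos x).le
      _ ≤ |C| := mul_le_of_le_one_right (abs_nonneg _) (rho_le_one x)

/-- A uniform bound for `g`. -/
def _root_.CamassaHolm.PartitionFunction.gMax (χ : PartitionFunction) : ℝ :=
  χ.exists_gFun_le.choose

lemma _root_.CamassaHolm.PartitionFunction.gMax_nonneg (χ : PartitionFunction) : 0 ≤ χ.gMax :=
  χ.exists_gFun_le.choose_spec.1

lemma _root_.CamassaHolm.PartitionFunction.abs_gFun_le (χ : PartitionFunction) (x : ℝ) :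
    |gFun χ x| ≤ χ.gMax := χ.exists_gFun_le.choose_spec.2 x

lemma abs_Pf_le (hK : 0 < K) (h : Cone χ K X) (ξ : ℝ) :
    |X.Pf χ ξ| ≤ 3 / 2 * X.energy + (5 + χ.gMax) * X.c ^ 2 := by
  refine (abs_add_le _ _).trans ?_
  have h1 := abs_pB_le hK h ξ
  have h2 := mul_le_mul_of_nonneg_left (χ.abs_gFun_le (X.y ξ)) (sq_nonneg X.c)
  rw [abs_mul, abs_of_nonneg (sq_nonneg X.c)]
  linarith

/-- U² ≤ 2ū² + 2c² ≤ 4E + 10c², to which the bound for P is added. The cone constant K does not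
enter the bound, which is what makes the later bootstrap possible. -/
lemma norm_AB_le (hK : 0 < K) (h : Cone χ K X) :
    ‖X.AB χ‖ ≤ 11 / 2 * X.energy + (15 + χ.gMax) * X.c ^ 2 := by
  have hE := energy_nonneg h
  have hG := χ.gMax_nonneg
  refine (BoundedContinuousFunction.norm_le (by positivity)).2 fun ξ => ?_
  rw [Real.norm_eq_abs, AB_eq]
  have h1 := abs_Pf_le hK h ξ
  have h2 := ubar_sq_le hK h ξ
  obtain ⟨a0, a1⟩ := χ.mem_Icc ξ
  have q1 : (X.c * χ ξ) ^ 2 ≤ X.c ^ 2 := by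
    rw [mul_pow]; exact mul_le_of_le_one_right (sq_nonneg _) (by nlinarith)
  have h3 : X.U χ ξ ^ 2 ≤ 2 * X.ubar ξ ^ 2 + 2 * X.c ^ 2 := by
    rw [U]; nlinarith [sq_nonneg (X.ubar ξ - X.c * χ ξ)]
  refine (abs_sub _ _).trans ?_
  rw [abs_of_nonneg (sq_nonneg _)]
  change X.U χ ξ ^ 2 + |X.Pf χ ξ| ≤ _
  linarith

/-! ### The balance law of the energy. -/

lemma integrable_rate (χ : PartitionFunction) (X : E) :
    Integrable fun ξ => -2 * (X.ubar ξ * (X.QB χ ξ * (1 + X.zx ξ))) + X.ubar ξ ^ 2 * X.Ux χ ξ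
      + 2 * (X.AB χ ξ * X.Ux χ ξ) := by
  refine (Integrable.add (Integrable.add (((L2.integrable_mul X.ubL (X.QL χ)).add
    (L2.integrable_mul (mulL X.ubB (X.QL χ)) X.zx)).const_mul (-2))
    (X.integrable_ubar_sq_mul (X.Ux χ)))
    ((L2.integrable_mul (X.AL χ) (X.Ux χ)).const_mul 2)).congr ?_
  filter_upwards [X.rep_ubL, X.rep_QL χ, X.rep_AL χ, (X.rep_QL χ).mulL X.ubB] with ξ h1 h2 h3 h4
  simp only [Pi.add_apply]
  rw [h4, h1, h2, h3, ubB_apply]; ring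

lemma locAC_Pf (χ : PartitionFunction) (X : E) : LocAC (X.Pf χ) :=
  (X.locAC_pB χ).add' ((LocAC.comp_left χ.contDiff_gFun X.locAC_y).const_mul _)

lemma exists_Pf_bound (χ : PartitionFunction) (X : E) : ∃ C, ∀ ξ, |X.Pf χ ξ| ≤ C := by
  refine ⟨‖X.pB χ‖ + X.c ^ 2 * χ.gMax, fun ξ => (abs_add_le _ _).trans
    (add_le_add ((X.pB χ).norm_coe_le_norm ξ) ?_)⟩
  rw [abs_mul, abs_of_nonneg (sq_nonneg X.c)]
  exact mul_le_mul_of_nonneg_left (χ.abs_gFun_le _) (sq_nonneg _)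

/-- The rate of change of the energy only sees the region where `χ' ≠ 0`. -/
lemma rate_eq (χ : PartitionFunction) (X : E) :
    X.rate χ = 2 / 3 * X.c ^ 3 + X.c * (∫ ξ, X.ubar ξ ^ 2 * deriv χ ξ)
      - 2 * X.c * ∫ ξ, X.Pf χ ξ * deriv χ ξ := by
  obtain ⟨C, hC⟩ := X.exists_Pf_bound χ
  have lu : LocAC X.ubar := X.ubar.memSob.locAC
  -- Since P_ξ = Q y_ξ and ū_ξ = U_ξ - cχ', the integrand of the rate is Φ_ξ plus terms with a
  -- factor χ'. The only boundary value is the limit ⅔c³ at +∞.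
  set Φ : ℝ → ℝ := fun ξ => -2 * (X.Pf χ ξ * X.ubar ξ) +
    (2 / 3 * X.U χ ξ ^ 3 + 1 / 3 * X.ubar ξ ^ 3) with hΦ
  have lΦ : LocAC Φ := (((X.locAC_Pf χ).mul lu).const_mul _).add'
    ((((X.locAC_U χ).pow 3).const_mul _).add' ((lu.pow 3).const_mul _))
  have i1 : Integrable fun ξ => X.ubar ξ ^ 2 * deriv χ ξ :=
    χ.integrable_deriv.bdd_mul (c := ‖X.ubB‖ ^ 2) (lu.continuous.pow 2).aestronglyMeasurable
      (ae_of_all _ fun ξ => by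
        rw [norm_pow]; exact pow_le_pow_left₀ (norm_nonneg _) (X.ubB.norm_coe_le_norm ξ) 2)
  have i2 : Integrable fun ξ => X.Pf χ ξ * deriv χ ξ :=
    χ.integrable_deriv.bdd_mul (c := C) (X.locAC_Pf χ).continuous.aestronglyMeasurable
      (ae_of_all _ hC)
  have dΦ : deriv Φ =ᵐ[volume] fun ξ => (-2 * (X.ubar ξ * (X.QB χ ξ * (1 + X.zx ξ)))
      + X.ubar ξ ^ 2 * X.Ux χ ξ + 2 * (X.AB χ ξ * X.Ux χ ξ)) - X.c * (X.ubar ξ ^ 2 * deriv χ ξ)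
      + 2 * X.c * (X.Pf χ ξ * deriv χ ξ) := by
    filter_upwards [X.ae_hasDerivAt_P χ, X.ae_hasDerivAt_U χ, lu.ae_differentiableAt,
      X.rep_Ux' χ] with ξ h1 h2 h3 h4
    have h5 := ((h1.mul h3.hasDerivAt).const_mul (-2)).add
      (((h2.fun_pow 3).const_mul (2 / 3)).add ((h3.hasDerivAt.fun_pow 3).const_mul (1 / 3)))
    refine h5.deriv.trans ?_
    have e : deriv X.ubar ξ = X.Ux χ ξ - X.c * deriv χ ξ := by rw [h4]; ring
    rw [AB_eq, Pf, e]
    push_cast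
    ring
  have iΦ : Integrable (deriv Φ) :=
    (((X.integrable_rate χ).sub (i1.const_mul X.c)).add (i2.const_mul (2 * X.c))).congr dΦ.symm
  have tP : ∀ l : Filter ℝ, Tendsto X.ubar l (𝓝 0) →
      Tendsto (fun ξ => X.Pf χ ξ * X.ubar ξ) l (𝓝 0) := fun l hl =>
    hl.zero_mul_isBoundedUnder_le ⟨C, eventually_map.2 (Eventually.of_forall hC)⟩
      |>.congr fun ξ => mul_comm _ _
  have t1 := X.ubar.memSob.tendsto_atTop
  have t0 := X.ubar.memSob.tendsto_atBot
  have hT : Tendsto Φ atTop (𝓝 (2 / 3 * X.c ^ 3)) := by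
    have hU : Tendsto (X.U χ) atTop (𝓝 X.c) := by
      have := t1.add (χ.tendsto_atTop.const_mul X.c)
      rwa [zero_add, mul_one] at this
    have := ((tP _ t1).const_mul (-2)).add (((hU.pow 3).const_mul (2 / 3)).add
      ((t1.pow 3).const_mul (1 / 3)))
    convert this using 2; ring
  have hB : Tendsto Φ atBot (𝓝 0) := by
    have hU : Tendsto (X.U χ) atBot (𝓝 0) := by
      have := t0.add (χ.tendsto_atBot.const_mul X.c)
      rwa [zero_add, mul_zero] at this
    have := ((tP _ t0).const_mul (-2)).add (((hU.pow 3).const_mul (2 / 3)).add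
      ((t0.pow 3).const_mul (1 / 3)))
    convert this using 2; ring
  have key := lΦ.integral_eq_of_tendsto iΦ hB hT
  have e1 := integral_add ((X.integrable_rate χ).sub (i1.const_mul X.c)) (i2.const_mul (2 * X.c))
  have e2 := integral_sub (X.integrable_rate χ) (i1.const_mul X.c)
  simp only [Pi.sub_apply] at e1
  rw [integral_congr_ae dΦ, e1, e2, integral_const_mul, integral_const_mul] at key
  rw [rate]
  linarith

/-- χ' is a probability density, so the sup bounds for ū² and P pass to the integrals: 5 = 2 +
2·(3/2), and ⅔ + 4 + 10 ≤ 15. The bound is linear in the energy, which therefore cannot blow up in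
finite time. -/
lemma abs_rate_le (hK : 0 < K) (h : Cone χ K X) :
    |X.rate χ| ≤ 5 * |X.c| * X.energy + (15 + 2 * χ.gMax) * |X.c| ^ 3 := by
  have h1 := χ.abs_integral_mul_deriv_le (f := fun ξ => X.ubar ξ ^ 2) fun ξ => by
    rw [abs_of_nonneg (sq_nonneg _)]; exact ubar_sq_le hK h ξ
  have h2 := χ.abs_integral_mul_deriv_le (abs_Pf_le hK h)
  have hc := abs_nonneg X.c
  rw [rate_eq]
  refine (abs_sub _ _).trans ((add_le_add_left (abs_add_le _ _) _).trans ?_)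
  rw [abs_mul, abs_mul, abs_mul, abs_mul, abs_pow, abs_two,
    abs_of_pos (by norm_num : (0 : ℝ) < 2 / 3)]
  have h3 := mul_le_mul_of_nonneg_left h1 hc
  have h4 := mul_le_mul_of_nonneg_left h2 hc
  have e : |X.c| ^ 3 = |X.c| * X.c ^ 2 := by rw [pow_succ', sq_abs]
  rw [e]
  have : 0 ≤ |X.c| * X.c ^ 2 := by positivity
  nlinarith

end E

/-! ### The energy along solutions -/

/-- The indicator function of `[-n, n]` as an element of `L²`. -/
def cutoff (n : ℕ) : L2 :=
  indicatorConstLp 2 (measurableSet_Icc (a := -(n : ℝ)) (b := n)) (by simp) 1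

lemma inner_cutoff (n : ℕ) (u : L2) : inner ℝ (cutoff n) u = ∫ x in Icc (-(n : ℝ)) n, u x :=
  L2.inner_indicatorConstLp_one _ _ _

lemma tendsto_inner_cutoff {u : L2} (hu : Integrable u) :
    Tendsto (fun n => inner ℝ (cutoff n) u) atTop (𝓝 (∫ x, u x)) := by
  have h := intervalIntegral_tendsto_integral hu
    (tendsto_neg_atTop_atBot.comp (tendsto_natCast_atTop_atTop (R := ℝ)))
    (tendsto_natCast_atTop_atTop (R := ℝ))
  refine h.congr fun n => ?_
  have hn : -(n : ℝ) ≤ n := by linarith [(Nat.cast_nonneg n : (0 : ℝ) ≤ n)]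
  rw [inner_cutoff, integral_Icc_eq_integral_Ioc, ← intervalIntegral.integral_of_le hn]
  rfl

lemma abs_inner_cutoff_le (n : ℕ) {u : L2} (hu : Integrable u) :
    |inner ℝ (cutoff n) u| ≤ ∫ x, |u x| := by
  rw [inner_cutoff]
  exact (abs_integral_le_integral_abs).trans
    (setIntegral_le_integral hu.abs (ae_of_all _ fun _ => abs_nonneg _))

lemma E.rep_AB_Ux (χ : PartitionFunction) (X : E) :
    Rep (mulL (X.AB χ) (X.Ux χ)) fun ξ => X.AL χ ξ * X.Ux χ ξ := by
  filter_upwards [(Rep.refl (X.Ux χ)).mulL (X.AB χ), X.rep_AL χ] with ξ h1 h2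
  rw [h1, h2]

lemma E.integrable_AB_Ux (χ : PartitionFunction) (X : E) :
    Integrable (mulL (X.AB χ) (X.Ux χ)) :=
  (L2.integrable_mul _ _).congr (X.rep_AB_Ux χ).symm

lemma E.integral_AB_Ux (χ : PartitionFunction) (X : E) :
    ∫ ξ, mulL (X.AB χ) (X.Ux χ) ξ = inner ℝ (X.AL χ) (X.Ux χ) := by
  rw [L2.inner_eq]; exact integral_congr_ae (X.rep_AB_Ux χ)

section Energy

variable {χ : PartitionFunction} {X : ℝ → E} {τ : ℝ}

/-- t ↦ h is differentiable only as a curve in L², where the integral over the line is not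
continuous. The identity is proved with cutoffs to [-n, n], and dominated convergence applies
because h_t is a product of two L² functions, hence bounded in L¹ uniformly in time. -/
lemma SolvesOn.integral_h (hX : SolvesOn (E.field χ) X τ)
    (hi : ∀ t ∈ Icc 0 τ, Integrable (X t).h) :
    ∀ t ∈ Icc 0 τ, ∫ ξ, (X t).h ξ = (∫ ξ, (X 0).h ξ) +
      ∫ s in 0..t, 2 * inner ℝ ((X s).AL χ) ((X s).Ux χ) := by
  intro t ht
  have hc := hX.continuousOn
  have hsub : Icc 0 t ⊆ Icc 0 τ := Icc_subset_Icc_right ht.2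
  have cA : ContinuousOn (fun s => (X s).AB χ) (Icc 0 τ) :=
    (E.lipB_AB χ).continuous.comp_continuousOn hc
  have cL : ContinuousOn (fun s => (X s).AL χ) (Icc 0 τ) :=
    (E.lipB_AL χ).continuous.comp_continuousOn hc
  have cU : ContinuousOn (fun s => (X s).Ux χ) (Icc 0 τ) :=
    (E.lipB_Ux χ).continuous.comp_continuousOn hc
  have cM : ContinuousOn (fun s => mulL ((X s).AB χ) ((X s).Ux χ)) (Icc 0 τ) :=
    (mulL.continuous.comp_continuousOn cA).clm_apply cU
  obtain ⟨C, hC⟩ := isCompact_Icc.exists_bound_of_continuousOn (cL.norm.mul cU.norm)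
  have h1 : ∀ n, ∫ s in 0..t, 2 * inner ℝ (cutoff n) (mulL ((X s).AB χ) ((X s).Ux χ)) =
      inner ℝ (cutoff n) (X t).h - inner ℝ (cutoff n) (X 0).h := fun n => by
    refine intervalIntegral.integral_eq_sub_of_hasDerivAt_of_le
      (f := fun s => inner ℝ (cutoff n) (X s).h) ht.1 ?_ (fun s hs => ?_) ?_
    · exact continuousOn_const.inner (E.hL.continuous.comp_continuousOn (hc.mono hsub))
    · have hs' : s ∈ Icc 0 τ := ⟨hs.1.le, hs.2.le.trans ht.2⟩
      have := HasDerivWithinAt.clm_apply' (innerSL ℝ (cutoff n)) (hX.h s hs')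
      have := this.hasDerivAt (Icc_mem_nhds hs.1 (hs.2.trans_le ht.2))
      refine this.congr_deriv ?_
      rw [innerSL_apply_apply, inner_smul_right]
    · refine ContinuousOn.intervalIntegrable ?_
      rw [uIcc_of_le ht.1]
      exact (continuousOn_const.inner (cM.mono hsub)).const_mul 2
  have h2 := (tendsto_inner_cutoff (hi t ht)).sub
    (tendsto_inner_cutoff (hi 0 ⟨le_rfl, ht.1.trans ht.2⟩))
  have h3 : Tendsto (fun n => ∫ s in 0..t, 2 * inner ℝ (cutoff n) (mulL ((X s).AB χ) ((X s).Ux χ)))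
      atTop (𝓝 (∫ s in 0..t, 2 * inner ℝ ((X s).AL χ) ((X s).Ux χ))) := by
    refine intervalIntegral.tendsto_integral_filter_of_dominated_convergence (fun _ => 2 * C)
      (Eventually.of_forall fun n => ?_) (Eventually.of_forall fun n => ae_of_all _ fun s hs => ?_)
      (by simp) (ae_of_all _ fun s hs => ?_)
    · refine ContinuousOn.aestronglyMeasurable ?_ measurableSet_uIoc
      rw [uIoc_of_le ht.1]
      exact ((continuousOn_const.inner (cM.mono hsub)).const_mul 2).mono Ioc_subset_Icc_self
    · rw [uIoc_of_le ht.1] at hs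
      have hs' : s ∈ Icc 0 τ := ⟨hs.1.le, hs.2.trans ht.2⟩
      rw [norm_mul, Real.norm_ofNat]
      refine mul_le_mul_of_nonneg_left ?_ zero_le_two
      refine (abs_inner_cutoff_le n ((X s).integrable_AB_Ux χ)).trans ?_
      have e : ∫ x, |mulL ((X s).AB χ) ((X s).Ux χ) x| = ∫ x, |(X s).AL χ x * (X s).Ux χ x| := by
        refine integral_congr_ae ?_
        filter_upwards [(X s).rep_AB_Ux χ] with x hx; rw [hx]
      rw [e]
      exact (L2.integral_mul_le _ _).trans ((le_abs_self _).trans (hC s hs'))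
    · have := tendsto_inner_cutoff ((X s).integrable_AB_Ux χ)
      rw [E.integral_AB_Ux] at this
      exact this.const_mul 2
  have := tendsto_nhds_unique (h2.congr fun n => (h1 n).symm) h3
  linarith

lemma SolvesOn.integral_h_deriv (hX : SolvesOn (E.field χ) X τ)
    (hi : ∀ t ∈ Icc 0 τ, Integrable (X t).h) :
    ∀ t ∈ Icc 0 τ, HasDerivWithinAt (fun t => ∫ ξ, (X t).h ξ)
      (2 * inner ℝ ((X t).AL χ) ((X t).Ux χ)) (Icc 0 τ) t := by
  intro t ht
  have hc := hX.continuousOn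
  have cβ : ContinuousOn (fun s => 2 * inner ℝ ((X s).AL χ) ((X s).Ux χ)) (Icc 0 τ) :=
    (((E.lipB_AL χ).continuous.comp_continuousOn hc).inner
      ((E.lipB_Ux χ).continuous.comp_continuousOn hc)).const_mul 2
  have : Fact (t ∈ Icc 0 τ) := ⟨ht⟩
  have hsub : Icc 0 t ⊆ Icc 0 τ := Icc_subset_Icc_right ht.2
  have h := intervalIntegral.integral_hasDerivWithinAt_right (a := 0) (b := t) (s := Icc 0 τ)
    (t := Icc 0 τ)
    (ContinuousOn.intervalIntegrable (by rw [uIcc_of_le ht.1]; exact cβ.mono hsub))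
    (cβ.stronglyMeasurableAtFilter_nhdsWithin measurableSet_Icc t) (cβ t ht)
  exact (h.const_add _).congr (fun s hs => hX.integral_h hi s hs) (hX.integral_h hi t ht)

lemma E.energy_eq {Y : E} (hi : Integrable Y.h) :
    Y.energy = inner ℝ Y.ubL Y.ubL + inner ℝ (mulL Y.ubB Y.ubL) Y.zx + ∫ ξ, Y.h ξ := by
  rw [E.energy, integral_add Y.integrable_ubar_sq_y hi, L2.inner_eq, L2.inner_eq,
    ← integral_add (L2.integrable_mul _ _) (L2.integrable_mul _ _)]
  congr 1
  refine integral_congr_ae ?_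
  filter_upwards [Y.rep_ubL, Y.rep_ubL.mulL Y.ubB] with ξ h1 h2
  rw [h2, h1, E.ubB_apply]; ring

/-- The part ∫ ū² y_ξ is a sum of inner products of differentiable curves in L² (`E.energy_eq`), and
∫ h is covered by `SolvesOn.integral_h_deriv`. -/
lemma SolvesOn.energy_deriv (hX : SolvesOn (E.field χ) X τ)
    (hi : ∀ t ∈ Icc 0 τ, Integrable (X t).h) :
    ∀ t ∈ Icc 0 τ, HasDerivWithinAt (fun t => (X t).energy) ((X t).rate χ) (Icc 0 τ) t := by
  intro t ht
  have d1 : HasDerivWithinAt (fun t => (X t).ubL) (-(X t).QL χ) (Icc 0 τ) t :=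
    (HasDerivWithinAt.clm_apply' H1.toL2 (hX.ubar t ht)).congr_deriv (E.toL2_mQ χ _)
  have d2 : HasDerivWithinAt (fun t => (X t).ubB) (H1.toBC ((X t).mQ χ)) (Icc 0 τ) t :=
    HasDerivWithinAt.clm_apply' H1.toBC (hX.ubar t ht)
  have d3 := (HasDerivWithinAt.clm_apply' mulL d2).clm_apply d1
  have d := ((d1.inner ℝ d1).add (d3.inner ℝ (hX.zx t ht))).add (hX.integral_h_deriv hi t ht)
  refine (d.congr (fun s hs => E.energy_eq (hi s hs)) (E.energy_eq (hi t ht))).congr_deriv ?_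
  set Y := X t
  have r1 : Rep (-Y.QL χ) fun ξ => -Y.QB χ ξ := by
    filter_upwards [Lp.coeFn_neg (Y.QL χ), Y.rep_QL χ] with ξ h1 h2
    rw [h1, Pi.neg_apply, h2]
  have r2 : Rep (mulL (H1.toBC (Y.mQ χ)) Y.ubL + mulL Y.ubB (-Y.QL χ)) _ :=
    (Y.rep_ubL.mulL _).add (r1.mulL _)
  have i1 := L2.integrable_mul Y.ubL (-Y.QL χ)
  have i1' := L2.integrable_mul (-Y.QL χ) Y.ubL
  have i2 := L2.integrable_mul (mulL Y.ubB Y.ubL) (Y.Ux χ)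
  have i3 := L2.integrable_mul (mulL (H1.toBC (Y.mQ χ)) Y.ubL + mulL Y.ubB (-Y.QL χ)) Y.zx
  have i4 := L2.integrable_mul (Y.AL χ) (Y.Ux χ)
  have e1 := integral_add (i1.add i1') (i2.add i3)
  have e2 := integral_add ((i1.add i1').add (i2.add i3)) (i4.const_mul 2)
  simp only [Pi.add_apply] at e1 e2
  rw [L2.inner_eq, L2.inner_eq, L2.inner_eq, L2.inner_eq, L2.inner_eq, ← integral_const_mul,
    ← integral_add i1 i1', ← integral_add i2 i3, ← e1, ← e2, E.rate]
  refine integral_congr_ae ?_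
  filter_upwards [Y.rep_ubL, Y.rep_ubL.mulL Y.ubB, r1, r2, Y.rep_AL χ] with ξ h1 h2 h3 h4 h5
  rw [h4, h3, h2, h1, h5, E.ubB_apply]
  have : H1.toBC (Y.mQ χ) ξ = -Y.QB χ ξ := rfl
  rw [this]; ring

end Energy

/-! ### A priori bounds -/

/-- `Z` solves the augmented system on `[0, τ] ⊆ [0, T]`, starting from `X₀` in the cone with
constant `K₀` and in the ball with radius `B`. -/
structure AugSol (χ : PartitionFunction) (T B K₀ τ : ℝ) (Z : ℝ → Aug) (X₀ : E) : Prop where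
  le : τ ≤ T
  solves : SolvesOn (augField χ) Z τ
  init : Z 0 = augInit X₀
  norm_le : ‖X₀‖ ≤ B
  cone : Cone χ K₀ X₀

section APriori

variable {χ : PartitionFunction} {T B K₀ τ : ℝ} {Z : ℝ → Aug} {X₀ : E}

lemma AugSol.init_fst (h : AugSol χ T B K₀ τ Z X₀) : (Z 0).1 = X₀ := by rw [h.init]; rfl

lemma AugSol.abs_c_le (h : AugSol χ T B K₀ τ Z X₀) {t : ℝ} (ht : t ∈ Icc 0 τ) :
    |(Z t).1.c| ≤ B := by
  rw [h.solves.fst.c_eq t ht, h.init_fst]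
  refine le_trans ?_ h.norm_le
  rw [E.norm_def]
  have : 0 ≤ ‖X₀.zeta‖ + ‖X₀.ubar‖ + ‖X₀.h‖ := by positivity
  linarith

/-- A merely qualitative statement, with K depending on the solution through the maximum of ‖A‖ on
the compact time interval. It makes h integrable and the energy estimates applicable, and their
conclusions no longer contain K. -/
lemma AugSol.exists_cone (h : AugSol χ T B K₀ τ Z X₀) (hK : 0 < K₀) :
    ∃ K, 0 < K ∧ ∀ t ∈ Icc 0 τ, Cone χ K (Z t).1 := by
  obtain ⟨A, hA⟩ := isCompact_Icc.exists_bound_of_continuousOn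
    ((E.lipB_AB χ).continuous.comp_continuousOn h.solves.fst.continuousOn)
  have hA0 : 0 ≤ max A 0 := le_max_right _ _
  refine ⟨K₀ * Real.exp ((max A 0 + 1 / 2) * τ), by positivity, fun t ht => ?_⟩
  refine (Cone.propagate h.solves h.init h.cone hA0
    (fun t ht => (hA t ht).trans (le_max_left _ _)) t ht).mono (by positivity) ?_
  gcongr
  exact ht.2

lemma E.norm_ubL_le (X : E) : ‖X.ubL‖ ≤ ‖X.ubar‖ := by
  rw [H1.norm_eq]
  exact Real.le_sqrt_of_sq_le (le_add_of_nonneg_right (sq_nonneg _))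

lemma E.norm_Ux_le (X : E) : ‖X.Ux χ‖ ≤ (1 + ‖χ.dL‖) * ‖X‖ := by
  have h1 : ‖H1.dL X.ubar‖ ≤ ‖X.ubar‖ := by
    rw [H1.norm_eq]
    exact Real.le_sqrt_of_sq_le (le_add_of_nonneg_left (sq_nonneg _))
  have h2 := X.norm_def
  have h3 : 0 ≤ ‖X.zeta‖ + ‖X.h‖ := by positivity
  have h4 : ‖X.Ux χ‖ ≤ ‖H1.dL X.ubar‖ + |X.c| * ‖χ.dL‖ :=
    (norm_add_le _ _).trans (by rw [norm_smul, Real.norm_eq_abs])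
  have h5 : |X.c| * ‖χ.dL‖ ≤ ‖X‖ * ‖χ.dL‖ :=
    mul_le_mul_of_nonneg_right (by linarith [norm_nonneg X.ubar]) (norm_nonneg _)
  linarith [abs_nonneg X.c]

variable (χ T B K₀) in
-- Grönwall for the energy. The bound depends on T, B, K₀ and χ only; the cone constant of the
-- individual solution drops out.
lemma exists_energy_bound (hK : 0 < K₀) : ∃ C, ∀ τ Z X₀, AugSol χ T B K₀ τ Z X₀ →
    ∀ t ∈ Icc 0 τ, (Z t).1.energy ≤ C := by
  have hG := χ.gMax_nonneg
  refine ⟨(K₀ * B ^ 2 + K₀ * (((1 + ‖χ.dL‖) * B) ^ 2 + B ^ 2) +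
    (15 + 2 * χ.gMax) / 5 * B ^ 2) * Real.exp (5 * B * T), fun τ Z X₀ h t ht => ?_⟩
  obtain ⟨K, hK', hC⟩ := h.exists_cone hK
  have hB : 0 ≤ B := (norm_nonneg _).trans h.norm_le
  -- Chosen so that the bound of the rate becomes 5|c| (E + D), with c conserved.
  set D := (15 + 2 * χ.gMax) / 5 * X₀.c ^ 2 with hD
  have hc : ∀ t ∈ Icc 0 τ, (Z t).1.c = X₀.c := fun t ht => by
    rw [h.solves.fst.c_eq t ht, h.init_fst]
  have h0 : (0 : ℝ) ∈ Icc 0 τ := ⟨le_rfl, ht.1.trans ht.2⟩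
  have hcB : |X₀.c| ≤ B := by rw [← hc 0 h0]; exact h.abs_c_le h0
  have hd := h.solves.fst.energy_deriv fun t ht => E.integrable_h hK' (hC t ht)
  have key := (exp_bounds_of_deriv (C := 5 * |X₀.c|) (fun t ht => (hd t ht).add_const D)
    (fun t ht => by
      have h1 := E.abs_rate_le hK' (hC t ht)
      rw [hc t ht] at h1
      refine h1.trans (le_of_eq ?_)
      have e : |X₀.c| ^ 3 = |X₀.c| * X₀.c ^ 2 := by rw [pow_succ', sq_abs]
      rw [hD, e]; ring) t ht).2
  rw [h.init_fst] at key
  have hD0 : 0 ≤ D := by positivity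
  have n1 : ‖X₀.ubL‖ ≤ B := by
    refine X₀.norm_ubL_le.trans (le_trans ?_ h.norm_le)
    rw [X₀.norm_def]
    have : 0 ≤ ‖X₀.zeta‖ + |X₀.c| + ‖X₀.h‖ := by positivity
    linarith
  have n2 : ‖X₀.h‖ ≤ B := by
    refine le_trans ?_ h.norm_le
    rw [X₀.norm_def]
    have : 0 ≤ ‖X₀.zeta‖ + |X₀.c| + ‖X₀.ubar‖ := by positivity
    linarith
  have n3 : ‖X₀.Ux χ‖ ≤ (1 + ‖χ.dL‖) * B :=
    X₀.norm_Ux_le.trans (mul_le_mul_of_nonneg_left h.norm_le (by positivity))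
  have hE : X₀.energy ≤ K₀ * B ^ 2 + K₀ * (((1 + ‖χ.dL‖) * B) ^ 2 + B ^ 2) :=
    (E.energy_le hK h.cone).trans (by gcongr)
  have hD1 : D ≤ (15 + 2 * χ.gMax) / 5 * B ^ 2 := by
    rw [hD]
    refine mul_le_mul_of_nonneg_left ?_ (by positivity)
    rw [← sq_abs]
    exact pow_le_pow_left₀ (abs_nonneg _) hcB 2
  have hE0 := E.energy_nonneg h.cone
  calc (Z t).1.energy ≤ (Z t).1.energy + D := le_add_of_nonneg_right hD0
    _ ≤ (X₀.energy + D) * Real.exp (5 * |X₀.c| * t) := key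
    _ ≤ _ := by
      refine mul_le_mul (add_le_add hE hD1) (Real.exp_le_exp.2 ?_) (Real.exp_pos _).le
        (by positivity)
      have : 0 ≤ t := ht.1
      have : t ≤ T := ht.2.trans h.le
      gcongr

variable (χ T B K₀) in
-- The bootstrap: the uniform energy bound gives a uniform bound A for ‖U² - P‖, and
-- `Cone.propagate` run with this A gives a uniform cone constant.
lemma exists_cone_bound (hK : 0 < K₀) : ∃ K, 0 < K ∧ ∀ τ Z X₀, AugSol χ T B K₀ τ Z X₀ →
    ∀ t ∈ Icc 0 τ, Cone χ K (Z t).1 ∧ ‖(Z t).1.AB χ‖ ≤ K ∧ (Z t).1.energy ≤ K := by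
  obtain ⟨C, hC⟩ := exists_energy_bound χ T B K₀ hK
  have hG := χ.gMax_nonneg
  set A := 11 / 2 * |C| + (15 + χ.gMax) * B ^ 2 with hAdef
  have hA0 : 0 ≤ A := by positivity
  have hAB : ∀ τ Z X₀, AugSol χ T B K₀ τ Z X₀ → ∀ t ∈ Icc 0 τ, ‖(Z t).1.AB χ‖ ≤ A := by
    intro τ Z X₀ h t ht
    obtain ⟨K, hK', hCone⟩ := h.exists_cone hK
    refine (E.norm_AB_le hK' (hCone t ht)).trans ?_
    have h1 := (hC τ Z X₀ h t ht).trans (le_abs_self C)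
    have h2 : (Z t).1.c ^ 2 ≤ B ^ 2 := by
      rw [← sq_abs]; exact pow_le_pow_left₀ (abs_nonneg _) (h.abs_c_le ht) 2
    rw [hAdef]
    gcongr
  set K := K₀ * Real.exp ((A + 1 / 2) * T) with hKdef
  have hKp : 0 < K := by positivity
  refine ⟨K + (A + |C|), by positivity, fun τ Z X₀ h t ht => ⟨?_, ?_, ?_⟩⟩
  · have ht' : t ≤ T := ht.2.trans h.le
    refine (Cone.propagate h.solves h.init h.cone hA0 (hAB τ Z X₀ h) t ht).mono (by positivity) ?_
    have : K₀ * Real.exp ((A + 1 / 2) * t) ≤ K := by rw [hKdef]; gcongr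
    linarith [abs_nonneg C]
  · linarith [hAB τ Z X₀ h t ht, abs_nonneg C]
  · linarith [hC τ Z X₀ h t ht, le_abs_self C]

end APriori

/-- In the cone, the energy and `c` control all components except `ζ`. -/
lemma E.exists_norm_bound (χ : PartitionFunction) {K : ℝ} (hK : 0 < K) (B : ℝ) :
    ∃ C, ∀ X : E, Cone χ K X → X.energy ≤ K → |X.c| ≤ B →
      ‖X.h‖ ≤ C ∧ ‖X.ubar‖ ≤ C ∧ ‖X.UV χ‖ ≤ C := by
  set M2 := 2 * K + 4 * B ^ 2 with hM2
  have hM20 : 0 ≤ M2 := by positivity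
  refine ⟨K + √(K * (1 + M2) * K) + |B| * ‖χ.dL‖ + (√M2 + |B|), fun X hX hE hc => ?_⟩
  have hcB : |X.c| ≤ |B| := hc.trans (le_abs_self B)
  have hM : ∀ ξ, X.ubar ξ ^ 2 ≤ M2 := fun ξ => (E.ubar_sq_le hK hX ξ).trans (by
    have : X.c ^ 2 ≤ B ^ 2 := sq_le_sq.2 hcB
    rw [hM2]; linarith)
  have i1 := E.integrable_energy hK hX
  have n1 : ‖X.h‖ ^ 2 ≤ K ^ 2 := by
    rw [L2.norm_sq]
    calc ∫ ξ, X.h ξ ^ 2 ≤ ∫ ξ, K * (X.ubar ξ ^ 2 * (1 + X.zx ξ) + X.h ξ) := by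
          refine integral_mono_ae (Lp.memLp X.h).integrable_sq (i1.const_mul K) ?_
          filter_upwards [hX] with ξ ⟨⟨h1, h2, _⟩, _, h3⟩
          have : 0 ≤ K * (X.ubar ξ ^ 2 * (1 + X.zx ξ)) := by positivity
          have h4 : X.h ξ * X.h ξ ≤ K * X.h ξ := mul_le_mul_of_nonneg_right (by linarith) h2
          nlinarith
      _ = K * X.energy := by rw [integral_const_mul, E.energy]
      _ ≤ K ^ 2 := by rw [sq]; gcongr
  have n2 : ‖X.Ux χ‖ ^ 2 ≤ K ^ 2 := by
    rw [L2.norm_sq]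
    calc ∫ ξ, X.Ux χ ξ ^ 2 ≤ ∫ ξ, K * (X.ubar ξ ^ 2 * (1 + X.zx ξ) + X.h ξ) := by
          refine integral_mono_ae (Lp.memLp (X.Ux χ)).integrable_sq (i1.const_mul K) ?_
          filter_upwards [hX] with ξ ⟨⟨h1, h2, h5⟩, _, h3⟩
          have : 0 ≤ K * (X.ubar ξ ^ 2 * (1 + X.zx ξ)) := by positivity
          have h4 : (1 + X.zx ξ) * X.h ξ ≤ K * X.h ξ :=
            mul_le_mul_of_nonneg_right (by linarith) h2
          nlinarith
      _ = K * X.energy := by rw [integral_const_mul, E.energy]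
      _ ≤ K ^ 2 := by rw [sq]; gcongr
  -- Where y_ξ is small the energy density does not see ū². But there h is bounded below: 1 ≤ K(y_ξ
  -- + h) gives ū² ≤ K(ū² y_ξ + M2 h).
  have n3 : ‖X.ubL‖ ^ 2 ≤ K * (1 + M2) * K := by
    rw [L2.norm_sq]
    calc ∫ ξ, X.ubL ξ ^ 2 ≤ ∫ ξ, K * (1 + M2) * (X.ubar ξ ^ 2 * (1 + X.zx ξ) + X.h ξ) := by
          refine integral_mono_ae (Lp.memLp X.ubL).integrable_sq (i1.const_mul _) ?_
          filter_upwards [hX, X.rep_ubL] with ξ ⟨⟨h1, h2, h5⟩, h3, _⟩ h6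
          rw [h6]
          have a1 : X.ubar ξ ^ 2 ≤ X.ubar ξ ^ 2 * (K * (1 + X.zx ξ + X.h ξ)) := by
            refine le_mul_of_one_le_right (sq_nonneg _) ?_
            calc (1 : ℝ) = K * K⁻¹ := (mul_inv_cancel₀ hK.ne').symm
              _ ≤ _ := by gcongr
          have a2 : X.ubar ξ ^ 2 * X.h ξ ≤ M2 * X.h ξ := mul_le_mul_of_nonneg_right (hM ξ) h2
          have a3 : 0 ≤ K * M2 * (X.ubar ξ ^ 2 * (1 + X.zx ξ)) := by positivity
          have a4 := mul_le_mul_of_nonneg_left a2 hK.le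
          have a5 : 0 ≤ K * X.h ξ := by positivity
          nlinarith
      _ = K * (1 + M2) * X.energy := by rw [integral_const_mul, E.energy]
      _ ≤ _ := by gcongr
  have m1 : ‖X.h‖ ≤ K := le_of_sq_le_sq n1 hK.le
  have m2 : ‖X.Ux χ‖ ≤ K := le_of_sq_le_sq n2 hK.le
  have m3 : ‖X.ubL‖ ≤ √(K * (1 + M2) * K) := Real.le_sqrt_of_sq_le n3
  have hs := Real.sqrt_nonneg (K * (1 + M2) * K)
  have hs2 := Real.sqrt_nonneg M2
  have hd : 0 ≤ |B| * ‖χ.dL‖ := by positivity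
  have hB := abs_nonneg B
  refine ⟨by linarith, ?_, ?_⟩
  · refine (H1.norm_le _).trans ?_
    have : ‖H1.dL X.ubar‖ ≤ K + |B| * ‖χ.dL‖ := by
      have e : H1.dL X.ubar = X.Ux χ - X.c • χ.dL := by rw [E.Ux]; abel
      rw [e]
      refine (norm_sub_le _ _).trans (add_le_add m2 ?_)
      rw [norm_smul, Real.norm_eq_abs]; gcongr
    change ‖X.ubL‖ + _ ≤ _
    linarith
  · rw [V.norm_eq, E.toBC_UV, E.dL_UV]
    have : ‖X.UB χ‖ ≤ √M2 + |B| := by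
      refine (BoundedContinuousFunction.norm_le (by positivity)).2 fun ξ => ?_
      rw [E.UB_apply, E.U]
      refine (norm_add_le _ _).trans (add_le_add (Real.abs_le_sqrt (hM ξ)) ?_)
      rw [norm_mul, Real.norm_eq_abs, Real.norm_eq_abs]
      calc |X.c| * |χ ξ| ≤ |B| * 1 := mul_le_mul hcB (χ.abs_le_one ξ) (abs_nonneg _) hB
        _ = |B| := mul_one _
    linarith

lemma SpinSys.norm_le {A p q : ℝ → BC} {τ K : ℝ} (h : SpinSys A τ p q) (hK0 : 0 ≤ K)
    (hK : ∀ t ∈ Icc 0 τ, ‖A t‖ ≤ K) (h0 : ‖(p 0, q 0)‖ ≤ 1) :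
    ∀ t ∈ Icc 0 τ, ‖(p t, q t)‖ ≤ Real.exp ((K + 1 / 2) * t) := by
  intro t ht
  have hd : ∀ t ∈ Icc 0 τ, HasDerivWithinAt (fun t => (p t, q t)) ((1 / 2 : ℝ) • q t, A t * p t)
      (Icc 0 τ) t := fun t ht => (h.one t ht).prodMk (h.two t ht)
  have := norm_le_gronwallBound_of_norm_deriv_right_le (f := fun t => (p t, q t)) (δ := 1)
    (K := K + 1 / 2) (ε := 0) (a := 0) (b := τ)
    (fun t ht => (hd t ht).continuousWithinAt) (fun t ht =>
      (hd t ⟨ht.1, ht.2.le⟩).mono_of_mem_nhdsWithin (mem_of_superset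
        (Icc_mem_nhdsGE ht.2) (Icc_subset_Icc_left ht.1))) h0 (fun t ht => by
      have hA := hK t ⟨ht.1, ht.2.le⟩
      have d1 : ‖p t‖ ≤ ‖(p t, q t)‖ := norm_fst_le (p t, q t)
      have d2 : ‖q t‖ ≤ ‖(p t, q t)‖ := norm_snd_le (p t, q t)
      have hn := norm_nonneg (p t, q t)
      have hKn : 0 ≤ K * ‖(p t, q t)‖ := by positivity
      have m1 : ‖A t * p t‖ ≤ K * ‖(p t, q t)‖ :=
        (norm_mul_le _ _).trans (mul_le_mul hA d1 (norm_nonneg _) hK0)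
      refine max_le ?_ ?_
      · change ‖(1 / 2 : ℝ) • q t‖ ≤ _
        rw [norm_smul, Real.norm_of_nonneg (by norm_num : (0 : ℝ) ≤ 1 / 2)]; linarith
      · change ‖A t * p t‖ ≤ _
        linarith) t ht
  rwa [gronwallBound_ε0, one_mul, sub_zero] at this

/-- Solutions of the augmented system that start in a bounded part of the cone remain in a bounded
part of the cone. -/
theorem exists_apriori_bound (χ : PartitionFunction) {T K₀ : ℝ} (B : ℝ) (hT : 0 ≤ T) (hK : 0 < K₀) :
    ∃ R, 0 < R ∧ ∀ τ Z X₀, AugSol χ T B K₀ τ Z X₀ → ∀ t ∈ Icc 0 τ,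
      ‖Z t‖ ≤ R ∧ Cone χ R (Z t).1 := by
  obtain ⟨K, hK', H⟩ := exists_cone_bound χ T B K₀ hK
  obtain ⟨C, hC⟩ := E.exists_norm_bound χ hK' B
  set S := Real.exp ((K + 1 / 2) * T) with hS
  set R := (B + |C| * T) + (|C| + B) + |C| + S + K with hR
  -- For B < 0 no X₀ satisfies ‖X₀‖ ≤ B.
  by_cases hB : 0 ≤ B
  swap
  · exact ⟨1, one_pos, fun τ Z X₀ h => absurd ((norm_nonneg _).trans h.norm_le) hB⟩
  have hSp : 0 < S := Real.exp_pos _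
  refine ⟨R, by positivity, fun τ Z X₀ h t ht => ?_⟩
  obtain ⟨hcone, hAB, hEn⟩ := H τ Z X₀ h t ht
  have hKR : K ≤ R := by
    rw [hR]
    have : 0 ≤ (B + |C| * T) + (|C| + B) + |C| + S := by positivity
    linarith
  refine ⟨?_, hcone.mono hK' hKR⟩
  have ht0 : (0 : ℝ) ∈ Icc 0 τ := ⟨le_rfl, ht.1.trans ht.2⟩
  have htT : t ≤ T := ht.2.trans h.le
  obtain ⟨b1, b2, _⟩ := hC _ hcone hEn (h.abs_c_le ht)
  -- ζ is not controlled by the energy; it is bounded by integrating ζ_t = U in V over [0, T].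
  have hz : ‖(Z t).1.zeta‖ ≤ B + |C| * T := by
    have h1 := (convex_Icc 0 τ).norm_image_sub_le_of_norm_hasDerivWithin_le (C := |C|)
      h.solves.fst.zeta (fun s hs => by
        obtain ⟨hcone, _, hEn⟩ := H τ Z X₀ h s hs
        exact (hC _ hcone hEn (h.abs_c_le hs)).2.2.trans (le_abs_self C)) ht0 ht
    rw [sub_zero, Real.norm_of_nonneg ht.1, h.init_fst] at h1
    have h2 : ‖X₀.zeta‖ ≤ B := by
      refine le_trans ?_ h.norm_le
      rw [X₀.norm_def]
      have : 0 ≤ ‖X₀.ubar‖ + |X₀.c| + ‖X₀.h‖ := by positivity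
      linarith
    have h3 := norm_le_norm_add_norm_sub' (Z t).1.zeta X₀.zeta
    have h4 : |C| * t ≤ |C| * T := by gcongr
    linarith
  have hX : ‖(Z t).1‖ ≤ (B + |C| * T) + (|C| + B) + |C| := by
    rw [E.norm_def]
    have := h.abs_c_le ht
    have := le_abs_self C
    linarith
  have hone : ‖(1 : BC)‖ ≤ 1 := (BoundedContinuousFunction.norm_le zero_le_one).2 fun x => by simp
  have hsp : ∀ t ∈ Icc 0 τ, ‖(Z t).1.AB χ‖ ≤ K := fun t ht => (H τ Z X₀ h t ht).2.1
  have hexp : Real.exp ((K + 1 / 2) * t) ≤ S := by rw [hS]; gcongr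
  have s1 := (h.solves.spin₁.norm_le hK'.le hsp (by
    rw [h.init]; exact max_le hone (by simp [augInit])) t ht).trans hexp
  have s2 := (h.solves.spin₂.norm_le hK'.le hsp (by
    rw [h.init]; exact max_le (by simp [augInit]) hone) t ht).trans hexp
  have hCn := abs_nonneg C
  have hCT : 0 ≤ |C| * T := by positivity
  refine max_le (by linarith) (max_le ?_ ?_)
  · exact s1.trans (by rw [hR]; linarith)
  · exact s2.trans (by rw [hR]; linarith)

/-! ### `ℱ` is the union of the cones -/

lemma Relabeling.exists_ae_deriv_bounds (f : Relabeling) :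
    ∃ K : ℝ, 0 < K ∧ ∀ᵐ ξ : ℝ, K⁻¹ ≤ deriv f.1 ξ ∧ deriv f.1 ξ ≤ K := by
  obtain ⟨K, hK⟩ := f.lip
  obtain ⟨K', hK'⟩ := f.lip_symm
  refine ⟨K + K' + 1, by positivity, ?_⟩
  filter_upwards [ae_deriv_comp hK hK' hK'.ae_differentiableAt_real, f.ae_deriv_pos] with x hx hp
  have e : (fun x => f.1.symm (f.1 x)) = id := by ext x; exact f.1.symm_apply_apply x
  rw [e, deriv_id] at hx
  have h1 : deriv f.1 x ≤ K := (le_abs_self _).trans (norm_deriv_le_of_lipschitz hK)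
  have h2 : deriv f.1.symm (f.1 x) ≤ K' := (le_abs_self _).trans (norm_deriv_le_of_lipschitz hK')
  have hK0 : (0 : ℝ) ≤ K := K.2
  have hK0' : (0 : ℝ) ≤ K' := K'.2
  refine ⟨?_, by linarith⟩
  rw [inv_le_iff_one_le_mul₀ (by positivity)]
  calc (1 : ℝ) = deriv f.1.symm (f.1 x) * deriv f.1 x := hx
    _ ≤ (K + K' + 1) * deriv f.1 x := by gcongr; linarith
    _ = _ := mul_comm _ _

namespace E

variable {χ : PartitionFunction} {X : E} {K : ℝ}

lemma locallyIntegrable_h (X : E) : LocallyIntegrable X.h volume :=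
  (Lp.memLp X.h).locallyIntegrable (by norm_num)

lemma integrableOn_Iic_iff (X : E) (a b : ℝ) : IntegrableOn X.h (Iic a) → IntegrableOn X.h (Iic b) := by
  intro h
  have h1 : IntegrableOn X.h (Icc a b) := X.locallyIntegrable_h.integrableOn_isCompact isCompact_Icc
  refine (h.union h1).mono_set fun x hx => ?_
  rcases le_total x a with h | h
  · exact Or.inl h
  · exact Or.inr ⟨h, hx⟩

lemma H_eq (hi : IntegrableOn X.h (Iic 0)) (ξ : ℝ) : X.H ξ = X.H 0 + ∫ τ in (0 : ℝ)..ξ, X.h τ := by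
  rw [H, H, ← intervalIntegral.integral_Iic_sub_Iic hi (X.integrableOn_Iic_iff 0 ξ hi)]
  ring

lemma locAC_H (hi : IntegrableOn X.h (Iic 0)) : LocAC X.H := by
  rw [funext (H_eq hi)]
  exact LocAC.primitive X.locallyIntegrable_h _ _

lemma ae_hasDerivAt_total (hi : IntegrableOn X.h (Iic 0)) :
    ∀ᵐ ξ : ℝ, HasDerivAt (fun ξ => X.y ξ + X.H ξ) (1 + X.zx ξ + X.h ξ) ξ := by
  filter_upwards [X.ae_hasDerivAt_y, LocallyIntegrable.ae_hasDerivAt_integral X.locallyIntegrable_h] with ξ h1 h2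
  refine h1.add ?_
  rw [funext (H_eq hi)]
  exact (h2 0).const_add _

lemma memG_of_cone (hK : 0 < K) (h : Cone χ K X) : MemG χ X where
  zeta_mem := ⟨X.locAC_zeta, X.zeta.memSob.memLp,
    memLp_top_of_bound (measurable_deriv _).aestronglyMeasurable (K + 1) (by
      filter_upwards [h, V.coeFn_dL X.zeta] with ξ ⟨⟨h1, h2, _⟩, _, h3⟩ h4
      rw [← h4, Real.norm_eq_abs]
      change |X.zx ξ| ≤ _
      exact abs_le.2 ⟨by linarith, by linarith⟩)⟩
  U_mem := ⟨X.locAC_U χ, (X.memSob_U χ).memLp,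
    memLp_top_of_bound (measurable_deriv _).aestronglyMeasurable K (by
      filter_upwards [h, X.rep_Ux χ] with ξ ⟨⟨h1, h2, h4⟩, _, h3⟩ h5
      rw [← h5, Real.norm_eq_abs]
      refine abs_le_of_sq_le_sq ?_ hK.le
      rw [← h4, sq]
      exact mul_le_mul (by linarith) (by linarith) h2 hK.le)⟩
  h_mem := memLp_top_of_bound (Lp.memLp X.h).1 K (by
    filter_upwards [h] with ξ ⟨⟨h1, h2, _⟩, _, h3⟩
    rw [Real.norm_of_nonneg h2]; linarith)
  y_deriv_nonneg := by
    filter_upwards [h, X.ae_deriv_y] with ξ ⟨⟨h1, _⟩, _⟩ h2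
    rwa [h2]
  h_nonneg := by filter_upwards [h] with ξ ⟨⟨_, h1, _⟩, _⟩ using h1
  pos := by
    filter_upwards [h, X.ae_deriv_y] with ξ ⟨_, h1, _⟩ h2
    rw [h2]; exact (inv_pos.2 hK).trans_le h1
  energy := by
    filter_upwards [h, X.ae_deriv_y, X.rep_Ux χ] with ξ ⟨⟨_, _, h1⟩, _⟩ h2 h3
    rw [h2, ← h3, h1]

lemma abs_H_le (hi : Integrable X.h) (ξ : ℝ) : |X.H ξ| ≤ ∫ τ, |X.h τ| :=
  (abs_integral_le_integral_abs).trans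
    (setIntegral_le_integral hi.abs (ae_of_all _ fun _ => abs_nonneg _))

lemma total_sub (hi : IntegrableOn X.h (Iic 0)) (a b : ℝ) :
    (X.y b + X.H b) - (X.y a + X.H a) = ∫ ξ in a..b, (1 + X.zx ξ + X.h ξ) := by
  have hl : LocAC fun ξ => X.y ξ + X.H ξ := X.locAC_y.add' (locAC_H hi)
  rw [← hl.integral_deriv a b]
  refine intervalIntegral.integral_congr_ae ?_
  filter_upwards [ae_hasDerivAt_total hi] with ξ h _ using h.deriv

lemma total_sub_bounds (hK : 0 < K) (h : Cone χ K X) {a b : ℝ} (hab : a ≤ b) :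
    K⁻¹ * (b - a) ≤ (X.y b + X.H b) - (X.y a + X.H a) ∧
      (X.y b + X.H b) - (X.y a + X.H a) ≤ K * (b - a) := by
  have hi := (integrable_h hK h).integrableOn (s := Iic 0)
  rw [total_sub hi]
  have hii : IntervalIntegrable (fun ξ => 1 + X.zx ξ + X.h ξ) volume a b := by
    have hl : LocAC fun ξ => X.y ξ + X.H ξ := X.locAC_y.add' (locAC_H hi)
    refine (hl.intervalIntegrable_deriv a b).congr_ae (ae_restrict_of_ae ?_)
    filter_upwards [ae_hasDerivAt_total hi] with ξ h using h.deriv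
  have c : ∀ r : ℝ, ∫ _ in a..b, r = r * (b - a) := fun r => by
    rw [intervalIntegral.integral_const, smul_eq_mul, mul_comm]
  rw [← c, ← c]
  exact ⟨intervalIntegral.integral_mono_ae hab (by simp) hii (Eventually.mono h fun ξ hξ => hξ.2.1),
    intervalIntegral.integral_mono_ae hab hii (by simp) (Eventually.mono h fun ξ hξ => hξ.2.2)⟩

lemma abs_total_sub_bounds (hK : 0 < K) (h : Cone χ K X) (a b : ℝ) :
    |a - b| ≤ K * |(X.y a + X.H a) - (X.y b + X.H b)| ∧
      |(X.y a + X.H a) - (X.y b + X.H b)| ≤ K * |a - b| := by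
  have key : ∀ a b, a ≤ b → |a - b| ≤ K * |(X.y a + X.H a) - (X.y b + X.H b)| ∧
      |(X.y a + X.H a) - (X.y b + X.H b)| ≤ K * |a - b| := fun a b hab => by
    obtain ⟨h1, h2⟩ := total_sub_bounds hK h hab
    have h3 : 0 ≤ K⁻¹ * (b - a) := mul_nonneg (inv_pos.2 hK).le (sub_nonneg.2 hab)
    rw [abs_sub_comm, abs_sub_comm (X.y a + X.H a), abs_of_nonneg (sub_nonneg.2 hab),
      abs_of_nonneg (h3.trans h1)]
    have h4 := mul_le_mul_of_nonneg_left h1 hK.le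
    rw [mul_inv_cancel_left₀ hK.ne'] at h4
    exact ⟨h4, h2⟩
  rcases le_total a b with hab | hab
  · exact key a b hab
  · rw [abs_sub_comm, abs_sub_comm (X.y a + X.H a)]; exact key b a hab

/-- K⁻¹ ≤ (y + H)_ξ ≤ K makes y + H bi-Lipschitz, the distance from the identity is at most ‖ζ‖ plus
the L¹ norm of h, which gives surjectivity, and (y + H)_ξ - 1 = ζ_ξ + h is in L². -/
lemma memF_of_cone (hK : 0 < K) (h : Cone χ K X) : MemF χ X := by
  refine ⟨memG_of_cone hK h, ?_⟩
  have hi := integrable_h hK h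
  set f : ℝ → ℝ := fun ξ => X.y ξ + X.H ξ with hf
  have hab := fun a b => abs_total_sub_bounds hK h a b
  have hmono : StrictMono f := fun a b hab => by
    have h1 := (total_sub_bounds hK h hab.le).1
    have : 0 < K⁻¹ * (b - a) := mul_pos (inv_pos.2 hK) (sub_pos.2 hab)
    simp only [hf]; linarith
  have hlip : LipschitzWith K.toNNReal f := LipschitzWith.of_dist_le_mul fun a b => by
    rw [Real.coe_toNNReal _ hK.le, Real.dist_eq, Real.dist_eq]
    exact (hab a b).2
  set C := ‖X.zB‖ + ∫ τ, |X.h τ|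
  have hC : ∀ ξ, |f ξ - ξ| ≤ C := fun ξ => by
    have e : f ξ - ξ = X.zB ξ + X.H ξ := by rw [zB_apply]; simp only [hf, y]; ring
    rw [e]
    exact (abs_add_le _ _).trans (add_le_add (X.zB.norm_coe_le_norm ξ) (abs_H_le hi ξ))
  have hsurj : Function.Surjective f := by
    refine hlip.continuous.surjective ?_ ?_
    · refine tendsto_atTop_mono (fun ξ => ?_) (tendsto_atTop_add_const_right atTop (-C) tendsto_id)
      have := (abs_le.1 (hC ξ)).1
      simp only [id]; linarith
    · refine tendsto_atBot_mono (fun ξ => ?_) (tendsto_atBot_add_const_right atBot C tendsto_id)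
      have := (abs_le.1 (hC ξ)).2
      simp only [id]; linarith
  let F := (hmono.orderIsoOfSurjective f hsurj).toHomeomorph
  have hF : ∀ ξ, F ξ = f ξ := fun ξ => rfl
  have hlip' : LipschitzWith K.toNNReal F.symm := LipschitzWith.of_dist_le_mul fun a b => by
    rw [Real.coe_toNNReal _ hK.le, Real.dist_eq, Real.dist_eq]
    have := (hab (F.symm a) (F.symm b)).1
    change _ ≤ K * |F (F.symm a) - F (F.symm b)| at this
    rwa [F.apply_symm_apply, F.apply_symm_apply] at this
  have hrel : IsRelabeling F := by
    refine ⟨MemSob.of_lipschitz (hlip.sub LipschitzWith.id) hC,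
      MemSob.of_lipschitz (hlip'.sub LipschitzWith.id) (C := C) fun ξ => ?_, ?_⟩
    · have := hC (F.symm ξ)
      rwa [← hF, F.apply_symm_apply, abs_sub_comm] at this
    · refine ((Lp.memLp X.zx).add (Lp.memLp X.h)).ae_eq ?_
      filter_upwards [ae_hasDerivAt_total (hi.integrableOn (s := Iic 0))] with ξ h1
      have h2 : deriv F ξ = _ := h1.deriv
      rw [h2, Pi.add_apply]; ring
  exact ⟨⟨F, hrel⟩, fun ξ => rfl⟩

/-- An element of `ℱ` belongs to some cone. -/
lemma exists_cone_of_memF (h : MemF χ X) : ∃ K, 0 < K ∧ Cone χ K X := by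
  obtain ⟨hG, f, hf⟩ := h
  obtain ⟨K, hK, hfK⟩ := f.exists_ae_deriv_bounds
  obtain ⟨C, hC⟩ := ae_bound_of_memLp_top hG.h_mem
  have base : ∀ᵐ ξ : ℝ, 0 ≤ 1 + X.zx ξ ∧ 0 ≤ X.h ξ ∧ (1 + X.zx ξ) * X.h ξ = X.Ux χ ξ ^ 2 := by
    filter_upwards [hG.y_deriv_nonneg, hG.h_nonneg, hG.energy, X.ae_deriv_y, X.rep_Ux χ]
      with ξ h1 h2 h3 h4 h5
    rw [h4] at h1 h3
    rw [h5]; exact ⟨h1, h2, h3⟩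
  by_cases hi : IntegrableOn X.h (Iic 0)
  · refine ⟨K, hK, ?_⟩
    filter_upwards [base, hfK, ae_hasDerivAt_total hi] with ξ h1 h2 h3
    have e : (f.1 : ℝ → ℝ) = fun ξ => X.y ξ + X.H ξ := funext hf
    rw [e, h3.deriv] at h2
    exact ⟨h1, h2⟩
  -- If h were not integrable at -∞, the integral defining H would have the default value 0. Then y
  -- itself is the relabeling, so y_ξ is bounded above and below, and h is bounded by the definition
  -- of 𝒢; the cone condition holds in this case too.
  · have hH : ∀ ξ, X.H ξ = 0 := fun ξ =>
      integral_undef fun h => hi (X.integrableOn_Iic_iff ξ 0 h)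
    have e : (f.1 : ℝ → ℝ) = X.y := funext fun ξ => by rw [hf, hH, add_zero]
    refine ⟨K + |C|, by positivity, ?_⟩
    filter_upwards [base, hfK, hC, X.ae_deriv_y] with ξ h1 h2 h3 h4
    rw [e, h4] at h2
    have h5 : X.h ξ ≤ |C| := (le_abs_self _).trans (h3.trans (le_abs_self C))
    refine ⟨h1, ?_, by linarith [h2.2]⟩
    have : (K + |C|)⁻¹ ≤ K⁻¹ := inv_anti₀ hK (by linarith [abs_nonneg C])
    linarith [h2.1, h1.2.1]

/-- If `y + H = id`, then `y_ξ + h = 1`. -/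
lemma cone_one (hK : 0 < K) (h : Cone χ K X) (ht : ∀ ξ, X.y ξ + X.H ξ = ξ) : Cone χ 1 X := by
  filter_upwards [h, ae_hasDerivAt_total ((integrable_h hK h).integrableOn (s := Iic 0))] with ξ h1 h2
  have e : (fun ξ => X.y ξ + X.H ξ) = fun ξ => ξ := funext ht
  rw [e] at h2
  have h3 := h2.unique (hasDerivAt_id' ξ)
  exact ⟨h1.1, by rw [h3, inv_one], h3.le⟩

end E

/-! ### The flow -/

/-- The two spinors are part of the unknown, so that any local solution is already of the kind for
which the a priori bound is proved. -/
lemma exists_augFlow {χ : PartitionFunction} (X : F χ) :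
    ∃ Z : ℝ → Aug, Z 0 = augInit X.1 ∧ SolvesGlobally (augField χ) Z := by
  obtain ⟨K, hK, hC⟩ := E.exists_cone_of_memF X.2
  refine (lipB_augField χ).exists_solvesGlobally fun T hT => ?_
  obtain ⟨R, _, hR⟩ := exists_apriori_bound χ ‖X.1‖ hT hK
  exact ⟨R, fun τ hτ Z h0 hZ => (hR τ Z X.1 ⟨hτ.2, hZ, h0, le_rfl, hC⟩ τ ⟨hτ.1, le_rfl⟩).1⟩

/-- The solution of the augmented system starting from `X`. -/
def augFlow {χ : PartitionFunction} (X : F χ) : ℝ → Aug := (exists_augFlow X).choose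

section Flow

variable {χ : PartitionFunction}

lemma augFlow_zero (X : F χ) : augFlow X 0 = augInit X.1 := (exists_augFlow X).choose_spec.1

lemma augFlow_solves (X : F χ) : SolvesGlobally (augField χ) (augFlow X) :=
  (exists_augFlow X).choose_spec.2

lemma augFlow_augSol (X : F χ) {T K : ℝ} (hC : Cone χ K X.1) {B : ℝ} (hB : ‖X.1‖ ≤ B) :
    AugSol χ T B K T (augFlow X) X.1 :=
  ⟨le_rfl, (augFlow_solves X).solvesOn T, augFlow_zero X, hB, hC⟩

lemma augFlow_memF (X : F χ) {t : ℝ} (ht : 0 ≤ t) : MemF χ (augFlow X t).1 := by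
  obtain ⟨K, hK, hC⟩ := E.exists_cone_of_memF X.2
  obtain ⟨R, hR0, hR⟩ := exists_apriori_bound χ ‖X.1‖ ht hK
  exact E.memF_of_cone hR0 (hR t _ X.1 (augFlow_augSol X hC le_rfl) t ⟨ht, le_rfl⟩).2

/-- The flow of the system on `ℱ`. -/
def flow (t : ℝ≥0) (X : F χ) : F χ := ⟨(augFlow X t).1, augFlow_memF X t.2⟩

lemma flow_val (t : ℝ≥0) (X : F χ) : (flow t X).1 = (augFlow X t).1 := rfl

lemma flow_zero (X : F χ) : flow 0 X = X := by
  refine Subtype.ext ?_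
  rw [flow_val, NNReal.coe_zero, augFlow_zero]; rfl

lemma augFlow_solves_fst (X : F χ) :
    SolvesGlobally (E.field χ) (fun t => (augFlow X t).1) := fun t ht =>
  HasDerivWithinAt.clm_apply' (ContinuousLinearMap.fst ℝ _ _) (augFlow_solves X t ht)

lemma F.monotone_y (X : F χ) : Monotone X.1.y :=
  E.monotone_y_of_deriv_nonneg X.2.1.y_deriv_nonneg

/-- The flow is unique. -/
lemma flow_unique {X : F χ} {Y : ℝ → E} (hY : SolvesGlobally (E.field χ) Y) (h0 : Y 0 = X.1)
    (t : ℝ≥0) : Y t = (flow t X).1 := by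
  refine (E.lipB_field χ).unique (hY.solvesOn t) ((augFlow_solves_fst X).solvesOn t) ?_ t
    ⟨t.2, le_rfl⟩
  rw [h0, augFlow_zero]; rfl

lemma SolvesGlobally.continuousOn {W : Type*} [NormedAddCommGroup W] [NormedSpace ℝ W] {G : W → W}
    {Y : ℝ → W} (hY : SolvesGlobally G Y) : ContinuousOn Y (Ici 0) :=
  fun t ht => (hY t ht).continuousWithinAt

lemma isGlobalSolution_flow (X : F χ) : IsGlobalSolution χ (fun t => (flow t X).1) := by
  refine ⟨fun t => (flow t X).1.field χ, ?_, fun t => ⟨?_, ?_⟩⟩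
  · have h : Continuous fun t : ℝ≥0 => (augFlow X t).1 :=
      (augFlow_solves_fst X).continuousOn.comp_continuous NNReal.continuous_coe fun t => t.2
    exact (E.lipB_field χ).continuous.comp h
  · refine (augFlow_solves_fst X t t.2).congr (fun s hs => ?_) ?_
    · change (augFlow X (s.toNNReal : ℝ)).1 = _
      rw [Real.coe_toNNReal _ hs]
    · change (augFlow X ((t : ℝ).toNNReal : ℝ)).1 = _
      rw [Real.toNNReal_coe]
  · exact E.isVelocity_field χ (flow t X).monotone_y

/-- In 𝒢 the function y is nondecreasing, hence the velocity is the value of the field. Uniqueness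
among 𝒢-valued solutions thereby reduces to uniqueness for a locally Lipschitz equation in E. -/
lemma IsGlobalSolution.solvesGlobally {Z : ℝ≥0 → E} (hZ : IsGlobalSolution χ Z)
    (hG : ∀ t, MemG χ (Z t)) : SolvesGlobally (E.field χ) (fun s => Z s.toNNReal) := by
  obtain ⟨Z', _, h⟩ := hZ
  intro t ht
  obtain ⟨h1, h2⟩ := h t.toNNReal
  rw [h2.eq_field χ (E.monotone_y_of_deriv_nonneg (hG _).y_deriv_nonneg), Real.coe_toNNReal _ ht]
    at h1
  exact h1

lemma SolvesGlobally.shift {W : Type*} [NormedAddCommGroup W] [NormedSpace ℝ W] {G : W → W}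
    {Y : ℝ → W} (hY : SolvesGlobally G Y) {s : ℝ} (hs : 0 ≤ s) :
    SolvesGlobally G (fun t => Y (t + s)) := by
  intro t ht
  have h1 := hY (t + s) (add_nonneg ht hs)
  have h2 : HasDerivWithinAt (fun t => t + s) 1 (Ici 0) t :=
    ((hasDerivAt_id t).add_const s).hasDerivWithinAt
  have := h1.scomp t h2 fun r hr => add_nonneg hr hs
  rwa [one_smul] at this

lemma flow_add (s t : ℝ≥0) (X : F χ) : flow (s + t) X = flow s (flow t X) := by
  refine Subtype.ext ?_
  have h := flow_unique (X := flow t X) ((augFlow_solves_fst X).shift t.2)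
    (by rw [zero_add]; rfl) s
  rw [← h]; rfl

end Flow

/-! ### Composition operators -/

/-- The image of Lebesgue measure under f is at most K times Lebesgue measure, and the L² norm sees
the square root of this factor. -/
lemma norm_toLp_comp_le {f : ℝ ≃ₜ ℝ} {K : ℝ≥0} (hf : LipschitzWith K f.symm) (u : L2) :
    ‖(memLp_comp hf (Lp.memLp u)).toLp _‖ ≤ √K * ‖u‖ := by
  have h0 : AEStronglyMeasurable u (volume.map f) := (Lp.memLp u).1.mono_ac
    (Measure.absolutelyContinuous_of_le_smul (map_volume_le hf))
  have h1 : eLpNorm (fun x => u (f x)) 2 volume = eLpNorm u 2 (volume.map f) :=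
    (eLpNorm_map_measure h0 f.measurable.aemeasurable).symm
  have h2 : eLpNorm u 2 (volume.map f) ≤ (K : ℝ≥0∞) ^ (1 / 2 : ℝ) * eLpNorm u 2 volume := by
    refine (eLpNorm_mono_measure u (map_volume_le hf)).trans (le_of_eq ?_)
    rw [eLpNorm_smul_measure_of_ne_top (by norm_num), smul_eq_mul]
    congr 2
    rw [ENNReal.toReal_div]; norm_num
  rw [Lp.norm_toLp, Lp.norm_def]
  have h3 := ENNReal.toReal_mono (ENNReal.mul_ne_top (by simp) (Lp.memLp u).2.ne) (h1.trans_le h2)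
  rwa [ENNReal.toReal_mul, ← ENNReal.toReal_rpow, ENNReal.coe_toReal, ← Real.sqrt_eq_rpow] at h3

/-- `u ↦ u ∘ f` on `L²`. -/
def Relabeling.comp (f : Relabeling) : L2 →L[ℝ] L2 := LinearMap.mkContinuous
  { toFun := fun u => (memLp_comp f.lip_symm.choose_spec (Lp.memLp u)).toLp _
    map_add' := fun u v => Lp.ext (by
      have hq := quasi_of_lipschitz f.lip_symm.choose_spec
      filter_upwards [MemLp.coeFn_toLp (memLp_comp f.lip_symm.choose_spec (Lp.memLp (u + v))),
        MemLp.coeFn_toLp (memLp_comp f.lip_symm.choose_spec (Lp.memLp u)),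
        MemLp.coeFn_toLp (memLp_comp f.lip_symm.choose_spec (Lp.memLp v)),
        Lp.coeFn_add ((memLp_comp f.lip_symm.choose_spec (Lp.memLp u)).toLp _)
          ((memLp_comp f.lip_symm.choose_spec (Lp.memLp v)).toLp _),
        hq.ae (Lp.coeFn_add u v)] with x h1 h2 h3 h4 h5
      rw [h1, h4, Pi.add_apply, h2, h3, h5, Pi.add_apply])
    map_smul' := fun c u => Lp.ext (by
      have hq := quasi_of_lipschitz f.lip_symm.choose_spec
      filter_upwards [MemLp.coeFn_toLp (memLp_comp f.lip_symm.choose_spec (Lp.memLp (c • u))),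
        MemLp.coeFn_toLp (memLp_comp f.lip_symm.choose_spec (Lp.memLp u)),
        Lp.coeFn_smul c ((memLp_comp f.lip_symm.choose_spec (Lp.memLp u)).toLp _),
        hq.ae (Lp.coeFn_smul c u)] with x h1 h2 h3 h4
      rw [h1, RingHom.id_apply, h3, Pi.smul_apply, h2, h4, Pi.smul_apply]) }
  (√f.lip_symm.choose) fun u => norm_toLp_comp_le f.lip_symm.choose_spec u

lemma Relabeling.coeFn_comp (f : Relabeling) (u : L2) : f.comp u =ᵐ[volume] fun x => u (f.1 x) :=
  MemLp.coeFn_toLp (memLp_comp f.lip_symm.choose_spec (Lp.memLp u))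

/-- Any Lipschitz constant of f⁻¹ may be used, not only the one chosen in the definition; families
of relabelings thus have a common operator bound. -/
lemma Relabeling.norm_comp_le (f : Relabeling) {K : ℝ≥0} (hf : LipschitzWith K f.1.symm) (u : L2) :
    ‖f.comp u‖ ≤ √K * ‖u‖ := by
  have e : f.comp u = (memLp_comp hf (Lp.memLp u)).toLp _ :=
    Lp.ext ((f.coeFn_comp u).trans (MemLp.coeFn_toLp _).symm)
  rw [e]; exact norm_toLp_comp_le hf u

lemma Relabeling.ae_comp (f : Relabeling) {p : ℝ → Prop} (h : ∀ᵐ x : ℝ, p x) :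
    ∀ᵐ x : ℝ, p (f.1 x) := by
  obtain ⟨K, hK⟩ := f.lip_symm
  exact (quasi_of_lipschitz hK).ae h

lemma memLp_deriv_mul (f : Relabeling) (u : L2) :
    MemLp (fun x => deriv f.1 x * u x) 2 volume := by
  obtain ⟨K, hK⟩ := f.lip
  refine (memLp_mul_deriv hK (Lp.memLp u)).ae_eq (ae_of_all _ fun x => ?_)
  exact mul_comm _ _

/-- Multiplication by `f_ξ`. -/
def Relabeling.derivMul (f : Relabeling) : L2 →L[ℝ] L2 := LinearMap.mkContinuous
  { toFun := fun u => (memLp_deriv_mul f u).toLp _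
    map_add' := fun u v => Lp.ext (by
      filter_upwards [MemLp.coeFn_toLp (memLp_deriv_mul f (u + v)),
        MemLp.coeFn_toLp (memLp_deriv_mul f u), MemLp.coeFn_toLp (memLp_deriv_mul f v),
        Lp.coeFn_add ((memLp_deriv_mul f u).toLp _) ((memLp_deriv_mul f v).toLp _),
        Lp.coeFn_add u v] with x h1 h2 h3 h4 h5
      rw [h1, h4, Pi.add_apply, h2, h3, h5, Pi.add_apply, mul_add])
    map_smul' := fun c u => Lp.ext (by
      filter_upwards [MemLp.coeFn_toLp (memLp_deriv_mul f (c • u)),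
        MemLp.coeFn_toLp (memLp_deriv_mul f u),
        Lp.coeFn_smul c ((memLp_deriv_mul f u).toLp _), Lp.coeFn_smul c u] with x h1 h2 h3 h4
      rw [h1, RingHom.id_apply, h3, Pi.smul_apply, h2, h4, Pi.smul_apply]
      simp only [smul_eq_mul]; ring) }
  f.lip.choose fun u => by
    refine Lp.norm_le_mul_norm_of_ae_le_mul ?_
    filter_upwards [MemLp.coeFn_toLp (memLp_deriv_mul f u)] with x hx
    change ‖(memLp_deriv_mul f u).toLp _ x‖ ≤ _
    rw [hx, norm_mul]
    exact mul_le_mul_of_nonneg_right (norm_deriv_le_of_lipschitz f.lip.choose_spec) (norm_nonneg _)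

lemma Relabeling.coeFn_derivMul (f : Relabeling) (u : L2) :
    f.derivMul u =ᵐ[volume] fun x => deriv f.1 x * u x :=
  MemLp.coeFn_toLp (memLp_deriv_mul f u)

/-- `u ↦ (u ∘ f) f_ξ` on `L²`. -/
def Relabeling.dcomp (f : Relabeling) : L2 →L[ℝ] L2 := f.derivMul ∘L f.comp

lemma Relabeling.coeFn_dcomp (f : Relabeling) (u : L2) :
    f.dcomp u =ᵐ[volume] fun x => u (f.1 x) * deriv f.1 x := by
  filter_upwards [f.coeFn_derivMul (f.comp u), f.coeFn_comp u] with x h1 h2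
  change f.derivMul (f.comp u) x = _
  rw [h1, h2, mul_comm]

lemma Relabeling.ae_deriv_comp (f : Relabeling) {u : ℝ → ℝ} (hu : LocAC u) :
    deriv (fun x => u (f.1 x)) =ᵐ[volume] fun x => deriv u (f.1 x) * deriv f.1 x := by
  obtain ⟨K, hK⟩ := f.lip
  obtain ⟨K', hK'⟩ := f.lip_symm
  exact CamassaHolm.ae_deriv_comp hK hK' hu.ae_differentiableAt

lemma Relabeling.dL_comp_V (f : Relabeling) (u : V) :
    V.dL (Sob.mk (f.memSob_comp u.memSob) : V) = f.dcomp (V.dL u) := by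
  refine Lp.ext ?_
  filter_upwards [V.coeFn_dL (Sob.mk (f.memSob_comp u.memSob) : V), f.coeFn_dcomp (V.dL u),
    f.ae_deriv_comp u.memSob.locAC, f.ae_comp (V.coeFn_dL u)] with x h1 h2 h3 h4
  rw [h1, h2, h4]; exact h3

lemma Relabeling.dL_comp_H1 (f : Relabeling) (u : H1) :
    H1.dL (Sob.mk (f.memSob_comp u.memSob) : H1) = f.dcomp (H1.dL u) := by
  refine Lp.ext ?_
  filter_upwards [H1.coeFn_dL (Sob.mk (f.memSob_comp u.memSob) : H1), f.coeFn_dcomp (H1.dL u),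
    f.ae_deriv_comp u.memSob.locAC, f.ae_comp (H1.coeFn_dL u)] with x h1 h2 h3 h4
  rw [h1, h2, h4]; exact h3

lemma Relabeling.toL2_comp_H1 (f : Relabeling) (u : H1) :
    H1.toL2 (Sob.mk (f.memSob_comp u.memSob) : H1) = f.comp (H1.toL2 u) := by
  refine Lp.ext ?_
  filter_upwards [H1.coeFn_toL2 (Sob.mk (f.memSob_comp u.memSob) : H1), f.coeFn_comp (H1.toL2 u),
    f.ae_comp (H1.coeFn_toL2 u)] with x h1 h2 h3
  rw [h1, h2, h3]; rfl

/-- `u ↦ u ∘ f` on `V`. -/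
def Relabeling.compV (f : Relabeling) : V →L[ℝ] V := LinearMap.mkContinuous
  { toFun := fun u => Sob.mk (f.memSob_comp u.memSob)
    map_add' := fun _ _ => rfl
    map_smul' := fun _ _ => rfl } (1 + ‖f.dcomp‖) fun u => by
    change ‖(Sob.mk (f.memSob_comp u.memSob) : V)‖ ≤ _
    rw [V.norm_eq, f.dL_comp_V, add_mul, one_mul]
    refine add_le_add ((BoundedContinuousFunction.norm_le (norm_nonneg _)).2 fun x =>
      V.abs_le_norm u (f.1 x)) ((f.dcomp.le_opNorm _).trans ?_)
    refine mul_le_mul_of_nonneg_left ?_ (norm_nonneg _)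
    rw [V.norm_eq]; exact le_add_of_nonneg_left (norm_nonneg _)

lemma H1.norm_toL2_le (u : H1) : ‖H1.toL2 u‖ ≤ ‖u‖ := by
  rw [H1.norm_eq]
  exact Real.le_sqrt_of_sq_le (le_add_of_nonneg_right (sq_nonneg _))

lemma H1.norm_dL_le (u : H1) : ‖H1.dL u‖ ≤ ‖u‖ := by
  rw [H1.norm_eq]
  exact Real.le_sqrt_of_sq_le (le_add_of_nonneg_left (sq_nonneg _))

/-- `u ↦ u ∘ f` on `H¹`. -/
def Relabeling.compH1 (f : Relabeling) : H1 →L[ℝ] H1 := LinearMap.mkContinuous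
  { toFun := fun u => Sob.mk (f.memSob_comp u.memSob)
    map_add' := fun _ _ => rfl
    map_smul' := fun _ _ => rfl } (‖f.comp‖ + ‖f.dcomp‖) fun u => by
    change ‖(Sob.mk (f.memSob_comp u.memSob) : H1)‖ ≤ _
    refine (H1.norm_le _).trans ?_
    rw [f.dL_comp_H1, f.toL2_comp_H1, add_mul]
    exact add_le_add ((f.comp.le_opNorm _).trans (mul_le_mul_of_nonneg_left (H1.norm_toL2_le u)
      (norm_nonneg _))) ((f.dcomp.le_opNorm _).trans (mul_le_mul_of_nonneg_left (H1.norm_dL_le u)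
      (norm_nonneg _)))

/-! ### Relabeling as an affine map -/

namespace E

variable (χ : PartitionFunction) (f : Relabeling)

/-- `χ ∘ f - χ` as an element of `H¹`. -/
def dchi : H1 := Sob.mk (memSob_chi_comp_sub χ f)

/-- The linear part of `X ↦ X ∘ f`. -/
def relabelLin : E →L[ℝ] E := LinearMap.mkContinuous
  { toFun := fun X => mk (f.compV X.zeta) (f.compH1 X.ubar + X.c • dchi χ f) X.c (f.dcomp X.h)
    map_add' := fun X Y => by
      refine E.ext' ?_ ?_ rfl ?_
      · exact map_add f.compV _ _
      · change f.compH1 (X.ubar + Y.ubar) + (X.c + Y.c) • dchi χ f =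
          (f.compH1 X.ubar + X.c • dchi χ f) + (f.compH1 Y.ubar + Y.c • dchi χ f)
        rw [map_add]; module
      · exact map_add f.dcomp _ _
    map_smul' := fun r X => by
      refine E.ext' ?_ ?_ rfl ?_
      · exact map_smul f.compV _ _
      · change f.compH1 (r • X.ubar) + (r * X.c) • dchi χ f =
          r • (f.compH1 X.ubar + X.c • dchi χ f)
        rw [map_smul]; module
      · exact map_smul f.dcomp _ _ }
  (‖f.compV‖ + (‖f.compH1‖ + ‖dchi χ f‖ + 1) + ‖f.dcomp‖) fun X => by
    change ‖mk (f.compV X.zeta) (f.compH1 X.ubar + X.c • dchi χ f) X.c (f.dcomp X.h)‖ ≤ _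
    have hn := X.norm_def
    have p1 := norm_nonneg X.zeta
    have p2 := norm_nonneg X.ubar
    have p3 := abs_nonneg X.c
    have p4 := norm_nonneg X.h
    rw [mk_norm]
    have h1 : ‖f.compV X.zeta‖ ≤ ‖f.compV‖ * ‖X‖ := (f.compV.le_opNorm _).trans
      (mul_le_mul_of_nonneg_left (by linarith) (norm_nonneg _))
    have h2 : ‖f.compH1 X.ubar‖ ≤ ‖f.compH1‖ * ‖X‖ := (f.compH1.le_opNorm _).trans
      (mul_le_mul_of_nonneg_left (by linarith) (norm_nonneg _))
    have h3 : ‖X.c • dchi χ f‖ ≤ ‖dchi χ f‖ * ‖X‖ := by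
      rw [norm_smul, Real.norm_eq_abs, mul_comm]
      exact mul_le_mul_of_nonneg_left (by linarith) (norm_nonneg _)
    have h4 : ‖f.dcomp X.h‖ ≤ ‖f.dcomp‖ * ‖X‖ := (f.dcomp.le_opNorm _).trans
      (mul_le_mul_of_nonneg_left (by linarith) (norm_nonneg _))
    have h5 := norm_add_le (f.compH1 X.ubar) (X.c • dchi χ f)
    have h6 : |X.c| ≤ ‖X‖ := by linarith
    linarith

lemma relabelLin_zeta (D : E) (ξ : ℝ) : (relabelLin χ f D).zeta ξ = D.zeta (f.1 ξ) := rfl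

lemma relabelLin_U (D : E) (ξ : ℝ) : (relabelLin χ f D).U χ ξ = D.U χ (f.1 ξ) := by
  change (D.ubar (f.1 ξ) + D.c * (χ (f.1 ξ) - χ ξ)) + D.c * χ ξ = _
  rw [U]; ring

lemma relabelLin_h (D : E) : (relabelLin χ f D).h =ᵐ[volume] fun ξ => D.h (f.1 ξ) * deriv f.1 ξ :=
  f.coeFn_dcomp D.h

/-- The function ζ picks up the fixed summand f - id; all else is linear. Relabeling by a fixed f is
therefore affine and continuous on E, and a time derivative passes through its linear part. -/
lemma relabel_eq (X : E) :
    X.relabel χ f = relabelLin χ f X + mk (Sob.mk f.memSob_sub_id) 0 0 0 := by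
  refine E.ext' (Sob.ext fun x => ?_) (Sob.ext fun x => ?_) (add_zero _).symm ?_
  · change (f.1 x + X.zeta (f.1 x)) - x = X.zeta (f.1 x) + (f.1 x - x)
    ring
  · change (X.ubar (f.1 x) + X.c * χ (f.1 x)) - X.c * χ x =
      (X.ubar (f.1 x) + X.c * (χ (f.1 x) - χ x)) + 0
    ring
  · change _ = f.dcomp X.h + 0
    rw [add_zero]
    exact Lp.ext ((X.relabel_h χ f).trans (f.coeFn_dcomp X.h).symm)

end E

/-! ### Equivariance -/

/-- Change of variables. -/
lemma Relabeling.integral_comp_mul_deriv (f : Relabeling) (u : ℝ → ℝ) :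
    ∫ ξ, u (f.1 ξ) * deriv f.1 ξ = ∫ ξ, u ξ := by
  obtain ⟨K, hK⟩ := f.lip
  let D : Set ℝ := {x | DifferentiableAt ℝ f.1 x}
  have hD : MeasurableSet D := measurableSet_of_differentiableAt ℝ f.1
  have hDc : volume Dᶜ = 0 := hK.ae_differentiableAt_real
  have hDI : (D : Set ℝ) =ᵐ[volume] univ := by
    filter_upwards [hK.ae_differentiableAt_real] with x hx
    exact propext ⟨fun _ => trivial, fun _ => hx⟩
  have himg : (f.1 '' D : Set ℝ) =ᵐ[volume] univ := by
    have h0 : volume (f.1 '' Dᶜ) = 0 := by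
      refine le_antisymm ((volume_image_le hK _).trans ?_) bot_le
      rw [hDc, mul_zero]
    filter_upwards [measure_eq_zero_iff_ae_notMem.1 h0] with z hz
    refine propext ⟨fun _ => trivial, fun _ => ⟨f.1.symm z, ?_, f.1.apply_symm_apply z⟩⟩
    by_contra hn
    exact hz ⟨_, hn, f.1.apply_symm_apply z⟩
  have key := integral_image_eq_integral_abs_deriv_smul (s := D) (f := f.1)
    (f' := deriv f.1) hD
    (fun x hx => (DifferentiableAt.hasDerivAt hx).hasDerivWithinAt) f.1.injective.injOn u
  rw [setIntegral_congr_set himg, setIntegral_congr_set hDI, setIntegral_univ, setIntegral_univ]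
    at key
  rw [key]
  refine integral_congr_ae ?_
  filter_upwards [f.ae_deriv_pos] with x h2
  rw [abs_of_pos h2, smul_eq_mul, mul_comm]

namespace E

variable {χ : PartitionFunction} {X : E} (f : Relabeling)

lemma density_relabel (hX : MemG χ X) :
    (X.relabel χ f).density χ =ᵐ[volume] fun ξ => X.density χ (f.1 ξ) * deriv f.1 ξ := by
  filter_upwards [E.deriv_relabel_y χ f hX, X.relabel_h χ f] with ξ h1 h2
  rw [density, density, h1, h2, Ubar, Ubar, relabel_U, relabel_y, relabel_c]; ring

/-- The density transforms with a factor f_ξ, which is exactly the Jacobian of η ↦ f(η) in the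
integral. -/
lemma P_relabel (hX : MemG χ X) (ξ : ℝ) : P χ (X.relabel χ f) ξ = P χ X (f.1 ξ) := by
  rw [P, P, relabel_y, relabel_c]
  congr 2
  rw [← f.integral_comp_mul_deriv (fun η => Real.exp (-|X.y (f.1 ξ) - X.y η|) * X.density χ η)]
  refine integral_congr_ae ?_
  filter_upwards [density_relabel f hX] with η h
  rw [h, relabel_y]; ring

/-- As for P, and sign(ξ - η) is unchanged because f is increasing. -/
lemma Q_relabel (hX : MemG χ X) (ξ : ℝ) : Q χ (X.relabel χ f) ξ = Q χ X (f.1 ξ) := by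
  rw [Q, Q, relabel_y, relabel_c]
  congr 2
  rw [← f.integral_comp_mul_deriv (fun η => Real.sign (f.1 ξ - η) *
    Real.exp (-|X.y (f.1 ξ) - X.y η|) * X.density χ η)]
  refine integral_congr_ae ?_
  filter_upwards [density_relabel f hX] with η h
  have hs : Real.sign (f.1 ξ - f.1 η) = Real.sign (ξ - η) := by
    rcases lt_trichotomy ξ η with h | h | h
    · rw [Real.sign_of_neg (sub_neg.2 (f.strictMono h)), Real.sign_of_neg (sub_neg.2 h)]
    · rw [h, sub_self, sub_self]
    · rw [Real.sign_of_pos (sub_pos.2 (f.strictMono h)), Real.sign_of_pos (sub_pos.2 h)]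
  rw [h, relabel_y, hs]; ring

lemma isVelocity_relabel (hX : MemG χ X) {D : E} (hD : IsVelocity χ X D) :
    IsVelocity χ (X.relabel χ f) (relabelLin χ f D) where
  zeta_eq ξ := by rw [relabelLin_zeta, relabel_U, hD.zeta_eq]
  U_eq ξ := by rw [relabelLin_U, Q_relabel f hX, hD.U_eq]
  h_eq := by
    filter_upwards [relabelLin_h χ f D, f.ae_comp hD.h_eq, E.deriv_relabel_U χ f hX]
      with ξ h1 h2 h3
    rw [h1, h2, h3, relabel_U, P_relabel f hX]; ring

end E

/-- The flow is equivariant with respect to relabeling. -/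
theorem flow_relabel {χ : PartitionFunction} (t : ℝ≥0) (X : F χ) (f : Relabeling) :
    flow t (X.relabel f) = (flow t X).relabel f := by
  refine Subtype.ext ?_
  have hY : SolvesGlobally (E.field χ) fun s => (augFlow X s).1.relabel χ f := by
    intro s hs
    have hF := augFlow_memF X hs
    -- The derivative of the relabeled curve is the linear part applied to the velocity. It is a
    -- velocity at the relabeled point, hence equals the field there.
    have h1 := (HasDerivWithinAt.clm_apply' (E.relabelLin χ f) (augFlow_solves_fst X s hs)).add_const
      (E.mk (Sob.mk f.memSob_sub_id) 0 0 0)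
    simp only [← E.relabel_eq] at h1
    have hv := E.isVelocity_relabel f hF.1
      (E.isVelocity_field χ (E.monotone_y_of_deriv_nonneg hF.1.y_deriv_nonneg))
    rwa [hv.eq_field χ (E.monotone_y_of_deriv_nonneg (hF.1.relabel f).y_deriv_nonneg)] at h1
  have := flow_unique (X := X.relabel f) hY (by rw [augFlow_zero]; rfl) t
  exact this.symm

/-! ### Continuity of composition -/

lemma L2.norm_le_of_support {u : L2} {v : ℝ → ℝ} {ε M : ℝ} (hε : 0 ≤ ε) (hM : 0 ≤ M) (hu : Rep u v)
    (hv : ∀ x, |v x| ≤ ε) (hs : ∀ x, M < |x| → v x = 0) : ‖u‖ ≤ √(2 * M) * ε := by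
  refine le_of_sq_le_sq ?_ (by positivity)
  rw [mul_pow, Real.sq_sqrt (by positivity), L2.norm_sq]
  have e : ∫ x, (Icc (-M) M).indicator (fun _ => ε ^ 2) x = 2 * M * ε ^ 2 := by
    rw [integral_indicator measurableSet_Icc, setIntegral_const, smul_eq_mul, Real.volume_real_Icc_of_le
      (by linarith)]
    ring
  rw [← e]
  refine integral_mono_ae (Lp.memLp u).integrable_sq ((integrable_indicator_iff
    measurableSet_Icc).2 (by simp [integrableOn_const_iff])) ?_
  filter_upwards [hu] with x hx
  rw [hx]
  by_cases h : x ∈ Icc (-M) M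
  · rw [indicator_of_mem h, ← sq_abs]
    exact pow_le_pow_left₀ (abs_nonneg _) (hv x) 2
  · rw [indicator_of_notMem h, hs x (not_le.1 fun h' => h (abs_le.1 h'))]
    simp

section Comp

variable {ι : Type*} {l : Filter ι} {b : ι → ℝ}

/-- φ is constant near each end, which covers both compactly supported functions and χ itself. The
differences are then uniformly small by uniform continuity and live on one bounded interval, hence
tend to 0 in L². -/
lemma tendsto_zero_of_comp {φ : ℝ → ℝ} (hφ : UniformContinuous φ) {M : ℝ}
    (hM : ∀ x y, (M ≤ x ∧ M ≤ y) ∨ (x ≤ -M ∧ y ≤ -M) → φ x = φ y) {g : ι → ℝ → ℝ} {g₀ : ℝ → ℝ} {C : ℝ}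
    (hC : ∀ x, |g₀ x - x| ≤ C) (hb : Tendsto b l (𝓝 0)) (hg : ∀ᶠ i in l, ∀ x, |g i x - g₀ x| ≤ b i)
    {u : ι → L2} (hu : ∀ i, Rep (u i) fun x => φ (g i x) - φ (g₀ x)) : Tendsto u l (𝓝 0) := by
  rw [tendsto_zero_iff_norm_tendsto_zero]
  -- For |x| > N the point g₀(x) is beyond ±(|M| + 1), and the last 1 leaves room for g(x), which is
  -- eventually within distance 1.
  set N := |M| + C + 1
  have hC0 : 0 ≤ C := (abs_nonneg _).trans (hC 0)
  have hN : 0 ≤ N := by positivity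
  have key : ∀ ε > 0, ∀ᶠ i in l, ‖u i‖ ≤ √(2 * N) * ε := by
    intro ε hε
    obtain ⟨δ, hδ, H⟩ := Metric.uniformContinuous_iff.1 hφ ε hε
    filter_upwards [hg, hb.eventually_lt_const hδ, hb.eventually_lt_const one_pos] with i h1 h2 h3
    refine L2.norm_le_of_support hε.le hN (hu i) (fun x => ?_) fun x hx => ?_
    · rw [← Real.dist_eq]
      exact (H ((Real.dist_eq _ _).trans_lt ((h1 x).trans_lt h2))).le
    · have a1 := abs_le.1 (hC x)
      have a2 := abs_le.1 ((h1 x).trans h3.le)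
      have a3 := le_abs_self M
      have a4 := neg_abs_le M
      refine sub_eq_zero.2 (hM _ _ ?_)
      rcases lt_abs.1 hx with h | h
      · left; constructor <;> linarith
      · right; constructor <;> linarith
  rw [Metric.tendsto_nhds]
  intro ε hε
  filter_upwards [key (ε / (√(2 * N) + 1)) (by positivity)] with i hi
  rw [Real.dist_0_eq_abs, abs_of_nonneg (norm_nonneg _)]
  refine hi.trans_lt ?_
  rw [mul_div_assoc', div_lt_iff₀ (by positivity)]
  nlinarith [Real.sqrt_nonneg (2 * N)]

/-- Composition is not norm continuous in g. It is strongly continuous: the operators are uniformly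
bounded by √K, so u₀ may be replaced by a continuous function of compact support, for which uniform
convergence of g suffices. -/
lemma tendsto_comp {g : ι → Relabeling} {g₀ : Relabeling} {K : ℝ≥0}
    (hK : ∀ᶠ i in l, LipschitzWith K (g i).1.symm) (hK0 : LipschitzWith K g₀.1.symm)
    (hb : Tendsto b l (𝓝 0)) (hg : ∀ᶠ i in l, ∀ x, |(g i).1 x - g₀.1 x| ≤ b i)
    {u : ι → L2} {u₀ : L2} (hu : Tendsto u l (𝓝 u₀)) :
    Tendsto (fun i => (g i).comp (u i)) l (𝓝 (g₀.comp u₀)) := by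
  obtain ⟨C, hC⟩ := bound_of_memLp_top g₀.2.memSob.locAC.continuous g₀.2.memSob.memLp
  rw [Metric.tendsto_nhds]
  intro ε hε
  -- Three of the four terms below are at most √K δ < ε/4; the fourth is the convergence for the
  -- approximating function.
  set δ := ε / (4 * (√K + 1)) with hδdef
  have hδ : 0 < δ := by positivity
  have hKδ : √K * δ < ε / 4 := by
    rw [hδdef, mul_div_assoc', div_lt_div_iff₀ (by positivity) (by norm_num)]
    nlinarith [Real.sqrt_nonneg (K : ℝ)]
  obtain ⟨φ, hφs, hφn, hφc, hφm⟩ := (Lp.memLp u₀).exists_hasCompactSupport_eLpNorm_sub_le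
    (by norm_num) (ENNReal.ofReal_pos.2 hδ).ne'
  set φL : L2 := hφm.toLp φ
  have hnear : ‖u₀ - φL‖ ≤ δ := by
    have e : ‖u₀ - φL‖ = (eLpNorm (⇑u₀ - φ) 2 volume).toReal := by
      rw [Lp.norm_def]
      congr 1
      refine eLpNorm_congr_ae ?_
      filter_upwards [Lp.coeFn_sub u₀ φL, MemLp.coeFn_toLp hφm] with x h1 h2
      rw [h1, Pi.sub_apply, Pi.sub_apply, h2]
    rw [e]
    exact ENNReal.toReal_le_of_le_ofReal hδ.le hφn
  obtain ⟨M, hM⟩ := hφs.isCompact.isBounded.subset_closedBall 0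
  have hφ0 : ∀ x, M + 1 ≤ |x| → φ x = 0 := fun x hx => by
    by_contra h
    have := hM (subset_tsupport _ h)
    rw [mem_closedBall_zero_iff, Real.norm_eq_abs] at this
    linarith
  have hcomp := tendsto_zero_of_comp (φ := φ)
    (hφc.uniformContinuous_of_tendsto_cocompact hφs.is_zero_at_infty) (M := |M| + 1)
    (fun x y h => by
      have h1 := le_abs_self M
      rcases h with ⟨hx, hy⟩ | ⟨hx, hy⟩
      · rw [hφ0 x (by linarith [le_abs_self x]), hφ0 y (by linarith [le_abs_self y])]
      · rw [hφ0 x (by linarith [neg_le_abs x]), hφ0 y (by linarith [neg_le_abs y])])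
    hC hb hg (u := fun i => (g i).comp φL - g₀.comp φL) (fun i => by
      refine ((Rep.refl _).sub (Rep.refl _)).congr ?_
      filter_upwards [(g i).coeFn_comp φL, g₀.coeFn_comp φL,
        (g i).ae_comp (MemLp.coeFn_toLp hφm), g₀.ae_comp (MemLp.coeFn_toLp hφm)] with x h1 h2 h3 h4
      rw [h1, h2, h3, h4])
  filter_upwards [hK, Metric.tendsto_nhds.1 hcomp (ε / 4) (by positivity),
    Metric.tendsto_nhds.1 hu δ hδ] with i h1 h2 h3
  rw [dist_zero_right] at h2
  rw [dist_eq_norm] at h3 ⊢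
  have e : (g i).comp (u i) - g₀.comp u₀ = (g i).comp (u i - u₀) + (g i).comp (u₀ - φL) +
      ((g i).comp φL - g₀.comp φL) - g₀.comp (u₀ - φL) := by
    simp only [map_sub]; abel
  have n1 : ‖(g i).comp (u i - u₀)‖ ≤ √K * δ :=
    ((g i).norm_comp_le h1 _).trans (mul_le_mul_of_nonneg_left h3.le (Real.sqrt_nonneg _))
  have n2 : ‖(g i).comp (u₀ - φL)‖ ≤ √K * δ :=
    ((g i).norm_comp_le h1 _).trans (mul_le_mul_of_nonneg_left hnear (Real.sqrt_nonneg _))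
  have n3 : ‖g₀.comp (u₀ - φL)‖ ≤ √K * δ :=
    (g₀.norm_comp_le hK0 _).trans (mul_le_mul_of_nonneg_left hnear (Real.sqrt_nonneg _))
  rw [e]
  have m1 := norm_sub_le ((g i).comp (u i - u₀) + (g i).comp (u₀ - φL) +
    ((g i).comp φL - g₀.comp φL)) (g₀.comp (u₀ - φL))
  have m2 := norm_add_le ((g i).comp (u i - u₀) + (g i).comp (u₀ - φL))
    ((g i).comp φL - g₀.comp φL)
  have m3 := norm_add_le ((g i).comp (u i - u₀)) ((g i).comp (u₀ - φL))
  linarith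

end Comp

/-! ### Division by `y_ξ + h` -/

namespace E

variable {χ : PartitionFunction} {X X' : E} {K : ℝ}

lemma memLp_div (hK : 0 < K) (h : Cone χ K X) (u : L2) :
    MemLp (fun ξ => u ξ / (1 + X.zx ξ + X.h ξ)) 2 volume := by
  refine (Lp.memLp u).of_le_mul (c := K) ((Lp.memLp u).1.aemeasurable.div
    ((aestronglyMeasurable_const.add (Lp.memLp X.zx).1).add
      (Lp.memLp X.h).1).aemeasurable).aestronglyMeasurable ?_
  filter_upwards [h] with ξ ⟨_, h1, _⟩
  have hw : 0 < 1 + X.zx ξ + X.h ξ := (inv_pos.2 hK).trans_le h1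
  rw [norm_div, Real.norm_of_nonneg hw.le, div_le_iff₀ hw]
  calc ‖u ξ‖ = K * ‖u ξ‖ * K⁻¹ := by field_simp
    _ ≤ _ := by gcongr

open Classical in
/-- `u / (y_ξ + h)`. -/
def divw (X : E) (u : L2) : L2 :=
  if h : MemLp (fun ξ => u ξ / (1 + X.zx ξ + X.h ξ)) 2 volume then h.toLp _ else 0

lemma coeFn_divw (hK : 0 < K) (h : Cone χ K X) (u : L2) :
    Rep (X.divw u) fun ξ => u ξ / (1 + X.zx ξ + X.h ξ) := by
  rw [divw, dif_pos (memLp_div hK h u)]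
  exact MemLp.coeFn_toLp _

/-- The differences of the denominators are controlled in L² only, so their factor must be bounded:
u'/w' is, by hypothesis on u' alone. The identity is u/w - u'/w' = ((u - u') + (u'/w')(w' - w))/w,
with 1/w ≤ K. -/
lemma norm_divw_sub_le (hK : 0 < K) (h : Cone χ K X) (h' : Cone χ K X') {u u' : L2}
    (hu : ∀ᵐ ξ : ℝ, |u' ξ| ≤ 1 + X'.zx ξ + X'.h ξ) :
    ‖X.divw u - X'.divw u'‖ ≤ K * (‖u - u'‖ + (‖X.zx - X'.zx‖ + ‖X.h - X'.h‖)) := by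
  have key : ‖X.divw u - X'.divw u'‖ ≤ K * ‖|u - u'| + (|X.zx - X'.zx| + |X.h - X'.h|)‖ := by
    refine Lp.norm_le_mul_norm_of_ae_le_mul ?_
    filter_upwards [h, h', hu, (coeFn_divw hK h u).sub (coeFn_divw hK h' u'),
      Lp.coeFn_add |u - u'| (|X.zx - X'.zx| + |X.h - X'.h|),
      Lp.coeFn_add |X.zx - X'.zx| |X.h - X'.h|, Lp.coeFn_abs (u - u'), Lp.coeFn_abs (X.zx - X'.zx),
      Lp.coeFn_abs (X.h - X'.h), Lp.coeFn_sub u u', Lp.coeFn_sub X.zx X'.zx, Lp.coeFn_sub X.h X'.h]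
      with ξ ⟨_, a1, _⟩ ⟨_, b1, _⟩ hu e1 e2 e3 e4 e5 e6 e7 e8 e9
    rw [e1, e2, Pi.add_apply, e3, Pi.add_apply, e4, e5, e6, e7, e8, e9, Pi.sub_apply, Pi.sub_apply,
      Pi.sub_apply]
    set w := 1 + X.zx ξ + X.h ξ with hw
    set w' := 1 + X'.zx ξ + X'.h ξ with hw'
    have pw : 0 < w := (inv_pos.2 hK).trans_le a1
    have pw' : 0 < w' := (inv_pos.2 hK).trans_le b1
    have q1 : |u' ξ / w'| ≤ 1 := by
      rw [abs_div, abs_of_pos pw', div_le_one pw']; exact hu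
    have q2 : |w' - w| ≤ |X.zx ξ - X'.zx ξ| + |X.h ξ - X'.h ξ| := by
      rw [abs_sub_comm]
      have : w - w' = (X.zx ξ - X'.zx ξ) + (X.h ξ - X'.h ξ) := by rw [hw, hw']; ring
      rw [this]; exact abs_add_le _ _
    have q3 : u ξ / w - u' ξ / w' = ((u ξ - u' ξ) + u' ξ / w' * (w' - w)) / w := by
      field_simp; ring
    have q4 : |u' ξ / w' * (w' - w)| ≤ |X.zx ξ - X'.zx ξ| + |X.h ξ - X'.h ξ| := by
      rw [abs_mul]
      exact (mul_le_of_le_one_left (abs_nonneg _) q1).trans q2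
    have q5 := abs_add_le (u ξ - u' ξ) (u' ξ / w' * (w' - w))
    have q6 : 0 ≤ |u ξ - u' ξ| + (|X.zx ξ - X'.zx ξ| + |X.h ξ - X'.h ξ|) := by positivity
    rw [Real.norm_eq_abs, Real.norm_of_nonneg q6, q3, abs_div, abs_of_pos pw, div_le_iff₀ pw]
    calc _ ≤ |u ξ - u' ξ| + (|X.zx ξ - X'.zx ξ| + |X.h ξ - X'.h ξ|) := by linarith
      _ = K * (|u ξ - u' ξ| + (|X.zx ξ - X'.zx ξ| + |X.h ξ - X'.h ξ|)) * K⁻¹ := by field_simp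
      _ ≤ _ := by gcongr
  refine key.trans (mul_le_mul_of_nonneg_left ((norm_add_le _ _).trans ?_) hK.le)
  rw [norm_abs_eq_norm]
  refine add_le_add_right ((norm_add_le _ _).trans ?_) _
  rw [norm_abs_eq_norm, norm_abs_eq_norm]

/-- A bound for the distance of the `h`-components in `L¹`. -/
def dist1 (χ : PartitionFunction) (K : ℝ) (X X' : E) : ℝ :=
  K * (‖X.Ux χ - X'.Ux χ‖ * (‖X.Ux χ‖ + ‖X'.Ux χ‖) + ‖X.h - X'.h‖ * (‖X.h‖ + ‖X'.h‖)
    + ‖X'.h‖ * (‖X.zx - X'.zx‖ + ‖X.h - X'.h‖))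

lemma L2_integral_mul_add_le (u v v' : L2) :
    Integrable (fun ξ => |u ξ| * (|v ξ| + |v' ξ|)) ∧
      ∫ ξ, |u ξ| * (|v ξ| + |v' ξ|) ≤ ‖u‖ * (‖v‖ + ‖v'‖) := by
  have i := (L2.integrable_mul u v).abs.add (L2.integrable_mul u v').abs
  have e : (fun ξ => |u ξ| * (|v ξ| + |v' ξ|)) = fun ξ => |u ξ * v ξ| + |u ξ * v' ξ| := by
    ext ξ; rw [abs_mul, abs_mul]; ring
  rw [e]
  refine ⟨i, ?_⟩
  rw [integral_add (L2.integrable_mul u v).abs (L2.integrable_mul u v').abs, mul_add]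
  exact add_le_add (L2.integral_mul_le u v) (L2.integral_mul_le u v')

/-- On the cone (y_ξ + h) h = U_ξ² + h² is quadratic in L² functions. Multiplying h - h' by y_ξ + h
≥ K⁻¹ turns it into a sum of products of L² functions, each with a small factor. So convergence in E
forces convergence of h in L¹, hence uniform convergence of H. -/
lemma integral_h_sub_le (hK : 0 < K) (h : Cone χ K X) (h' : Cone χ K X') :
    ∫ ξ, |X.h ξ - X'.h ξ| ≤ dist1 χ K X X' := by
  obtain ⟨i1, n1⟩ := L2_integral_mul_add_le (X.Ux χ - X'.Ux χ) (X.Ux χ) (X'.Ux χ)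
  obtain ⟨i2, n2⟩ := L2_integral_mul_add_le (X.h - X'.h) X.h X'.h
  obtain ⟨i3, n3⟩ := L2_integral_mul_add_le X'.h (X.zx - X'.zx) (X.h - X'.h)
  have hint := ((i1.add i2).add i3).const_mul K
  have e := integral_add (i1.add i2) i3
  have e' := integral_add i1 i2
  simp only [Pi.add_apply] at e
  calc ∫ ξ, |X.h ξ - X'.h ξ| ≤ _ := integral_mono_ae
        ((integrable_h hK h).sub (integrable_h hK h')).abs hint ?_
    _ ≤ dist1 χ K X X' := by
      rw [integral_const_mul]
      simp only [Pi.add_apply]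
      rw [e, e', dist1]
      exact mul_le_mul_of_nonneg_left (add_le_add (add_le_add n1 n2) n3) hK.le
  filter_upwards [h, h', Lp.coeFn_sub (X.Ux χ) (X'.Ux χ), Lp.coeFn_sub X.zx X'.zx,
    Lp.coeFn_sub X.h X'.h] with ξ ⟨⟨_, _, a1⟩, a2, _⟩ ⟨⟨_, _, b1⟩, _⟩ e1 e2 e3
  simp only [Pi.add_apply]
  rw [e1, e2, e3, Pi.sub_apply, Pi.sub_apply, Pi.sub_apply]
  have pw : 0 < 1 + X.zx ξ + X.h ξ := (inv_pos.2 hK).trans_le a2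
  have id1 : (1 + X.zx ξ + X.h ξ) * (X.h ξ - X'.h ξ) =
      (X.Ux χ ξ - X'.Ux χ ξ) * (X.Ux χ ξ + X'.Ux χ ξ) + (X.h ξ - X'.h ξ) * (X.h ξ + X'.h ξ)
      - X'.h ξ * ((X.zx ξ - X'.zx ξ) + (X.h ξ - X'.h ξ)) := by
    linear_combination a1 - b1
  have id2 : |(1 + X.zx ξ + X.h ξ) * (X.h ξ - X'.h ξ)| ≤
      |X.Ux χ ξ - X'.Ux χ ξ| * (|X.Ux χ ξ| + |X'.Ux χ ξ|)
      + |X.h ξ - X'.h ξ| * (|X.h ξ| + |X'.h ξ|)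
      + |X'.h ξ| * (|X.zx ξ - X'.zx ξ| + |X.h ξ - X'.h ξ|) := by
    rw [id1]
    refine (abs_sub _ _).trans (add_le_add ((abs_add_le _ _).trans (add_le_add ?_ ?_)) ?_) <;>
    · rw [abs_mul]
      exact mul_le_mul_of_nonneg_left (abs_add_le _ _) (abs_nonneg _)
  rw [abs_mul, abs_of_pos pw] at id2
  calc |X.h ξ - X'.h ξ| = K * (K⁻¹ * |X.h ξ - X'.h ξ|) := by field_simp
    _ ≤ K * ((1 + X.zx ξ + X.h ξ) * |X.h ξ - X'.h ξ|) := by gcongr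
    _ ≤ _ := mul_le_mul_of_nonneg_left id2 hK.le

lemma abs_H_sub_le (hK : 0 < K) (h : Cone χ K X) (h' : Cone χ K X') (ξ : ℝ) :
    |X.H ξ - X'.H ξ| ≤ dist1 χ K X X' := by
  have i := integrable_h hK h
  have i' := integrable_h hK h'
  rw [H, H, ← integral_sub i.integrableOn i'.integrableOn]
  refine (abs_integral_le_integral_abs).trans (le_trans ?_ (integral_h_sub_le hK h h'))
  exact setIntegral_le_integral (i.sub i').abs (ae_of_all _ fun _ => abs_nonneg _)

end E

/-! ### The map `Γ` -/

namespace F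

variable {χ : PartitionFunction} {K : ℝ}

lemma lipschitz_total (X : F χ) (hK : 0 < K) (h : Cone χ K X.1) :
    LipschitzWith K.toNNReal X.total.1 := LipschitzWith.of_dist_le_mul fun a b => by
  rw [Real.coe_toNNReal _ hK.le, Real.dist_eq, Real.dist_eq, total_apply, total_apply]
  exact (E.abs_total_sub_bounds hK h a b).2

/-- With a and b the preimages of x, the bi-Lipschitz bound for the first map reduces |a - b| to the
difference of the two maps at the same point b. -/
lemma abs_symm_sub_le (X X' : F χ) (hK : 0 < K) (h : Cone χ K X.1) (h' : Cone χ K X'.1) (x : ℝ) :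
    |X.total.1.symm x - X'.total.1.symm x| ≤
      K * (‖X.1.zB - X'.1.zB‖ + E.dist1 χ K X.1 X'.1) := by
  set a := X.total.1.symm x
  set b := X'.total.1.symm x
  have ha : X.1.y a + X.1.H a = x := by rw [← total_apply]; exact X.total.1.apply_symm_apply x
  have hb : X'.1.y b + X'.1.H b = x := by rw [← total_apply]; exact X'.total.1.apply_symm_apply x
  refine (E.abs_total_sub_bounds hK h a b).1.trans (mul_le_mul_of_nonneg_left ?_ hK.le)
  rw [ha, ← hb]
  have e : X'.1.y b + X'.1.H b - (X.1.y b + X.1.H b) =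
      (X'.1.zB b - X.1.zB b) + (X'.1.H b - X.1.H b) := by
    rw [E.zB_apply, E.zB_apply, E.y, E.y]; ring
  rw [e]
  refine (abs_add_le _ _).trans (add_le_add ?_ ?_)
  · rw [abs_sub_comm]; exact (X.1.zB - X'.1.zB).norm_coe_le_norm b
  · rw [abs_sub_comm]; exact E.abs_H_sub_le hK h h' b

/-- `(y + H)⁻¹` has derivative `1 / (y_ξ + h)`. -/
lemma ae_deriv_total_inv (X : F χ) (hK : 0 < K) (h : Cone χ K X.1) :
    ∀ᵐ ξ : ℝ, deriv (X.total⁻¹ : Relabeling).1 ξ =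
      1 / (1 + X.1.zx ((X.total⁻¹ : Relabeling).1 ξ) + X.1.h ((X.total⁻¹ : Relabeling).1 ξ)) := by
  set g : Relabeling := X.total⁻¹
  have e : ∀ ξ, X.total.1 (g.1 ξ) = ξ := fun ξ => X.total.1.apply_symm_apply ξ
  obtain ⟨L, hL⟩ := g.lip
  have hd : ∀ᵐ ξ : ℝ, HasDerivAt X.total.1 (1 + X.1.zx ξ + X.1.h ξ) ξ := by
    rw [show (X.total.1 : ℝ → ℝ) = fun ξ => X.1.y ξ + X.1.H ξ from funext X.total_apply]
    exact E.ae_hasDerivAt_total (E.integrable_h hK h).integrableOn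
  filter_upwards [g.ae_comp hd, hL.ae_differentiableAt_real, g.ae_comp h] with ξ h1 h2 ⟨_, h3, _⟩
  have h4 := h1.comp ξ h2.hasDerivAt
  rw [show X.total.1 ∘ g.1 = id from funext e] at h4
  have h5 := h4.unique (hasDerivAt_id ξ)
  rw [eq_div_iff ((inv_pos.2 hK).trans_le h3).ne', mul_comm]
  exact h5

lemma Gam_h (X : F χ) (hK : 0 < K) (h : Cone χ K X.1) :
    X.Gam.1.h = X.total⁻¹.comp (X.1.divw X.1.h) := by
  refine Lp.ext ?_
  filter_upwards [X.1.relabel_h χ X.total⁻¹, X.ae_deriv_total_inv hK h,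
    X.total⁻¹.coeFn_comp (X.1.divw X.1.h), X.total⁻¹.ae_comp (E.coeFn_divw hK h X.1.h)]
    with ξ h1 h2 h3 h4
  rw [h3, h4]
  refine h1.trans ?_
  rw [h2]; ring

/-- For Γ(X) one has y_ξ + h = 1, so ζ_ξ = -h and needs no limit of its own. -/
lemma Gam_zx (X : F χ) (hK : 0 < K) (h : Cone χ K X.1) :
    X.Gam.1.zx = -X.total⁻¹.comp (X.1.divw X.1.h) := by
  refine Lp.ext ?_
  filter_upwards [E.deriv_relabel_y χ X.total⁻¹ X.2.1, X.ae_deriv_total_inv hK h,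
    X.total⁻¹.coeFn_comp (X.1.divw X.1.h), X.total⁻¹.ae_comp (E.coeFn_divw hK h X.1.h),
    X.Gam.1.ae_deriv_y, X.total⁻¹.ae_comp X.1.ae_deriv_y, X.total⁻¹.ae_comp h,
    Lp.coeFn_neg (X.total⁻¹.comp (X.1.divw X.1.h))] with ξ h1 h2 h3 h4 h5 h6 ⟨_, h7, _⟩ h8
  rw [h8, Pi.neg_apply, h3, h4]
  have h9 : 1 + X.Gam.1.zx ξ = _ := h5.symm.trans h1
  rw [h6, h2] at h9
  have hw := ((inv_pos.2 hK).trans_le h7).ne'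
  have h10 : X.Gam.1.zx ξ = _ := eq_sub_of_add_eq' h9
  rw [h10]
  field_simp; ring

lemma Gam_Ux (X : F χ) (hK : 0 < K) (h : Cone χ K X.1) :
    X.Gam.1.Ux χ = X.total⁻¹.comp (X.1.divw (X.1.Ux χ)) := by
  refine Lp.ext ?_
  filter_upwards [E.deriv_relabel_U χ X.total⁻¹ X.2.1, X.ae_deriv_total_inv hK h,
    X.total⁻¹.coeFn_comp (X.1.divw (X.1.Ux χ)), X.total⁻¹.ae_comp (E.coeFn_divw hK h (X.1.Ux χ)),
    X.Gam.1.rep_Ux χ, X.total⁻¹.ae_comp (X.1.rep_Ux χ)] with ξ h1 h2 h3 h4 h5 h6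
  rw [h3, h4, h5]
  refine h1.trans ?_
  rw [h6, h2]; ring

lemma Gam_ubL (X : F χ) :
    X.Gam.1.ubL = X.total⁻¹.comp X.1.ubL + X.1.c • H1.toL2 (E.dchi χ X.total⁻¹) := by
  have e : X.Gam.1.ubar = X.total⁻¹.compH1 X.1.ubar + X.1.c • E.dchi χ X.total⁻¹ + 0 :=
    congrArg E.ubar (E.relabel_eq χ X.total⁻¹ X.1)
  rw [add_zero] at e
  rw [E.ubL, e, map_add, map_smul]
  congr 1
  exact X.total⁻¹.toL2_comp_H1 X.1.ubar

end F

/-! ### Continuity of `Γ` -/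

section Continuity

variable {ι : Type*} {l : Filter ι} {χ : PartitionFunction} {K : ℝ}

lemma E.tendsto_of_components (χ : PartitionFunction) {X : ι → E} {X₀ : E}
    (h1 : Tendsto (fun i => (X i).zB) l (𝓝 X₀.zB)) (h2 : Tendsto (fun i => (X i).zx) l (𝓝 X₀.zx))
    (h3 : Tendsto (fun i => (X i).ubL) l (𝓝 X₀.ubL))
    (h4 : Tendsto (fun i => (X i).Ux χ) l (𝓝 (X₀.Ux χ)))
    (h5 : Tendsto (fun i => (X i).c) l (𝓝 X₀.c)) (h6 : Tendsto (fun i => (X i).h) l (𝓝 X₀.h)) :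
    Tendsto X l (𝓝 X₀) := by
  have h7 : Tendsto (fun i => H1.dL (X i).ubar) l (𝓝 (H1.dL X₀.ubar)) := by
    have e : ∀ Y : E, H1.dL Y.ubar = Y.Ux χ - Y.c • χ.dL := fun Y => by rw [E.Ux]; abel
    simp only [e]
    exact h4.sub (h5.smul_const _)
  rw [tendsto_iff_norm_sub_tendsto_zero] at h1 h2 h3 h5 h6 h7 ⊢
  refine squeeze_zero (fun _ => norm_nonneg _) (fun i => ?_)
    (by simpa using ((h1.add h2).add ((h3.add h7).add h5)).add h6)
  rw [E.norm_def]
  refine add_le_add (add_le_add ?_ (add_le_add ?_ le_rfl)) le_rfl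
  · exact (V.norm_eq _).le.trans (add_le_add (le_of_eq (congrArg norm (map_sub V.toBC _ _)))
      (le_of_eq (congrArg norm (map_sub V.dL _ _))))
  · exact (H1.norm_le _).trans (add_le_add (le_of_eq (congrArg norm (map_sub H1.toL2 _ _)))
      (le_of_eq (congrArg norm (map_sub H1.dL _ _))))

/-- Both y and H are nondecreasing, so an increment of y is at most that of y + H. -/
lemma E.abs_y_sub_le {X : E} (hK : 0 < K) (h : Cone χ K X) (a b : ℝ) :
    |X.y a - X.y b| ≤ K * |a - b| := by
  have hy : Monotone X.y := X.monotone_y_of_deriv_nonneg (by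
    filter_upwards [h, X.ae_deriv_y] with ξ h1 h2
    rw [h2]; exact h1.1.1)
  have hi := E.integrable_h hK h
  have hH : Monotone X.H := fun a b hab => setIntegral_mono_set hi.integrableOn
    (ae_restrict_of_ae (Eventually.mono h fun ξ h1 => h1.1.2.1)) (Iic_subset_Iic.2 hab).eventuallyLE
  have key : ∀ a b, a ≤ b → |X.y a - X.y b| ≤ K * |a - b| := fun a b hab => by
    rw [abs_sub_comm, abs_sub_comm a, abs_of_nonneg (sub_nonneg.2 (hy hab)),
      abs_of_nonneg (sub_nonneg.2 hab)]
    linarith [(E.total_sub_bounds hK h hab).2, hH hab]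
  rcases le_total a b with hab | hab
  · exact key a b hab
  · rw [abs_sub_comm, abs_sub_comm a]; exact key b a hab

lemma E.tendsto_dist1 {X : ι → E} {X₀ : E} (h : Tendsto X l (𝓝 X₀)) :
    Tendsto (fun i => E.dist1 χ K (X i) X₀) l (𝓝 0) := by
  have c : Continuous fun Y : E => E.dist1 χ K Y X₀ := by
    have h1 := (E.lipB_Ux (χ := χ)).continuous
    have h2 := E.lipB_zx.continuous
    have h3 := E.lipB_h.continuous
    unfold E.dist1
    fun_prop
  have e : E.dist1 χ K X₀ X₀ = 0 := by simp [E.dist1]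
  rw [← e]
  exact (c.tendsto X₀).comp h

lemma Cone.ae_abs_h_le {X : E} (h : Cone χ K X) :
    ∀ᵐ ξ : ℝ, |X.h ξ| ≤ 1 + X.zx ξ + X.h ξ := by
  filter_upwards [h] with ξ ⟨⟨h1, h2, _⟩, _⟩
  rw [abs_of_nonneg h2]; linarith

lemma Cone.ae_abs_Ux_le {X : E} (h : Cone χ K X) :
    ∀ᵐ ξ : ℝ, |X.Ux χ ξ| ≤ 1 + X.zx ξ + X.h ξ := by
  filter_upwards [h] with ξ ⟨⟨h1, h2, h3⟩, _⟩
  refine abs_le_of_sq_le_sq ?_ (by linarith)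
  rw [← h3]
  nlinarith [mul_nonneg h1 h2]

lemma E.tendsto_divw {X : ι → E} {X₀ : E} (hK : 0 < K) (hC : ∀ᶠ i in l, Cone χ K (X i))
    (h0 : Cone χ K X₀) (h : Tendsto X l (𝓝 X₀)) {u : ι → L2} {u₀ : L2} (hu : Tendsto u l (𝓝 u₀))
    (hu₀ : ∀ᵐ ξ : ℝ, |u₀ ξ| ≤ 1 + X₀.zx ξ + X₀.h ξ) :
    Tendsto (fun i => (X i).divw (u i)) l (𝓝 (X₀.divw u₀)) := by
  have h2 := (E.lipB_zx.continuous.tendsto X₀).comp h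
  have h3 := (E.lipB_h.continuous.tendsto X₀).comp h
  rw [tendsto_iff_norm_sub_tendsto_zero] at h2 h3 hu ⊢
  refine squeeze_zero' (Eventually.of_forall fun _ => norm_nonneg _)
    (hC.mono fun i hi => E.norm_divw_sub_le hK hi h0 hu₀) ?_
  simpa using (hu.add (h2.add h3)).const_mul K

/-- `Γ` is continuous on each cone. -/
theorem F.tendsto_Gam {X : ι → F χ} {X₀ : F χ} (hK : 0 < K) (hC : ∀ᶠ i in l, Cone χ K (X i).1)
    (h0 : Cone χ K X₀.1) (h : Tendsto (fun i => (X i).1) l (𝓝 X₀.1)) :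
    Tendsto (fun i => (X i).Gam.1) l (𝓝 X₀.Gam.1) := by
  set b : ι → ℝ := fun i => K * (‖(X i).1.zB - X₀.1.zB‖ + E.dist1 χ K (X i).1 X₀.1) with hbdef
  have hz := tendsto_iff_norm_sub_tendsto_zero.1 ((E.lipB_zB.continuous.tendsto X₀.1).comp h)
  have hb : Tendsto b l (𝓝 0) := by simpa using (hz.add (E.tendsto_dist1 h)).const_mul K
  have hg : ∀ᶠ i in l, ∀ x,
      |((X i).total⁻¹ : Relabeling).1 x - (X₀.total⁻¹ : Relabeling).1 x| ≤ b i :=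
    hC.mono fun i hi x => F.abs_symm_sub_le (X i) X₀ hK hi h0 x
  have hl : ∀ᶠ i in l, LipschitzWith K.toNNReal ((X i).total⁻¹ : Relabeling).1.symm :=
    hC.mono fun i hi => (X i).lipschitz_total hK hi
  have hl0 : LipschitzWith K.toNNReal (X₀.total⁻¹ : Relabeling).1.symm := X₀.lipschitz_total hK h0
  have th := tendsto_comp hl hl0 hb hg (E.tendsto_divw hK hC h0 h
    ((E.lipB_h.continuous.tendsto X₀.1).comp h) h0.ae_abs_h_le)
  have tU := tendsto_comp hl hl0 hb hg (E.tendsto_divw hK hC h0 h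
    (((E.lipB_Ux (χ := χ)).continuous.tendsto X₀.1).comp h) h0.ae_abs_Ux_le)
  have tu := tendsto_comp hl hl0 hb hg (((LipB.clm (H1.toL2 ∘L E.ubarL)).continuous.tendsto X₀.1).comp h)
  have tc := (E.lipB_c.continuous.tendsto X₀.1).comp h
  -- The splitting U = ū + cχ is not preserved by composition: the correction c(χ∘g - χ) has to
  -- converge as well, and does so since χ is constant outside [0, 1].
  have tχ : Tendsto (fun i => H1.toL2 (E.dchi χ (X i).total⁻¹)) l
      (𝓝 (H1.toL2 (E.dchi χ X₀.total⁻¹))) := by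
    obtain ⟨L, hL⟩ := χ.lip
    obtain ⟨C, hC⟩ := bound_of_memLp_top (X₀.total⁻¹).2.memSob.locAC.continuous
      (X₀.total⁻¹).2.memSob.memLp
    rw [← tendsto_sub_nhds_zero_iff]
    refine tendsto_zero_of_comp hL.uniformContinuous (M := 1) (fun x y h => ?_) hC hb hg fun i => ?_
    · rcases h with ⟨h1, h2⟩ | ⟨h1, h2⟩
      · rw [χ.eq_one x h1, χ.eq_one y h2]
      · rw [χ.eq_zero x (by linarith), χ.eq_zero y (by linarith)]
    · refine (Rep.sub (H1.coeFn_toL2 _) (H1.coeFn_toL2 _)).congr (ae_of_all _ fun x => ?_)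
      change (χ (((X i).total⁻¹ : Relabeling).1 x) - χ x) -
        (χ ((X₀.total⁻¹ : Relabeling).1 x) - χ x) = _
      ring
  refine E.tendsto_of_components χ ?_ ?_ ?_ ?_ tc ?_
  · rw [tendsto_iff_norm_sub_tendsto_zero]
    refine squeeze_zero' (g := fun i => ‖(X i).1.zB - X₀.1.zB‖ + K * b i)
      (Eventually.of_forall fun _ => norm_nonneg _) ?_ (by simpa using hz.add (hb.const_mul K))
    filter_upwards [hC, hg] with i hi hgi
    refine (BoundedContinuousFunction.norm_le_of_nonempty).2 fun x => ?_
    set p := ((X i).total⁻¹ : Relabeling).1 x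
    set q := (X₀.total⁻¹ : Relabeling).1 x
    -- Compare ζ_i with ζ₀ at the same point p, then y₀ at p and q; the second difference is handled
    -- by the Lipschitz bound for y₀.
    have e : ((X i).Gam.1.zB - X₀.Gam.1.zB) x =
        ((X i).1.zB - X₀.1.zB) p + (X₀.1.y p - X₀.1.y q) := by
      change ((X i).1.y p - x) - (X₀.1.y q - x) = ((X i).1.zeta p - X₀.1.zeta p) + _
      rw [E.y, E.y, E.y]; ring
    rw [e]
    exact (norm_add_le _ _).trans (add_le_add (((X i).1.zB - X₀.1.zB).norm_coe_le_norm p)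
      ((E.abs_y_sub_le hK h0 p q).trans (mul_le_mul_of_nonneg_left (hgi x) hK.le)))
  · rw [X₀.Gam_zx hK h0]
    exact th.neg.congr' (hC.mono fun i hi => ((X i).Gam_zx hK hi).symm)
  · simp only [F.Gam_ubL]
    exact tu.add (tc.smul tχ)
  · rw [X₀.Gam_Ux hK h0]
    exact tU.congr' (hC.mono fun i hi => ((X i).Gam_Ux hK hi).symm)
  · rw [X₀.Gam_h hK h0]
    exact th.congr' (hC.mono fun i hi => ((X i).Gam_h hK hi).symm)

/-- The flow is jointly continuous on each cone. -/
theorem tendsto_flow {t : ι → ℝ≥0} {t₀ : ℝ≥0} {X : ι → F χ} {X₀ : F χ} (hK : 0 < K)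
    (hC : ∀ i, Cone χ K (X i).1) (h0 : Cone χ K X₀.1) (ht : Tendsto t l (𝓝 t₀))
    (h : Tendsto (fun i => (X i).1) l (𝓝 X₀.1)) :
    Tendsto (fun i => (flow (t i) (X i)).1) l (𝓝 (flow t₀ X₀).1) ∧
      ∃ R, 0 < R ∧ (∀ᶠ i in l, Cone χ R (flow (t i) (X i)).1) ∧ Cone χ R (flow t₀ X₀).1 := by
  -- A common time horizon and a common ball (radius ‖X₀‖ + 1) for all nearby data, so that one a
  -- priori bound R and one Grönwall rate serve for all of them.
  set T : ℝ := t₀ + 1 with hT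
  have hT0 : 0 ≤ T := by positivity
  set B := ‖X₀.1‖ + 1
  obtain ⟨R, hR0, hR⟩ := exists_apriori_bound χ B hT0 hK
  obtain ⟨M, hM⟩ := (lipB_augField χ).dist_le R
  have hB0 : ‖X₀.1‖ ≤ B := by simp [B]
  have hB : ∀ᶠ i in l, ‖(X i).1‖ ≤ B :=
    (h.norm.eventually_lt_const (lt_add_one _)).mono fun i hi => hi.le
  have hti : ∀ᶠ i in l, (t i : ℝ) ≤ T :=
    ((NNReal.tendsto_coe.2 ht).eventually_lt_const (lt_add_one _)).mono fun i hi => hi.le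
  have ht0 : (t₀ : ℝ) ≤ T := by simp [hT]
  have b0 := hR T _ _ (augFlow_augSol X₀ h0 hB0)
  refine ⟨?_, R, hR0, ?_, (b0 t₀ ⟨t₀.2, ht0⟩).2⟩
  · have cont : Tendsto (fun i => augFlow X₀ (t i)) l (𝓝 (augFlow X₀ t₀)) := by
      have : Continuous fun s : ℝ≥0 => augFlow X₀ s :=
        (augFlow_solves X₀).continuousOn.comp_continuous NNReal.continuous_coe fun s => s.2
      exact (this.tendsto t₀).comp ht
    have near : Tendsto (fun i => augFlow (X i) (t i)) l (𝓝 (augFlow X₀ t₀)) := by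
      rw [tendsto_iff_dist_tendsto_zero] at cont h ⊢
      refine squeeze_zero' (g := fun i => dist (X i).1 X₀.1 * Real.exp (|M| * T) +
        dist (augFlow X₀ (t i)) (augFlow X₀ t₀)) (Eventually.of_forall fun _ => dist_nonneg) ?_
        (by simpa using (h.mul_const _).add cont)
      filter_upwards [hB, hti] with i h1 h2
      refine (dist_triangle _ (augFlow X₀ (t i)) _).trans (add_le_add ?_ le_rfl)
      have bi := hR T _ _ (augFlow_augSol (X i) (hC i) h1)
      have := hM T _ _ ((augFlow_solves (X i)).solvesOn T) ((augFlow_solves X₀).solvesOn T)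
        (fun s hs => (bi s hs).1) (fun s hs => (b0 s hs).1) (t i) ⟨(t i).2, h2⟩
      -- All spinors start from the same constants, so the initial distance is that of the points of
      -- E.
      have e : dist (augFlow (X i) 0) (augFlow X₀ 0) = dist (X i).1 X₀.1 := by
        rw [augFlow_zero, augFlow_zero, augInit, augInit, Prod.dist_eq, dist_self]
        exact max_eq_left dist_nonneg
      rw [e] at this
      refine this.trans (mul_le_mul_of_nonneg_left (Real.exp_le_exp.2 ?_) dist_nonneg)
      exact mul_le_mul (le_abs_self M) h2 (t i).2 (abs_nonneg M)
    exact near.fst_nhds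
  · filter_upwards [hB, hti] with i h1 h2
    exact (hR T _ _ (augFlow_augSol (X i) (hC i) h1) (t i) ⟨(t i).2, h2⟩).2

end Continuity

/-! ### The semigroup on `ℱ/G` -/

section Semigroup

variable {χ : PartitionFunction}

/-- Γ(X) satisfies y + H = id. Thus every class has a representative in the cone with constant 1,
whatever cone X lies in; this uniformity gives continuity on the whole quotient and not just on
pieces of it. -/
lemma F.Gam_cone (X : F χ) : Cone χ 1 X.Gam.1 := by
  obtain ⟨K, hK, hC⟩ := E.exists_cone_of_memF X.Gam.2
  refine E.cone_one hK hC fun ξ => ?_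
  have e : X.Gam.total = 1 := by rw [F.Gam, F.total_relabel, mul_inv_cancel]
  rw [← F.total_apply, e]; rfl

/-- The flow induced on `ℱ/G`. -/
def flowQ (t : ℝ≥0) : FmodG χ → FmodG χ :=
  Quotient.map (flow t) (by
    rintro X _ ⟨f, rfl⟩
    exact ⟨f, flow_relabel t X f⟩)

lemma flowQ_proj (t : ℝ≥0) (X : F χ) : flowQ t (FmodG.proj X) = FmodG.proj (flow t X) := rfl

lemma flowQ_zero (a : FmodG χ) : flowQ 0 a = a := by
  refine Quotient.inductionOn a fun X => ?_
  exact (flowQ_proj 0 X).trans (congrArg FmodG.proj (flow_zero X))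

lemma flowQ_add (s t : ℝ≥0) (a : FmodG χ) : flowQ (s + t) a = flowQ s (flowQ t a) := by
  refine Quotient.inductionOn a fun X => ?_
  exact (flowQ_proj (s + t) X).trans (congrArg FmodG.proj (flow_add s t X))

/-- The representative `Γ(X)` of the class `[X]`. -/
def FmodG.rep : FmodG χ → F χ :=
  Quotient.lift F.Gam (by
    rintro X _ ⟨f, rfl⟩
    exact (F.Gam_relabel X f).symm)

lemma FmodG.rep_val (a : FmodG χ) : a.rep.1 = a.GamTilde :=
  Quotient.inductionOn a fun _ => rfl

lemma FmodG.proj_rep (a : FmodG χ) : proj a.rep = a := by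
  refine Quotient.inductionOn a fun X => ?_
  exact Quotient.sound (Setoid.symm ⟨X.total⁻¹, rfl⟩)

lemma FmodG.rep_cone (a : FmodG χ) : Cone χ 1 a.rep.1 :=
  Quotient.inductionOn a fun X => X.Gam_cone

/-- The metric is induced by `FmodG.GamTilde`, so the claim is the continuity of (t, a) ↦
Γ(S_t(Γ(a))) into E. The representatives depend continuously on a by definition and lie in one cone,
the flow keeps nearby ones in a common cone, and there Γ is continuous. -/
lemma continuous_flowQ : Continuous fun p : ℝ≥0 × FmodG χ => flowQ p.1 p.2 := by
  have hind : IsInducing (FmodG.GamTilde (χ := χ)) := ⟨rfl⟩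
  rw [hind.continuous_iff, continuous_iff_continuousAt]
  rintro ⟨t₀, a₀⟩
  have e : ∀ (t : ℝ≥0) (a : FmodG χ), (flowQ t a).GamTilde = (flow t a.rep).Gam.1 := fun t a => by
    conv_lhs => rw [← a.proj_rep]
    rfl
  have hX : Tendsto (fun p : ℝ≥0 × FmodG χ => p.2.rep.1) (𝓝 (t₀, a₀)) (𝓝 a₀.rep.1) := by
    simp only [FmodG.rep_val]
    exact (hind.continuous.comp continuous_snd).tendsto (t₀, a₀)
  obtain ⟨h1, R, hR, h2, h3⟩ := tendsto_flow one_pos (fun p : ℝ≥0 × FmodG χ => p.2.rep_cone)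
    a₀.rep_cone (continuous_fst.tendsto (t₀, a₀)) hX
  have := F.tendsto_Gam hR h2 h3 h1
  simp only [ContinuousAt, Function.comp_def, e]
  exact this

end Semigroup

end

end CamassaHolm

/-! ### The main theorem. -/

theorem mainTheorem7 (χ : PartitionFunction) :
    ∃ S : ℝ≥0 → F χ → F χ,
      -- `S` is the flow of the governing system on `ℱ`
      (∀ X₀ : F χ, S 0 X₀ = X₀ ∧ IsGlobalSolution χ (fun t => (S t X₀).1) ∧
        ∀ Z : ℝ≥0 → E, IsGlobalSolution χ Z → (∀ t, MemG χ (Z t)) → Z 0 = X₀.1 →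
          ∀ t, Z t = (S t X₀).1) ∧
      -- equivariance
      (∀ (t : ℝ≥0) (X : F χ) (f : Relabeling), S t (X.relabel f) = (S t X).relabel f) ∧
      -- the induced continuous semigroup on `ℱ/G`
      ∃ T : ℝ≥0 → FmodG χ → FmodG χ,
        (∀ (t : ℝ≥0) (X : F χ), T t (FmodG.proj X) = FmodG.proj (S t X)) ∧
        (∀ a : FmodG χ, T 0 a = a) ∧
        (∀ (s t : ℝ≥0) (a : FmodG χ), T (s + t) a = T s (T t a)) ∧
        Continuous (fun p : ℝ≥0 × FmodG χ => T p.1 p.2) := by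
  refine ⟨flow, fun X₀ => ⟨flow_zero X₀, isGlobalSolution_flow X₀, fun Z hZ hG h0 t => ?_⟩,
    flow_relabel, flowQ, flowQ_proj, flowQ_zero, flowQ_add, continuous_flowQ⟩
  have := flow_unique (X := X₀) (hZ.solvesGlobally hG)
    (by rw [Real.toNNReal_zero]; exact h0) t
  rwa [Real.toNNReal_coe] at this
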